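/- For every $n$ let $X_1,\dots,X_n$ be i.i.d. random variables with values in a measurable space $\mathcal X$ and common law $P$, and let $\mathcal F$ be a class of real-valued symmetric functions on $\mathcal X\times\mathcal X$ with a measurable envelope $F$, i.e. $|f|\le F$ for all $f\in\mathcal F$ (the sample, $\mathcal X$, $P$, $\mathcal F$ and $F$ may all depend on $n$). Assume that $\mathcal F$ is pointwise measurable (its members are measurable, and it has a countable subclass $\mathcal G$ such that every $f\in\mathcal F$ is the pointwise limit of a sequence from $\mathcal G$), that $M:=\sup F<\infty$, and that each $f\in\mathcal F$ is $P$-degenerate: $\int f(x,y)\,dP(y)=0$ for all $x\in\mathcal X$. Write $\mathcal U_n f=\frac1{n(n-1)}\sum_{i\neq j}f(X_i,X_j)$, $\|g\|_{Q,2}=(\int g^2\,dQ)^{1/2}$ (with $\|F\|_{P,2}$ computed under $P\otimes P$), $l_f(x)=\int f^2(x,y)\,dP(y)$, $L(x)=\int F^2(x,y)\,dP(y)$, $M_L=\sup_x L(x)$, $$\sigma_2^2=\sup_{f\in\mathcal F}\int f^2\,d(P\otimes P),\qquad \sigma_1^2=\sup_{f\in\mathcal F}\int l_f^2\,dP,$$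 and assume $\sigma_2>0$. Suppose there are constants $A=A_n\ge e$ and $v=v_n$, with $v_n$ bounded below by a positive constant independent of $n$, such that $$\sup_Q N\big(\varepsilon\|F\|_{Q,2},e_Q,\mathcal F\big)\le\Big(\frac A\varepsilon\Big)^v\qquad\text{for all }0<\varepsilon\le1,$$ where the supremum is over all finitely discrete probability measures $Q$ on $\mathcal X\times\mathcal X$ and $N(r,e_Q,\mathcal F)$ is the least number of closed balls of radius $r$ in $L^2(Q)$ (with centres anywhere in $L^2(Q)$) that cover $\mathcal F$. Then, as $n\to\infty$, $$\sup_{f\in\mathcal F}|\mathcal U_n f|=O_p\Big(\frac{(\sigma_2+\pi)v}{n}\log\frac{A\|F\|_{P,2}}{\sigma_2}+\frac{M}{n^2}v^2\log^2\frac{A\|F\|_{P,2}}{\sigma_2}\Big),$$ where $\pi\ge0$ is given by $$\pi^2=\sqrt{\frac{v\sigma_1^2}{n}\log\frac{2A\|L\|_{P,2}}{\sigma_1}}+\frac{v\,\|M_L\|_{P,2}}{n}\log\frac{2A\|L\|_{P,2}}{\sigma_1}$$ (and $\|M_L\|_{P,2}=M_L$, as $M_L$ is a constant). -/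

import Mathlib

open MeasureTheory ProbabilityTheory Filter Topology
open scoped ENNReal NNReal

namespace UStatistic

noncomputable section

/-- `Y n = O_p(r n)` for random variables `Y n` defined on probability spaces `(Ω n, μ n)` and
deterministic `r n`. (The measure of a set is its outer measure if the set is not measurable.) -/
def IsBigOp {Ω : ℕ → Type*} [∀ n, MeasurableSpace (Ω n)] (μ : ∀ n, Measure (Ω n))
    (Y : ∀ n, Ω n → ℝ) (r : ℕ → ℝ) : Prop :=
  ∀ δ : ℝ, 0 < δ → ∃ K : ℝ, 0 < K ∧
    ∀ᶠ n in atTop, μ n {ω | K * r n < |Y n ω|} ≤ ENNReal.ofReal δ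

section Norms

variable {α : Type*} [MeasurableSpace α]

/-- The norm `‖f‖_{Q,2}`. -/
def l2Norm (Q : Measure α) (f : α → ℝ) : ℝ≥0 := (eLpNorm f 2 Q).toNNReal

/-- `Q` is a probability measure supported on finitely many points. -/
def IsFinitelyDiscrete (Q : Measure α) : Prop :=
  IsProbabilityMeasure Q ∧
    ∃ (s : Finset α) (w : α → ℝ≥0∞), Q = ∑ x ∈ s, w x • Measure.dirac x

/-- The class `C`, viewed as a subset of `L²(Q)`. -/
def l2Class (Q : Measure α) (C : Set (α → ℝ)) : Set (Lp ℝ 2 Q) :=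
  {g | ∃ f ∈ C, g =ᵐ[Q] f}

/-- The covering number `N(r, e_Q, C)`: the least number of closed balls of radius `r` in `L²(Q)`
which cover `C`. -/
def coverNum (Q : Measure α) (r : ℝ≥0) (C : Set (α → ℝ)) : ℕ∞ :=
  Metric.externalCoveringNumber r (l2Class Q C)

/-- The uniform entropy bound `sup_Q N(ε ‖F‖_{Q,2}, e_Q, C) ≤ (A / ε) ^ v` for `0 < ε ≤ 1`, the
supremum being over all finitely discrete probability measures `Q`. -/
def UniformEntropyBound (C : Set (α → ℝ)) (F : α → ℝ) (A v : ℝ) : Prop :=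
  ∀ Q : Measure α, IsFinitelyDiscrete Q → ∀ ε : ℝ, 0 < ε → ε ≤ 1 →
    (coverNum Q (ε.toNNReal * l2Norm Q F) C : ℝ≥0∞) ≤ ENNReal.ofReal ((A / ε) ^ v)

/-- A pointwise measurable class: measurable functions, and a countable subclass whose pointwise
sequential limits exhaust the class. -/
def PointwiseMeasurable (C : Set (α → ℝ)) : Prop :=
  (∀ f ∈ C, Measurable f) ∧
    ∃ G ⊆ C, G.Countable ∧
      ∀ f ∈ C, ∃ g : ℕ → α → ℝ, (∀ m, g m ∈ G) ∧
        ∀ x, Tendsto (fun m => g m x) atTop (𝓝 (f x))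

end Norms

section Kernels

variable {S : Type*}

/-- `𝒰_n f = (1 / (n (n - 1))) ∑_{i ≠ j} f (x_i, x_j)`. -/
def uStat {n : ℕ} (x : Fin n → S) (f : S × S → ℝ) : ℝ :=
  1 / ((n : ℝ) * ((n : ℝ) - 1)) *
    ∑ i : Fin n, ∑ j ∈ Finset.univ.filter (fun j => i ≠ j), f (x i, x j)

variable [MeasurableSpace S]

/-- `x ↦ 𝔼 f²(x, ·)`. -/
def secondMoment (P : Measure S) (f : S × S → ℝ) (x : S) : ℝ := ∫ y, f (x, y) ^ 2 ∂P

/-- `f` is `P`-degenerate. -/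
def Degenerate (P : Measure S) (f : S × S → ℝ) : Prop := ∀ x, ∫ y, f (x, y) ∂P = 0

/-- `σ₂`, where `σ₂² = sup_f 𝔼 f²`. -/
def sigma2 (P : Measure S) (C : Set (S × S → ℝ)) : ℝ :=
  Real.sqrt (⨆ f : C, ∫ z, f.1 z ^ 2 ∂(P.prod P))

/-- `σ₁`, where `σ₁² = sup_f 𝔼 l_f²` and `l_f (x) = 𝔼 f²(x, ·)`. -/
def sigma1 (P : Measure S) (C : Set (S × S → ℝ)) : ℝ :=
  Real.sqrt (⨆ f : C, ∫ x, secondMoment P f.1 x ^ 2 ∂P)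

/-- `M = sup F`. -/
def envSup (F : S × S → ℝ) : ℝ := ⨆ z, F z

/-- `M_L = sup L`, where `L (x) = 𝔼 F²(x, ·)`. -/
def envLSup (P : Measure S) (F : S × S → ℝ) : ℝ := ⨆ x, secondMoment P F x

/-- `log (2 A ‖L‖_{P,2} / σ₁)`. -/
def log1 (P : Measure S) (C : Set (S × S → ℝ)) (F : S × S → ℝ) (A : ℝ) : ℝ :=
  Real.log (2 * A * l2Norm P (secondMoment P F) / sigma1 P C)

/-- `log (A ‖F‖_{P,2} / σ₂)`. -/
def log2 (P : Measure S) (C : Set (S × S → ℝ)) (F : S × S → ℝ) (A : ℝ) : ℝ :=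
  Real.log (A * l2Norm (P.prod P) F / sigma2 P C)

/-- `π`, where `π²` is
`√(v σ₁² / n · log (2A‖L‖_{P,2} / σ₁)) + (v ‖M_L‖_{P,2} / n) log (2A‖L‖_{P,2} / σ₁)`. -/
def piTerm (P : Measure S) (C : Set (S × S → ℝ)) (F : S × S → ℝ) (A v : ℝ) (n : ℕ) : ℝ :=
  Real.sqrt
    (Real.sqrt (v * sigma1 P C ^ 2 / n * log1 P C F A) +
      v * l2Norm P (fun _ => envLSup P F) / n * log1 P C F A)

/-- `((σ₂ + π) v / n) log (A‖F‖_{P,2}/σ₂) + (M / n²) v² log² (A‖F‖_{P,2}/σ₂)`. -/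
def rate (P : Measure S) (C : Set (S × S → ℝ)) (F : S × S → ℝ) (A v : ℝ) (n : ℕ) : ℝ :=
  (sigma2 P C + piTerm P C F A v n) * v / n * log2 P C F A +
    envSup F / (n : ℝ) ^ 2 * v ^ 2 * log2 P C F A ^ 2

end Kernels

end

end UStatistic

namespace UStatistic

noncomputable section

/-- The uniform average of a function on a finite type. -/
def avg {Ω : Type*} [Fintype Ω] (φ : Ω → ℝ) : ℝ := (∑ ω, φ ω) / Fintype.card Ω

section Average

variable {Ω Ω' : Type*} [Fintype Ω] [Fintype Ω']

lemma avg_mono {φ ψ : Ω → ℝ} (h : ∀ ω, φ ω ≤ ψ ω) : avg φ ≤ avg ψ := by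
  unfold avg; gcongr with ω; exact h ω

lemma avg_add (φ ψ : Ω → ℝ) : avg (fun ω => φ ω + ψ ω) = avg φ + avg ψ := by
  simp [avg, Finset.sum_add_distrib, add_div]

lemma avg_mul_left (c : ℝ) (φ : Ω → ℝ) : avg (fun ω => c * φ ω) = c * avg φ := by
  simp [avg, ← Finset.mul_sum, mul_div_assoc]

lemma avg_const [Nonempty Ω] (c : ℝ) : avg (fun _ : Ω => c) = c := by
  have : (Fintype.card Ω : ℝ) ≠ 0 := by exact_mod_cast Fintype.card_ne_zero
  simp [avg]

lemma avg_equiv (e : Ω ≃ Ω) (φ : Ω → ℝ) : avg (fun ω => φ (e ω)) = avg φ := by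
  unfold avg; rw [e.sum_comp]

lemma avg_comm (φ : Ω → Ω' → ℝ) :
    avg (fun ω => avg (fun ω' => φ ω ω')) = avg (fun ω' => avg (fun ω => φ ω ω')) := by
  simp only [avg, ← Finset.sum_div]
  rw [Finset.sum_comm, div_right_comm]

lemma avg_sum {ι : Type*} (s : Finset ι) (φ : ι → Ω → ℝ) :
    avg (fun ω => ∑ i ∈ s, φ i ω) = ∑ i ∈ s, avg (φ i) := by
  simp only [avg, ← Finset.sum_div]
  rw [Finset.sum_comm]

lemma avg_nonneg {φ : Ω → ℝ} (h : ∀ ω, 0 ≤ φ ω) : 0 ≤ avg φ :=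
  div_nonneg (Finset.sum_nonneg fun ω _ => h ω) (by positivity)

lemma exp_avg_le [Nonempty Ω] (φ : Ω → ℝ) :
    Real.exp (avg φ) ≤ avg (fun ω => Real.exp (φ ω)) := by
  have hc : (Fintype.card Ω : ℝ) ≠ 0 := by exact_mod_cast Fintype.card_ne_zero
  have := convexOn_exp.map_sum_le (t := Finset.univ) (w := fun _ : Ω => (Fintype.card Ω : ℝ)⁻¹)
    (p := φ) (fun _ _ => by positivity) (by simp [hc]) (fun _ _ => Set.mem_univ _)
  simpa [avg, ← Finset.mul_sum, div_eq_inv_mul] using this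

lemma sq_avg_le [Nonempty Ω] (φ : Ω → ℝ) : avg φ ^ 2 ≤ avg (fun ω => φ ω ^ 2) := by
  have h : 0 ≤ avg (fun ω => (φ ω - avg φ) ^ 2) := avg_nonneg fun ω => sq_nonneg _
  have e : avg (fun ω => (φ ω - avg φ) ^ 2) = avg (fun ω => φ ω ^ 2) - avg φ ^ 2 := by
    have : (fun ω => (φ ω - avg φ) ^ 2) =
        fun ω => (φ ω ^ 2 + (-2 * avg φ) * φ ω) + avg φ ^ 2 := by ext ω; ring
    rw [this, avg_add, avg_add, avg_mul_left, avg_const]; ring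
  linarith

/-- A maximal inequality: the mean of the maximum of `N` variables with exponential moments bounded
by `4` is at most `log (4 N)`. -/
lemma avg_sup'_le [Nonempty Ω] {κ : Type*} (K : Finset κ) (hK : K.Nonempty) (Y : κ → Ω → ℝ)
    (h : ∀ k ∈ K, avg (fun ω => Real.exp (Y k ω)) ≤ 4) :
    avg (fun ω => K.sup' hK (fun k => Y k ω)) ≤ Real.log (4 * K.card) := by
  have hc : (0 : ℝ) < K.card := by exact_mod_cast hK.card_pos
  rw [Real.le_log_iff_exp_le (by positivity)]
  calc _ ≤ avg (fun ω => Real.exp (K.sup' hK (fun k => Y k ω))) := exp_avg_le _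
    _ ≤ avg (fun ω => ∑ k ∈ K, Real.exp (Y k ω)) := by
        refine avg_mono fun ω => ?_
        obtain ⟨k, hk, e⟩ := K.exists_mem_eq_sup' hK (fun k => Y k ω)
        rw [e]
        exact Finset.single_le_sum (f := fun k => Real.exp (Y k ω))
          (fun i _ => (Real.exp_pos _).le) hk
    _ = ∑ k ∈ K, avg (fun ω => Real.exp (Y k ω)) := avg_sum _ _
    _ ≤ ∑ k ∈ K, 4 := Finset.sum_le_sum h
    _ = _ := by simp [mul_comm]

end Average

/-- A sign, as a real number. -/
def sgn (u : ℤˣ) : ℝ := ((u : ℤ) : ℝ)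

@[simp] lemma sgn_one : sgn 1 = 1 := by simp [sgn]

@[simp] lemma sgn_neg_one : sgn (-1) = -1 := by simp [sgn]

@[simp] lemma sgn_mul (u w : ℤˣ) : sgn (u * w) = sgn u * sgn w := by simp [sgn]

@[simp] lemma sgn_mul_self (u : ℤˣ) : sgn u * sgn u = 1 := by
  rcases Int.units_eq_one_or u with rfl | rfl <;> simp

@[simp] lemma sgn_sq (u : ℤˣ) : sgn u ^ 2 = 1 := by rw [sq, sgn_mul_self]

section Signs

variable {n : ℕ}

lemma avg_exp_linear_le (c : Fin n → ℝ) :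
    avg (fun ε : Fin n → ℤˣ => Real.exp (∑ i, c i * sgn (ε i))) ≤
      Real.exp ((∑ i, c i ^ 2) / 2) := by
  have h1 : avg (fun ε : Fin n → ℤˣ => Real.exp (∑ i, c i * sgn (ε i))) =
      ∏ i, Real.cosh (c i) := by
    simp only [avg, Real.exp_sum]
    rw [← Fintype.prod_sum (fun i (u : ℤˣ) => Real.exp (c i * sgn u))]
    have : ∀ i, ∑ u : ℤˣ, Real.exp (c i * sgn u) = 2 * Real.cosh (c i) := by
      intro i
      rw [show (Finset.univ : Finset ℤˣ) = {1, -1} from rfl, Finset.sum_pair (by decide)]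
      simp [Real.cosh_eq]; ring
    rw [Finset.prod_congr rfl fun i _ => this i, Finset.prod_mul_distrib]
    simp
  rw [h1, Finset.sum_div, Real.exp_sum]
  exact Finset.prod_le_prod (fun i _ => (Real.cosh_pos _).le)
    (fun i _ => Real.cosh_le_exp_half_sq _)

lemma integral_exp_mul_sub_half_sq (c : ℝ) :
    Integrable (fun x : ℝ => Real.exp (c * x - x ^ 2 / 2)) ∧
    ∫ x : ℝ, Real.exp (c * x - x ^ 2 / 2) = √(2 * Real.pi) * Real.exp (c ^ 2 / 2) := by
  have e : (fun x : ℝ => Real.exp (c * x - x ^ 2 / 2)) =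
      fun x => Real.exp (c ^ 2 / 2) * Real.exp (-(1 / 2) * (x - c) ^ 2) := by
    ext x; rw [← Real.exp_add]; congr 1; ring
  rw [e]
  constructor
  · exact ((integrable_exp_neg_mul_sq (b := 1 / 2) (by norm_num)).comp_sub_right c).const_mul _
  · rw [integral_const_mul, integral_sub_right_eq_self (fun x => Real.exp (-(1 / 2) * x ^ 2)),
      integral_gaussian, mul_comm]
    congr 2; ring

/-- Square-exponential integrability of normalised Rademacher sums. -/
lemma avg_exp_sq_linear_le (b : Fin n → ℝ) (hb : ∑ i, b i ^ 2 ≤ 1) :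
    avg (fun ε : Fin n → ℤˣ => Real.exp (3 / 8 * (∑ i, b i * sgn (ε i)) ^ 2)) ≤ 2 := by
  have hp : 0 < √(2 * Real.pi) := by positivity
  have key : √(2 * Real.pi) *
      avg (fun ε : Fin n → ℤˣ => Real.exp (3 / 8 * (∑ i, b i * sgn (ε i)) ^ 2)) ≤
      √(2 * Real.pi) * 2 := by
    have h34 : √(3 / 4 : ℝ) ^ 2 = 3 / 4 := Real.sq_sqrt (by norm_num)
    calc _ = avg (fun ε : Fin n → ℤˣ => ∫ x : ℝ,
          Real.exp ((√(3 / 4) * ∑ i, b i * sgn (ε i)) * x - x ^ 2 / 2)) := by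
          rw [← avg_mul_left]
          congr 1; ext ε
          rw [(integral_exp_mul_sub_half_sq _).2, mul_pow, h34]
          congr 2; ring
      _ = ∫ x : ℝ, avg (fun ε : Fin n → ℤˣ =>
          Real.exp ((√(3 / 4) * ∑ i, b i * sgn (ε i)) * x - x ^ 2 / 2)) := by
          simp only [avg]
          rw [integral_div, integral_finsetSum]
          exact fun ε _ => (integral_exp_mul_sub_half_sq _).1
      _ ≤ ∫ x : ℝ, Real.exp (-(1 / 8) * x ^ 2) := by
          refine integral_mono ?_ (integrable_exp_neg_mul_sq (by norm_num)) fun x => ?_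
          · simp only [avg]
            exact (integrable_finsetSum _ fun ε _ => (integral_exp_mul_sub_half_sq _).1).div_const _
          · simp only
            have h := avg_exp_linear_le (fun i => √(3 / 4) * x * b i)
            have e : (fun ε : Fin n → ℤˣ =>
                Real.exp ((√(3 / 4) * ∑ i, b i * sgn (ε i)) * x - x ^ 2 / 2)) =
                fun ε => Real.exp (-(x ^ 2 / 2)) *
                  Real.exp (∑ i, √(3 / 4) * x * b i * sgn (ε i)) := by
              ext ε
              rw [← Real.exp_add, Finset.mul_sum, Finset.sum_mul]
              congr 1
              rw [neg_add_eq_sub]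
              congr 1
              exact Finset.sum_congr rfl fun i _ => by ring
            rw [e, avg_mul_left]
            calc _ ≤ Real.exp (-(x ^ 2 / 2)) *
                  Real.exp ((∑ i, (√(3 / 4) * x * b i) ^ 2) / 2) := by gcongr
              _ ≤ _ := by
                rw [← Real.exp_add, Real.exp_le_exp]
                have : ∑ i, (√(3 / 4) * x * b i) ^ 2 = 3 / 4 * x ^ 2 * ∑ i, b i ^ 2 := by
                  rw [Finset.mul_sum]
                  exact Finset.sum_congr rfl fun i _ => by rw [mul_pow, mul_pow, h34]
                rw [this]
                nlinarith [mul_le_mul_of_nonneg_left hb (sq_nonneg x)]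
      _ = √(2 * Real.pi) * 2 := by
          rw [integral_gaussian, show Real.pi / (1 / 8) = 2 * Real.pi * 2 ^ 2 by ring,
            Real.sqrt_mul (by positivity), Real.sqrt_sq (by norm_num)]
  exact le_of_mul_le_mul_left key hp

lemma avg_exp_sum_sq_linear_le {m : ℕ} (a : Fin n → Fin m → ℝ)
    (ha : ∑ j, ∑ i, a i j ^ 2 ≤ 1) :
    avg (fun ε : Fin n → ℤˣ => Real.exp (3 / 8 * ∑ j, (∑ i, a i j * sgn (ε i)) ^ 2)) ≤ 2 := by
  set s : Fin m → ℝ := fun j => ∑ i, a i j ^ 2 with hs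
  have hs0 : ∀ j, 0 ≤ s j := fun j => Finset.sum_nonneg fun i _ => sq_nonneg _
  have hz : ∀ j, s j = 0 → ∀ i, a i j = 0 := by
    intro j hj i
    have := (Finset.sum_eq_zero_iff_of_nonneg (fun i _ => sq_nonneg (a i j))).1 hj i
      (Finset.mem_univ i)
    exact pow_eq_zero_iff (two_ne_zero) |>.1 this
  rcases (Finset.sum_nonneg fun j _ => hs0 j : 0 ≤ ∑ j, s j).eq_or_lt with h0 | h0
  · have : ∀ j, s j = 0 := fun j =>
      (Finset.sum_eq_zero_iff_of_nonneg (fun j _ => hs0 j)).1 h0.symm j (Finset.mem_univ j)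
    have hz' : ∀ i j, a i j = 0 := fun i j => hz j (this j) i
    simp only [hz', zero_mul, Finset.sum_const_zero]
    norm_num [avg_const]
  set T := ∑ j, s j with hT
  have hT1 : T ≤ 1 := ha
  calc _ ≤ avg (fun ε : Fin n → ℤˣ => ∑ j, s j / T *
        Real.exp (3 / 8 * (∑ i, (a i j * √(T / s j)) * sgn (ε i)) ^ 2)) := by
        refine avg_mono fun ε => ?_
        have := convexOn_exp.map_sum_le (t := Finset.univ) (w := fun j => s j / T)
          (p := fun j => 3 / 8 * (∑ i, (a i j * √(T / s j)) * sgn (ε i)) ^ 2)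
          (fun j _ => div_nonneg (hs0 j) h0.le) (by rw [← Finset.sum_div, ← hT, div_self h0.ne'])
          (fun _ _ => Set.mem_univ _)
        simp only [smul_eq_mul] at this
        refine le_trans (le_of_eq ?_) this
        congr 1
        rw [Finset.mul_sum]
        refine Finset.sum_congr rfl fun j _ => ?_
        rcases (hs0 j).eq_or_lt with hj | hj
        · simp [hz j hj.symm]
        · have : ∑ i, (a i j * √(T / s j)) * sgn (ε i) =
              √(T / s j) * ∑ i, a i j * sgn (ε i) := by
            rw [Finset.mul_sum]; exact Finset.sum_congr rfl fun i _ => by ring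
          rw [this, mul_pow, Real.sq_sqrt (by positivity)]
          field_simp
    _ = ∑ j, s j / T * avg (fun ε : Fin n → ℤˣ =>
        Real.exp (3 / 8 * (∑ i, (a i j * √(T / s j)) * sgn (ε i)) ^ 2)) := by
        rw [avg_sum]; simp only [avg_mul_left]
    _ ≤ ∑ j, s j / T * 2 := by
        refine Finset.sum_le_sum fun j _ => ?_
        refine mul_le_mul_of_nonneg_left (avg_exp_sq_linear_le _ ?_) (div_nonneg (hs0 j) h0.le)
        simp only [mul_pow, ← Finset.sum_mul]
        rw [Real.sq_sqrt (div_nonneg h0.le (hs0 j))]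
        change s j * (T / s j) ≤ 1
        rcases (hs0 j).eq_or_lt with hj | hj
        · simp [← hj]
        · rw [mul_div_cancel₀ _ hj.ne']; exact hT1
    _ = 2 := by rw [← Finset.sum_mul, ← Finset.sum_div, ← hT, div_self h0.ne', one_mul]

/-- The Rademacher chaos `∑_{i ≠ j} a_{ij} ε_i ε_j`. -/
def chaos (a : Fin n → Fin n → ℝ) (ε : Fin n → ℤˣ) : ℝ :=
  ∑ i, ∑ j ∈ Finset.univ.filter (fun j => i ≠ j), a i j * (sgn (ε i) * sgn (ε j))

lemma avg_exp_bipartite_le (I : Fin n → Prop) [DecidablePred I] (a : Fin n → Fin n → ℝ)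
    (ha : ∑ j, ∑ i, a i j ^ 2 ≤ 1) (t : ℝ) (ht : t ^ 2 ≤ 3 / 4) :
    avg (fun ε : Fin n → ℤˣ => Real.exp (t *
      ∑ j, ∑ i, (if I i ∧ ¬ I j then a i j else 0) * (sgn (ε i) * sgn (ε j)))) ≤ 2 := by
  set ψ : (Fin n → ℤˣ) → ℝ := fun ε => Real.exp (t *
      ∑ j, ∑ i, (if I i ∧ ¬ I j then a i j else 0) * (sgn (ε i) * sgn (ε j))) with hψ
  let m : (Fin n → ℤˣ) → (Fin n → ℤˣ) := fun u i => if I i then 1 else u i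
  have h1 : avg ψ = avg (fun ε => avg (fun u => ψ (m u * ε))) := by
    rw [avg_comm]
    have : ∀ u, avg (fun ε => ψ (m u * ε)) = avg ψ := fun u => avg_equiv (Equiv.mulLeft (m u)) ψ
    simp only [this, avg_const]
  rw [h1]
  refine le_trans (avg_mono (ψ := fun ε => Real.exp (3 / 8 * ∑ j, (∑ i,
    (if I i ∧ ¬ I j then a i j else 0) * sgn (ε i)) ^ 2)) fun ε => ?_) ?_
  · have := avg_exp_linear_le (fun j => t * sgn (ε j) *
      ∑ i, (if I i ∧ ¬ I j then a i j else 0) * sgn (ε i))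
    refine le_trans (le_of_eq ?_) (this.trans ?_)
    · congr 1; ext u
      simp only [hψ]
      congr 1
      rw [Finset.mul_sum]
      refine Finset.sum_congr rfl fun j _ => ?_
      rw [Finset.mul_sum, Finset.mul_sum, Finset.sum_mul]
      refine Finset.sum_congr rfl fun i _ => ?_
      by_cases hi : I i <;> by_cases hj : I j <;> simp [hi, hj, m]
      ring
    · rw [Real.exp_le_exp]
      simp only [mul_pow, sgn_sq, mul_one, ← Finset.mul_sum]
      have : 0 ≤ ∑ j, (∑ i, (if I i ∧ ¬ I j then a i j else 0) * sgn (ε i)) ^ 2 :=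
        Finset.sum_nonneg fun j _ => sq_nonneg _
      nlinarith
  · refine avg_exp_sum_sq_linear_le (fun i j => if I i ∧ ¬ I j then a i j else 0) (le_trans ?_ ha)
    refine Finset.sum_le_sum fun j _ => Finset.sum_le_sum fun i _ => ?_
    split_ifs
    · exact le_rfl
    · simpa using sq_nonneg (a i j)

lemma avg_ite_and {i j : Fin n} (hij : i ≠ j) (c : ℝ) :
    avg (fun δ : Fin n → ℤˣ => if δ i = 1 ∧ ¬ δ j = 1 then c else 0) = c / 4 := by
  have e : (fun δ : Fin n → ℤˣ => if δ i = 1 ∧ ¬ δ j = 1 then c else 0) =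
      fun δ => ∏ k, ((if k = i then (if δ k = 1 then c else 0) else
        if k = j then (if δ k = 1 then 0 else 1) else 1) : ℝ) := by
    ext δ
    rw [← Finset.mul_prod_erase _ _ (Finset.mem_univ i),
      ← Finset.mul_prod_erase _ _ (Finset.mem_erase.2 ⟨hij.symm, Finset.mem_univ j⟩),
      Finset.prod_eq_one]
    · by_cases h1 : δ i = 1 <;> by_cases h2 : δ j = 1 <;> simp [h1, h2, hij.symm]
    · intro k hk
      simp only [Finset.mem_erase, Finset.mem_univ, and_true] at hk
      simp [hk.1, hk.2]
  have hs : ∀ f : ℤˣ → ℝ, ∑ u, f u = f 1 + f (-1) := fun f => by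
    rw [show (Finset.univ : Finset ℤˣ) = {1, -1} from rfl, Finset.sum_pair (by decide)]
  rw [e, avg, ← Fintype.prod_sum (fun k (u : ℤˣ) => ((if k = i then (if u = 1 then c else 0) else
        if k = j then (if u = 1 then 0 else 1) else 1) : ℝ))]
  have : ∀ k, ∑ u : ℤˣ, ((if k = i then (if u = 1 then c else 0) else
        if k = j then (if u = 1 then 0 else 1) else 1) : ℝ) =
      2 * (if k = i then c / 2 else 1) * (if k = j then 1 / 2 else 1) := by
    intro k
    rw [hs]
    have h1 : ¬ (-1 : ℤˣ) = 1 := by decide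
    by_cases hi : k = i
    · have : k ≠ j := fun h => hij (hi.symm.trans h)
      simp [hi, h1, hij]; ring
    · by_cases hj : k = j
      · simp [hj, h1, hij.symm]
      · simp [hi, hj]; norm_num
  simp only [this, Finset.prod_mul_distrib, Finset.prod_ite_eq', Finset.mem_univ, if_true]
  simp
  field_simp
  norm_num

lemma avg_exp_chaos_le (a : Fin n → Fin n → ℝ)
    (ha : ∑ j, ∑ i, a i j ^ 2 ≤ 1) (t : ℝ) (ht : t ^ 2 ≤ 3 / 64) :
    avg (fun ε : Fin n → ℤˣ => Real.exp (t * chaos a ε)) ≤ 2 := by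
  have key : ∀ ε : Fin n → ℤˣ, t * chaos a ε = avg (fun δ : Fin n → ℤˣ => (4 * t) *
      ∑ j, ∑ i, (if δ i = 1 ∧ ¬ δ j = 1 then a i j else 0) * (sgn (ε i) * sgn (ε j))) := by
    intro ε
    rw [avg_mul_left, avg_sum]
    simp only [avg_sum]
    unfold chaos
    rw [Finset.sum_comm, mul_assoc, mul_left_comm]
    congr 1
    rw [Finset.mul_sum]
    refine Finset.sum_congr rfl fun i _ => ?_
    rw [Finset.sum_filter, Finset.mul_sum]
    refine Finset.sum_congr rfl fun j _ => ?_
    have e2 : ∀ δ : Fin n → ℤˣ,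
        (if δ i = 1 ∧ ¬ δ j = 1 then a i j else 0) * (sgn (ε i) * sgn (ε j)) =
        (sgn (ε i) * sgn (ε j)) * (if δ i = 1 ∧ ¬ δ j = 1 then a i j else 0) :=
      fun δ => mul_comm _ _
    simp only [e2, avg_mul_left]
    by_cases hij : i = j
    · subst hij; simp [avg]
    · rw [avg_ite_and hij]; simp [hij]; ring
  calc _ ≤ avg (fun ε : Fin n → ℤˣ => avg (fun δ : Fin n → ℤˣ => Real.exp ((4 * t) *
      ∑ j, ∑ i, (if δ i = 1 ∧ ¬ δ j = 1 then a i j else 0) * (sgn (ε i) * sgn (ε j))))) :=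
        avg_mono fun ε => by rw [key]; exact exp_avg_le _
    _ = avg (fun δ : Fin n → ℤˣ => avg (fun ε : Fin n → ℤˣ => Real.exp ((4 * t) *
      ∑ j, ∑ i, (if δ i = 1 ∧ ¬ δ j = 1 then a i j else 0) * (sgn (ε i) * sgn (ε j))))) :=
        avg_comm _
    _ ≤ avg (fun _ : Fin n → ℤˣ => 2) :=
        avg_mono fun δ => avg_exp_bipartite_le (fun i => δ i = 1) a ha _ (by nlinarith)
    _ = 2 := avg_const _

end Signs

section MaximalInequalities

variable {n : ℕ}

/-- The Rademacher sum with coefficients `a`. -/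
def rademacher (a : EuclideanSpace ℝ (Fin n)) (ε : Fin n → ℤˣ) : ℝ := ∑ i, a i * sgn (ε i)

/-- The Rademacher chaos with coefficients `a`. -/
def rademacherChaos (a : EuclideanSpace ℝ (Fin n × Fin n)) (ε : Fin n → ℤˣ) : ℝ :=
  chaos (fun i j => a (i, j)) ε

lemma rademacher_sub (a b : EuclideanSpace ℝ (Fin n)) (ε : Fin n → ℤˣ) :
    rademacher (a - b) ε = rademacher a ε - rademacher b ε := by
  simp [rademacher, sub_mul]

lemma rademacherChaos_sub (a b : EuclideanSpace ℝ (Fin n × Fin n)) (ε : Fin n → ℤˣ) :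
    rademacherChaos (a - b) ε = rademacherChaos a ε - rademacherChaos b ε := by
  simp [rademacherChaos, chaos, sub_mul]

lemma chaos_smul (c : ℝ) (a : Fin n → Fin n → ℝ) (ε : Fin n → ℤˣ) :
    chaos (fun i j => c * a i j) ε = c * chaos a ε := by
  simp only [chaos, Finset.mul_sum, mul_assoc]

lemma avg_sup'_rademacherChaos_le (K : Finset (EuclideanSpace ℝ (Fin n × Fin n)))
    (hK : K.Nonempty) (D : ℝ) (hD : 0 < D) (h : ∀ a ∈ K, ‖a‖ ≤ D) :
    avg (fun ε => K.sup' hK (fun a => |rademacherChaos a ε|)) ≤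
      5 * D * id (Real.log (4 * K.card)) := by
  have h5 : 0 < (5 * D)⁻¹ := by positivity
  have main := avg_sup'_le K hK (fun a (ε : Fin n → ℤˣ) => (5 * D)⁻¹ * |rademacherChaos a ε|) ?_
  · have e : (fun ε : Fin n → ℤˣ => K.sup' hK (fun a => (5 * D)⁻¹ * |rademacherChaos a ε|)) =
        fun ε => (5 * D)⁻¹ * K.sup' hK (fun a => |rademacherChaos a ε|) := by
      ext ε
      rw [Finset.mul₀_sup' h5.le]
    rw [e, avg_mul_left, inv_mul_le_iff₀ (by positivity)] at main
    exact main
  · intro a ha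
    have hs : ∑ j, ∑ i, (D⁻¹ * a (i, j)) ^ 2 ≤ 1 := by
      have : ‖a‖ ^ 2 = ∑ j, ∑ i, a (i, j) ^ 2 := by
        rw [EuclideanSpace.norm_sq_eq, Fintype.sum_prod_type_right]; simp
      simp only [mul_pow, ← Finset.mul_sum]
      rw [← this, ← mul_pow, sq_le_one_iff₀ (by positivity), inv_mul_le_one₀ hD]
      exact h a ha
    have e : ∀ (t : ℝ) (ε : Fin n → ℤˣ), t * chaos (fun i j => D⁻¹ * a (i, j)) ε =
        (t * D⁻¹) * rademacherChaos a ε := fun t ε => by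
      rw [chaos_smul, rademacherChaos, mul_assoc]
    have h1 := avg_exp_chaos_le (fun i j => D⁻¹ * a (i, j)) hs (1 / 5) (by norm_num)
    have h2 := avg_exp_chaos_le (fun i j => D⁻¹ * a (i, j)) hs (-(1 / 5)) (by norm_num)
    simp only [e] at h1 h2
    calc _ ≤ avg (fun ε : Fin n → ℤˣ => Real.exp ((1 / 5 * D⁻¹) * rademacherChaos a ε) +
          Real.exp ((-(1 / 5) * D⁻¹) * rademacherChaos a ε)) := by
          refine avg_mono fun ε => ?_
          rcases abs_cases (rademacherChaos a ε) with ⟨h, _⟩ | ⟨h, _⟩ <;> rw [h]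
          · rw [show (5 * D)⁻¹ = 1 / 5 * D⁻¹ by rw [mul_inv]; ring]
            exact le_add_of_nonneg_right (Real.exp_pos _).le
          · rw [show (5 * D)⁻¹ * -rademacherChaos a ε =
              (-(1 / 5) * D⁻¹) * rademacherChaos a ε by rw [mul_inv]; ring]
            exact le_add_of_nonneg_left (Real.exp_pos _).le
      _ ≤ 4 := by rw [avg_add]; linarith

lemma avg_sup'_rademacher_le (K : Finset (EuclideanSpace ℝ (Fin n)))
    (hK : K.Nonempty) (D : ℝ) (hD : 0 < D) (h : ∀ a ∈ K, ‖a‖ ≤ D) :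
    avg (fun ε => K.sup' hK (fun a => |rademacher a ε|)) ≤
      2 * D * √(Real.log (4 * K.card)) := by
  have hc : (1 : ℝ) ≤ K.card := by exact_mod_cast hK.card_pos
  have main := avg_sup'_le K hK
    (fun a (ε : Fin n → ℤˣ) => 3 / 8 * (∑ i, (D⁻¹ * a i) * sgn (ε i)) ^ 2) ?_
  · have hlog : 0 ≤ Real.log (4 * K.card) := Real.log_nonneg (by linarith)
    refine le_of_sq_le_sq ?_ (by positivity)
    rw [mul_pow, Real.sq_sqrt hlog]
    have h1 : avg (fun ε => K.sup' hK (fun a => |rademacher a ε|)) ^ 2 ≤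
        avg (fun ε : Fin n → ℤˣ => 8 / 3 * D ^ 2 * K.sup' hK
          (fun a => 3 / 8 * (∑ i, (D⁻¹ * a i) * sgn (ε i)) ^ 2)) := by
      refine (sq_avg_le _).trans (avg_mono fun ε => ?_)
      obtain ⟨a, ha, e⟩ := K.exists_mem_eq_sup' hK (fun a => |rademacher a ε|)
      have h2 := Finset.le_sup' (fun a : EuclideanSpace ℝ (Fin n) =>
        3 / 8 * (∑ i, (D⁻¹ * a i) * sgn (ε i)) ^ 2) ha
      have h3 : ∑ i, (D⁻¹ * a i) * sgn (ε i) = D⁻¹ * rademacher a ε := by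
        simp only [rademacher, Finset.mul_sum, mul_assoc]
      rw [e, sq_abs]
      calc _ = 8 / 3 * D ^ 2 * (3 / 8 * (∑ i, (D⁻¹ * a i) * sgn (ε i)) ^ 2) := by
            rw [h3]; field_simp
        _ ≤ _ := by gcongr
    rw [avg_mul_left] at h1
    have h4 : 8 / 3 * D ^ 2 * avg (fun ε : Fin n → ℤˣ => K.sup' hK
          (fun a => 3 / 8 * (∑ i, (D⁻¹ * a i) * sgn (ε i)) ^ 2)) ≤
          8 / 3 * D ^ 2 * Real.log (4 * K.card) := by gcongr
    have : 0 ≤ D ^ 2 * Real.log (4 * K.card) := by positivity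
    nlinarith
  · intro a ha
    refine (avg_exp_sq_linear_le _ ?_).trans (by norm_num)
    have : ‖a‖ ^ 2 = ∑ i, a i ^ 2 := by rw [EuclideanSpace.norm_sq_eq]; simp
    simp only [mul_pow, ← Finset.mul_sum]
    rw [← this, ← mul_pow, sq_le_one_iff₀ (by positivity), inv_mul_le_one₀ hD]
    exact h a ha

end MaximalInequalities

/-- The properties of `id` and `√` used in chaining. -/
structure IsGauge (θ : ℝ → ℝ) : Prop where
  nonneg : ∀ x, 0 ≤ x → 0 ≤ θ x
  mono : ∀ x y, 0 ≤ x → x ≤ y → θ x ≤ θ y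
  add_le : ∀ x y, 0 ≤ x → 0 ≤ y → θ (x + y) ≤ θ x + θ y
  mul_le : ∀ k x, 1 ≤ k → 0 ≤ x → θ (k * x) ≤ k * θ x
  log_le : ∀ v x, 0 ≤ v → 1 ≤ x → θ (v * Real.log x) ≤ θ v * x

lemma isGauge_id : IsGauge id where
  nonneg x hx := hx
  mono x y _ h := h
  add_le x y _ _ := le_rfl
  mul_le k x _ _ := le_rfl
  log_le v x hv hx := mul_le_mul_of_nonneg_left (Real.log_le_self (by linarith)) hv

lemma isGauge_sqrt : IsGauge Real.sqrt where
  nonneg x _ := Real.sqrt_nonneg x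
  mono x y _ h := Real.sqrt_le_sqrt h
  add_le x y hx hy := Real.sqrt_le_iff.2 ⟨by positivity, by
    nlinarith [Real.sq_sqrt hx, Real.sq_sqrt hy, Real.sqrt_nonneg x, Real.sqrt_nonneg y,
      mul_nonneg (Real.sqrt_nonneg x) (Real.sqrt_nonneg y)]⟩
  mul_le k x hk hx := by
    rw [Real.sqrt_mul (by linarith)]
    gcongr
    exact Real.sqrt_le_iff.2 ⟨by linarith, by nlinarith⟩
  log_le v x hv hx := by
    rw [Real.sqrt_mul hv]
    gcongr
    refine Real.sqrt_le_iff.2 ⟨by linarith, ?_⟩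
    have := Real.log_le_self (by linarith : (0 : ℝ) ≤ x)
    nlinarith

lemma sum_range_chaining (J : ℕ) :
    ∑ j ∈ Finset.range J, ((j : ℝ) + 2) * (1 / 2) ^ j ≤ 6 := by
  have : ∑ j ∈ Finset.range J, ((j : ℝ) + 2) * (1 / 2) ^ j = 6 - (2 * J + 6) * (1 / 2) ^ J := by
    induction J with
    | zero => norm_num
    | succ k ih => rw [Finset.sum_range_succ, ih, pow_succ]; push_cast; ring
  rw [this]
  have : (0 : ℝ) ≤ (2 * J + 6) * (1 / 2) ^ J := by positivity
  linarith

/-- Chaining for a finite class with polynomial covering numbers. -/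
theorem chaining {ι Ω E : Type*} [Fintype ι] [Nonempty ι] [Fintype Ω] [Nonempty Ω]
    [SeminormedAddCommGroup E] [DecidableEq E] (Y : E → Ω → ℝ)
    (hY : ∀ a b ω, Y (a - b) ω = Y a ω - Y b ω)
    {θ : ℝ → ℝ} (hθ : IsGauge θ) {c : ℝ} (hc : 0 ≤ c)
    (hmax : ∀ (K : Finset E) (hK : K.Nonempty) (D : ℝ), 0 < D → (∀ a ∈ K, ‖a‖ ≤ D) →
      avg (fun ω => K.sup' hK (fun a => |Y a ω|)) ≤ c * D * θ (Real.log (4 * K.card)))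
    (a : ι → E) {Z W B v κ : ℝ} (hZ : 0 < Z) (hZW : Z ≤ W) (hB : Real.exp 1 ≤ B) (hv : 0 ≤ v)
    (hκ : 0 < κ) (ha : ∀ f, ‖a f‖ ≤ κ * Z)
    (hnet : ∀ ε : ℝ, 0 < ε → ε ≤ 1 → ∃ N : Finset ι, (N.card : ℝ) ≤ (B / ε) ^ v ∧
      ∀ f, ∃ g ∈ N, ‖a f - a g‖ ≤ κ * (ε * W)) :
    avg (fun ω => ⨆ f, |Y (a f) ω|) ≤
      c * (26 * (κ * Z)) * θ (1 + v * Real.log (B * W / Z)) := by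
  have hW : 0 < W := hZ.trans_le hZW
  have hB0 : 0 < B := (Real.exp_pos 1).trans_le hB
  have hscale : ∀ j : ℕ, 0 < Z / W * (1 / 2) ^ j ∧ Z / W * (1 / 2) ^ j ≤ 1 := fun j =>
    ⟨by positivity, mul_le_one₀ ((div_le_one hW).2 hZW) (by positivity)
      (pow_le_one₀ (by norm_num) (by norm_num))⟩
  choose N hNc hN using fun j : ℕ => hnet _ (hscale j).1 (hscale j).2
  choose p hpN hp using hN
  have hp' : ∀ j f, ‖a f - a (p j f)‖ ≤ κ * Z * (1 / 2) ^ j := fun j f => by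
    refine (hp j f).trans (le_of_eq ?_); field_simp
  have hNpos : ∀ j, (0 : ℝ) < (N j).card := fun j => by
    have : (N j).Nonempty := ⟨_, hpN j (Classical.arbitrary ι)⟩
    exact_mod_cast this.card_pos
  set ℓ := Real.log (B * W / Z) with hℓ
  have hℓ1 : 1 ≤ ℓ := by
    rw [hℓ, Real.le_log_iff_exp_le (by positivity), mul_div_assoc]
    exact hB.trans (le_mul_of_one_le_right hB0.le ((one_le_div hZ).2 hZW))
  have hvℓ : 0 ≤ v * ℓ := by positivity
  have hlogN : ∀ j, Real.log (N j).card ≤ v * (ℓ + j) := fun j => by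
    have h1 := Real.log_le_log (hNpos j) (hNc j)
    have e : B / (Z / W * (1 / 2) ^ j) = (B * W / Z) * 2 ^ j := by
      rw [one_div, inv_pow]; field_simp
    rw [e, Real.log_rpow (by positivity), Real.log_mul (by positivity) (by positivity),
      Real.log_pow] at h1
    have : Real.log 2 ≤ 1 := by linarith [Real.log_two_lt_d9]
    refine h1.trans (mul_le_mul_of_nonneg_left ?_ hv)
    have : (j : ℝ) * Real.log 2 ≤ j * 1 := by gcongr
    linarith
  have hlog4 : Real.log 4 ≤ 2 := by
    rw [show (4 : ℝ) = 2 ^ 2 by norm_num, Real.log_pow]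
    push_cast; linarith [Real.log_two_lt_d9]
  set T := θ (1 + v * ℓ) with hT
  have hT0 : 0 ≤ T := hθ.nonneg _ (by linarith)
  let K0 : Finset E := Finset.univ.image (fun f => a (p 0 f))
  let K : ℕ → Finset E := fun j => Finset.univ.image (fun f => a (p (j + 1) f) - a (p j f))
  let R : ℕ → Finset E := fun j => Finset.univ.image (fun f => a f - a (p j f))
  have hK0 : K0.Nonempty := Finset.univ_nonempty.image _
  have hK : ∀ j, (K j).Nonempty := fun j => Finset.univ_nonempty.image _
  have hR : ∀ j, (R j).Nonempty := fun j => Finset.univ_nonempty.image _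
  have b0 : avg (fun ω => K0.sup' hK0 (fun a => |Y a ω|)) ≤ c * (κ * Z) * (2 * T) := by
    refine (hmax K0 hK0 (κ * Z) (by positivity) ?_).trans ?_
    · intro x hx
      obtain ⟨f, -, rfl⟩ := Finset.mem_image.1 hx
      exact ha _
    · have hcard : (K0.card : ℝ) ≤ (N 0).card := by
        have : K0 ⊆ (N 0).image a := by
          intro x hx
          obtain ⟨f, -, rfl⟩ := Finset.mem_image.1 hx
          exact Finset.mem_image_of_mem _ (hpN 0 f)
        exact_mod_cast (Finset.card_le_card this).trans Finset.card_image_le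
      have hpos : (1 : ℝ) ≤ K0.card := by exact_mod_cast hK0.card_pos
      gcongr
      refine (hθ.mono _ (2 * (1 + v * ℓ)) (Real.log_nonneg (by linarith)) ?_).trans
        (hθ.mul_le _ _ (by norm_num) (by linarith))
      rw [Real.log_mul (by norm_num) (by linarith)]
      have h1 := Real.log_le_log (by linarith) hcard
      have h2 := hlogN 0
      simp only [Nat.cast_zero, add_zero] at h2
      linarith
  have bK : ∀ j, avg (fun ω => (K j).sup' (hK j) (fun a => |Y a ω|)) ≤
      c * (κ * Z) * T * 4 * (((j : ℝ) + 2) * (1 / 2) ^ j) := by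
    intro j
    refine (hmax (K j) (hK j) (2 * (κ * Z * (1 / 2) ^ j)) (by positivity) ?_).trans ?_
    · intro x hx
      obtain ⟨f, -, rfl⟩ := Finset.mem_image.1 hx
      have h1 := hp' j f
      have h2 := hp' (j + 1) f
      have h3 : κ * Z * (1 / 2) ^ (j + 1) ≤ κ * Z * (1 / 2) ^ j := by
        gcongr ?_ * ?_
        exact pow_le_pow_of_le_one (by norm_num) (by norm_num) (Nat.le_succ j)
      calc _ = ‖(a f - a (p j f)) - (a f - a (p (j + 1) f))‖ := by congr 1; abel
        _ ≤ _ := (norm_sub_le _ _).trans (by linarith)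
    · have hcard : ((K j).card : ℝ) ≤ (N (j + 1)).card * (N j).card := by
        have : K j ⊆ (N (j + 1) ×ˢ N j).image (fun q => a q.1 - a q.2) := by
          intro x hx
          obtain ⟨f, -, rfl⟩ := Finset.mem_image.1 hx
          exact Finset.mem_image.2 ⟨(p (j + 1) f, p j f),
            Finset.mem_product.2 ⟨hpN _ _, hpN _ _⟩, rfl⟩
        have := (Finset.card_le_card this).trans Finset.card_image_le
        rw [Finset.card_product] at this
        exact_mod_cast this
      have hpos : (1 : ℝ) ≤ (K j).card := by exact_mod_cast (hK j).card_pos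
      have hθ' : θ (Real.log (4 * (K j).card)) ≤ (2 * (j + 2)) * T := by
        refine (hθ.mono _ ((2 * (j + 2)) * (1 + v * ℓ)) (Real.log_nonneg (by linarith)) ?_).trans
          (hθ.mul_le _ _ (by linarith [(Nat.cast_nonneg j : (0 : ℝ) ≤ j)]) (by linarith))
        rw [Real.log_mul (by norm_num) (by linarith)]
        have h1 := Real.log_le_log (by linarith) hcard
        rw [Real.log_mul (hNpos _).ne' (hNpos _).ne'] at h1
        have h2 := hlogN j
        have h3 := hlogN (j + 1)
        push_cast at h3
        have hj : (0 : ℝ) ≤ j := Nat.cast_nonneg j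
        have h4 : v * (ℓ + (j + 1)) + v * (ℓ + j) ≤ v * ((2 * j + 3) * ℓ) := by
          rw [← mul_add]
          refine mul_le_mul_of_nonneg_left ?_ hv
          nlinarith
        nlinarith
      calc _ ≤ c * (2 * (κ * Z * (1 / 2) ^ j)) * ((2 * (j + 2)) * T) := by gcongr
        _ = _ := by ring
  have bR : ∀ j, avg (fun ω => (R j).sup' (hR j) (fun a => |Y a ω|)) ≤
      c * (κ * Z) * θ (Real.log (4 * Fintype.card ι)) * (1 / 2) ^ j := by
    intro j
    refine (hmax (R j) (hR j) (κ * Z * (1 / 2) ^ j) (by positivity) ?_).trans ?_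
    · intro x hx
      obtain ⟨f, -, rfl⟩ := Finset.mem_image.1 hx
      exact hp' j f
    · have hpos : (1 : ℝ) ≤ (R j).card := by exact_mod_cast (hR j).card_pos
      have hcard : ((R j).card : ℝ) ≤ Fintype.card ι := by
        exact_mod_cast Finset.card_image_le
      have : θ (Real.log (4 * (R j).card)) ≤ θ (Real.log (4 * Fintype.card ι)) :=
        hθ.mono _ _ (Real.log_nonneg (by linarith))
          (Real.log_le_log (by linarith) (by linarith))
      calc _ ≤ c * (κ * Z * (1 / 2) ^ j) * θ (Real.log (4 * Fintype.card ι)) := by gcongr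
        _ = _ := by ring
  have total : ∀ J : ℕ, avg (fun ω => ⨆ f, |Y (a f) ω|) ≤ c * (26 * (κ * Z)) * T +
      c * (κ * Z) * θ (Real.log (4 * Fintype.card ι)) * (1 / 2) ^ J := by
    intro J
    have h1 : avg (fun ω => ⨆ f, |Y (a f) ω|) ≤ avg (fun ω =>
        (K0.sup' hK0 (fun a => |Y a ω|) +
          ∑ j ∈ Finset.range J, (K j).sup' (hK j) (fun a => |Y a ω|)) +
          (R J).sup' (hR J) (fun a => |Y a ω|)) := by
      refine avg_mono fun ω => ciSup_le fun f => ?_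
      have e : Y (a f) ω = (Y (a (p 0 f)) ω + ∑ j ∈ Finset.range J,
          Y (a (p (j + 1) f) - a (p j f)) ω) + Y (a f - a (p J f)) ω := by
        simp only [hY]
        rw [Finset.sum_range_sub (fun j => Y (a (p j f)) ω)]; ring
      rw [e]
      refine (abs_add_le _ _).trans (add_le_add ((abs_add_le _ _).trans (add_le_add ?_
        ((Finset.abs_sum_le_sum_abs _ _).trans (Finset.sum_le_sum fun j _ => ?_)))) ?_)
      · exact Finset.le_sup' (fun a => |Y a ω|) (Finset.mem_image_of_mem (fun f => a (p 0 f)) (Finset.mem_univ f))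
      · exact Finset.le_sup' (fun a => |Y a ω|)
          (Finset.mem_image_of_mem (fun f => a (p (j + 1) f) - a (p j f)) (Finset.mem_univ f))
      · exact Finset.le_sup' (fun a => |Y a ω|)
          (Finset.mem_image_of_mem (fun f => a f - a (p J f)) (Finset.mem_univ f))
    rw [avg_add, avg_add, avg_sum] at h1
    have h2 := Finset.sum_le_sum (fun j (_ : j ∈ Finset.range J) => bK j)
    rw [← Finset.mul_sum] at h2
    have h3 : c * (κ * Z) * T * 4 * ∑ j ∈ Finset.range J, ((j : ℝ) + 2) * (1 / 2) ^ j ≤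
        c * (κ * Z) * T * 4 * 6 := by
      gcongr
      exact sum_range_chaining J
    have h4 := bR J
    linarith
  have hlim : Tendsto (fun J : ℕ => c * (26 * (κ * Z)) * T +
      c * (κ * Z) * θ (Real.log (4 * Fintype.card ι)) * (1 / 2) ^ J) atTop
      (𝓝 (c * (26 * (κ * Z)) * T +
        c * (κ * Z) * θ (Real.log (4 * Fintype.card ι)) * 0)) :=
    ((tendsto_pow_atTop_nhds_zero_of_lt_one (by norm_num) (by norm_num)).const_mul _).const_add _
  rw [mul_zero, add_zero] at hlim
  exact ge_of_tendsto' hlim total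

/-- Linearisation of the chaining bound in the squares of the random radius `Z` and of the random
envelope norm `W`. -/
lemma chaining_radius_le {θ : ℝ → ℝ} (hθ : IsGauge θ) {Z W A τ σ b v : ℝ} (hZ : 0 < Z)
    (hZW : Z ≤ W) (hA : Real.exp 1 ≤ A) (hσ : 0 < σ) (hστ : σ ≤ τ) (hb : 0 < b) (hv : 0 ≤ v) :
    Z * θ (1 + v * Real.log (4 * A * W / Z)) ≤
      θ (1 + 3 * v * Real.log (A * τ / σ)) * ((Z ^ 2 / b + b) / 2) +
      θ v * ((Z ^ 2 / b + b) + (Z ^ 2 / b + b * (W ^ 2 / τ ^ 2)) / 2 + σ) := by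
  have hW : 0 < W := hZ.trans_le hZW
  have hA0 : 0 < A := (Real.exp_pos 1).trans_le hA
  have hτ : 0 < τ := hσ.trans_le hστ
  set ℓ := Real.log (A * τ / σ) with hℓ
  have hℓ1 : 1 ≤ ℓ := by
    rw [hℓ, Real.le_log_iff_exp_le (by positivity), mul_div_assoc]
    exact hA.trans (le_mul_of_one_le_right hA0.le ((one_le_div hσ).2 hστ))
  have hlog4 : Real.log 4 ≤ 2 := by
    rw [show (4 : ℝ) = 2 ^ 2 by norm_num, Real.log_pow]
    push_cast; linarith [Real.log_two_lt_d9]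
  set x := max 1 (W / τ)
  set y := max 1 (σ / Z)
  have hx : 1 ≤ x := le_max_left _ _
  have hy : 1 ≤ y := le_max_left _ _
  have h1 : Real.log (4 * A * W / Z) ≤ 3 * ℓ + Real.log x + Real.log y := by
    have e : 4 * A * W / Z = 4 * (A * τ / σ) * (W / τ) * (σ / Z) := by field_simp
    have hxl : Real.log (W / τ) ≤ Real.log x := Real.log_le_log (by positivity) (le_max_right _ _)
    have hyl : Real.log (σ / Z) ≤ Real.log y := Real.log_le_log (by positivity) (le_max_right _ _)
    rw [e, Real.log_mul (by positivity) (by positivity),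
      Real.log_mul (by positivity) (by positivity), Real.log_mul (by norm_num) (by positivity)]
    linarith
  have hlx := Real.log_nonneg hx
  have hly := Real.log_nonneg hy
  have h0 : 0 ≤ Real.log (4 * A * W / Z) := by
    refine Real.log_nonneg ?_
    rw [one_le_div hZ]
    have : 1 ≤ A := (Real.one_le_exp (by norm_num)).trans hA
    nlinarith
  have h2 : θ (1 + v * Real.log (4 * A * W / Z)) ≤
      θ (1 + 3 * v * ℓ) + θ v * x + θ v * y := by
    calc _ ≤ θ ((1 + 3 * v * ℓ) + v * Real.log x + v * Real.log y) :=
          hθ.mono _ _ (by positivity) (by nlinarith)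
      _ ≤ _ := (hθ.add_le _ _ (by positivity) (by positivity)).trans
          (add_le_add ((hθ.add_le _ _ (by positivity) (by positivity)).trans
            (add_le_add le_rfl (hθ.log_le _ _ hv hx))) (hθ.log_le _ _ hv hy))
  have hZb : Z ≤ (Z ^ 2 / b + b) / 2 := by
    rw [le_div_iff₀ (by norm_num), ← sub_nonneg]
    have : Z ^ 2 / b + b - Z * 2 = (Z - b) ^ 2 / b := by field_simp; ring
    rw [this]; positivity
  have hZW' : Z * (W / τ) ≤ (Z ^ 2 / b + b * (W ^ 2 / τ ^ 2)) / 2 := by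
    rw [le_div_iff₀ (by norm_num), ← sub_nonneg]
    have : Z ^ 2 / b + b * (W ^ 2 / τ ^ 2) - Z * (W / τ) * 2 = (Z - b * (W / τ)) ^ 2 / b := by
      field_simp; ring
    rw [this]; positivity
  have hxZ : Z * x ≤ Z + Z * (W / τ) := by
    rw [← mul_one_add]
    exact mul_le_mul_of_nonneg_left (max_le (by linarith [div_pos hW hτ]) (by linarith)) hZ.le
  have hyZ : Z * y ≤ Z + σ := by
    have : y ≤ 1 + σ / Z := max_le (by linarith [div_pos hσ hZ]) (by linarith)
    calc _ ≤ Z * (1 + σ / Z) := mul_le_mul_of_nonneg_left this hZ.le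
      _ = _ := by field_simp
  have hθ1 : 0 ≤ θ (1 + 3 * v * ℓ) := hθ.nonneg _ (by positivity)
  have hθv : 0 ≤ θ v := hθ.nonneg _ hv
  calc _ ≤ Z * (θ (1 + 3 * v * ℓ) + θ v * x + θ v * y) := mul_le_mul_of_nonneg_left h2 hZ.le
    _ = θ (1 + 3 * v * ℓ) * Z + θ v * (Z * x + Z * y) := by ring
    _ ≤ _ := add_le_add (mul_le_mul_of_nonneg_left hZb hθ1)
        (mul_le_mul_of_nonneg_left (by linarith) hθv)

section Nets

variable {α : Type*} [MeasurableSpace α]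

lemma integrable_of_measurable_of_abs_le {μ : Measure α} [IsFiniteMeasure μ] {f : α → ℝ}
    (hf : Measurable f) {c : ℝ} (hc : ∀ x, |f x| ≤ c) : Integrable f μ :=
  Integrable.of_bound hf.aestronglyMeasurable c (ae_of_all _ hc)

/-- Finitely many integrals of bounded functions can be approximated by those under a finitely
discrete probability measure. -/
lemma exists_isFinitelyDiscrete_integral_mem {κ : Type*} [Fintype κ] (Q : Measure α)
    [IsProbabilityMeasure Q] (φ : κ → α → ℝ) (hφ : ∀ k, Measurable (φ k)) (c : ℝ)
    (hc : ∀ k x, |φ k x| ≤ c) (U : Set (κ → ℝ)) (hU : IsOpen U)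
    (hmem : (fun k => ∫ x, φ k x ∂Q) ∈ U) :
    ∃ Q' : Measure α, IsFinitelyDiscrete Q' ∧ (fun k => ∫ x, φ k x ∂Q') ∈ U := by
  classical
  set Φ : α → (κ → ℝ) := fun x k => φ k x with hΦ
  have hi : Integrable Φ Q := by
    refine Integrable.of_eval fun k => integrable_of_measurable_of_abs_le (hφ k) (hc k)
  have hm : ∫ x, Φ x ∂Q ∈ closure (convexHull ℝ (Set.range Φ)) :=
    (convex_convexHull ℝ _).closure.integral_mem isClosed_closure
      (ae_of_all _ fun x => subset_closure (subset_convexHull ℝ _ (Set.mem_range_self x))) hi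
  have e : ∫ x, Φ x ∂Q = fun k => ∫ x, φ k x ∂Q := by
    ext k
    exact eval_integral (fun k => (integrable_of_measurable_of_abs_le (hφ k) (hc k) :
      Integrable (fun x => Φ x k) Q)) k
  rw [e] at hm
  obtain ⟨y, hyU, hy⟩ := mem_closure_iff.1 hm U hU hmem
  obtain ⟨ι, _, w, z, hw, hw1, hz, rfl⟩ := mem_convexHull_iff_exists_fintype.1 hy
  choose x hx using hz
  have hQ' : ∑ a ∈ Finset.univ.image x, (∑ i ∈ Finset.univ.filter (fun i => x i = a),
      ENNReal.ofReal (w i)) • Measure.dirac a = ∑ i, ENNReal.ofReal (w i) • Measure.dirac (x i) := by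
    rw [← Finset.sum_fiberwise_of_maps_to (s := Finset.univ) (t := Finset.univ.image x) (g := x)
      (fun i hi => Finset.mem_image_of_mem x hi)]
    refine Finset.sum_congr rfl fun a _ => ?_
    rw [Finset.sum_smul]
    refine Finset.sum_congr rfl fun i hi => ?_
    rw [(Finset.mem_filter.1 hi).2]
  refine ⟨∑ i, ENNReal.ofReal (w i) • Measure.dirac (x i), ⟨⟨?_⟩, _, _, hQ'.symm⟩, ?_⟩
  · simp only [Measure.coe_finsetSum, Finset.sum_apply, Measure.smul_apply, measure_univ,
      smul_eq_mul, mul_one]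
    rw [← ENNReal.ofReal_sum_of_nonneg fun i _ => hw i, hw1, ENNReal.ofReal_one]
  · convert hyU using 1
    ext k
    rw [integral_finsetSum_measure]
    · simp only [integral_smul_measure, integral_dirac' _ _ (hφ k).stronglyMeasurable,
        Finset.sum_apply, Pi.smul_apply, ← hx, hΦ]
      exact Finset.sum_congr rfl fun i _ => by rw [ENNReal.toReal_ofReal (hw i)]
    · exact fun i _ => (integrable_of_measurable_of_abs_le (hφ k) (hc k)).smul_measure (by simp)

lemma eLpNorm_two_eq {μ : Measure α} [IsFiniteMeasure μ] {f : α → ℝ}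
    (hf : Measurable f) {c : ℝ} (hc : ∀ x, |f x| ≤ c) :
    MemLp f 2 μ ∧ eLpNorm f 2 μ = ENNReal.ofReal √(∫ x, f x ^ 2 ∂μ) := by
  have h : MemLp f 2 μ := MemLp.of_bound hf.aestronglyMeasurable c (ae_of_all _ hc)
  refine ⟨h, ?_⟩
  rw [h.eLpNorm_eq_integral_rpow_norm (by norm_num) (by norm_num)]
  simp [Real.sqrt_eq_rpow]

lemma l2Norm_eq {μ : Measure α} [IsFiniteMeasure μ] {f : α → ℝ}
    (hf : Measurable f) {c : ℝ} (hc : ∀ x, |f x| ≤ c) :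
    (l2Norm μ f : ℝ) = √(∫ x, f x ^ 2 ∂μ) := by
  rw [l2Norm, (eLpNorm_two_eq hf hc).2, ENNReal.ofReal, ENNReal.toNNReal_coe,
    Real.coe_toNNReal _ (Real.sqrt_nonneg _)]

variable {ι : Type*} {C : Set (α → ℝ)} {F : α → ℝ} {A v M : ℝ} {f : ι → α → ℝ}

lemma card_le_of_separated_discrete (hent : UniformEntropyBound C F A v)
    (hF : Measurable F) (hFM : ∀ x, |F x| ≤ M) (hf : ∀ i, Measurable (f i)) (hfC : ∀ i, f i ∈ C)
    (hfF : ∀ i x, |f i x| ≤ F x) (hA : 0 ≤ A) {Q : Measure α} (hQ : IsFinitelyDiscrete Q)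
    {ε : ℝ} (hε : 0 < ε) (hε1 : ε ≤ 1) (T : Finset ι)
    (hT : ∀ i ∈ T, ∀ j ∈ T, i ≠ j → ε ^ 2 * ∫ x, F x ^ 2 ∂Q < ∫ x, (f i x - f j x) ^ 2 ∂Q) :
    (T.card : ℝ) ≤ (2 * A / ε) ^ v := by
  classical
  have := hQ.1
  have hfM : ∀ i x, |f i x| ≤ M := fun i x => (hfF i x).trans ((le_abs_self _).trans (hFM x))
  have hm : ∀ i, MemLp (f i) 2 Q := fun i => (eLpNorm_two_eq (hf i) (hfM i)).1
  let g : ι → Lp ℝ 2 Q := fun i => (hm i).toLp (f i)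
  set r : ℝ≥0 := (ε / 2).toNNReal * l2Norm Q F with hr
  have hr2 : ((2 * r : ℝ≥0) : ℝ≥0∞) = ENNReal.ofReal (ε * √(∫ x, F x ^ 2 ∂Q)) := by
    have : (2 * r : ℝ≥0) = (ε * √(∫ x, F x ^ 2 ∂Q)).toNNReal := by
      apply NNReal.coe_injective
      rw [hr]
      push_cast
      rw [l2Norm_eq hF hFM, Real.coe_toNNReal _ (by positivity), Real.coe_toNNReal _ (by positivity)]
      ring
    rw [this]; rfl
  have hd : ∀ i ∈ T, ∀ j ∈ T, i ≠ j → ((2 * r : ℝ≥0) : ℝ≥0∞) < edist (g i) (g j) := by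
    intro i hi j hj hij
    rw [Lp.edist_toLp_toLp, hr2]
    have := (eLpNorm_two_eq (μ := Q) (f := f i - f j) ((hf i).sub (hf j)) (c := M + M)
      (fun x => (abs_sub _ _).trans (add_le_add (hfM i x) (hfM j x)))).2
    rw [this]
    have hlt := hT i hi j hj hij
    have hF0 : 0 ≤ ∫ x, F x ^ 2 ∂Q := integral_nonneg fun x => sq_nonneg _
    have h2 : ε * √(∫ x, F x ^ 2 ∂Q) = √(ε ^ 2 * ∫ x, F x ^ 2 ∂Q) := by
      rw [Real.sqrt_mul (by positivity), Real.sqrt_sq hε.le]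
    rw [h2]
    have hlt' : √(ε ^ 2 * ∫ x, F x ^ 2 ∂Q) < √(∫ x, (f i - f j) x ^ 2 ∂Q) :=
      Real.sqrt_lt_sqrt (by positivity) hlt
    exact (ENNReal.ofReal_lt_ofReal_iff (lt_of_le_of_lt (Real.sqrt_nonneg _) hlt')).2 hlt'
  have hinj : Set.InjOn g T := by
    intro i hi j hj hij
    by_contra hne
    have := hd i hi j hj hne
    rw [hij, edist_self] at this
    exact absurd this (by simp)
  have hsep : Metric.IsSeparated ((2 * r : ℝ≥0) : ℝ≥0∞) (g '' T) := by
    rintro _ ⟨i, hi, rfl⟩ _ ⟨j, hj, rfl⟩ hne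
    exact hd i hi j hj fun h => hne (by rw [h])
  have hsub : g '' T ⊆ l2Class Q C := by
    rintro _ ⟨i, hi, rfl⟩
    exact ⟨f i, hfC i, (hm i).coeFn_toLp⟩
  have h1 : (T.card : ℕ∞) ≤ coverNum Q r C := by
    refine le_trans ?_ ((hsep.encard_le_packingNumber hsub).trans
      (Metric.packingNumber_two_mul_le_externalCoveringNumber r (l2Class Q C)))
    rw [hinj.encard_image, Set.encard_coe_eq_coe_finsetCard]
  have h2 := hent Q hQ (ε / 2) (by linarith) (by linarith)
  have h3 : ((T.card : ℕ) : ℝ≥0∞) ≤ ENNReal.ofReal ((A / (ε / 2)) ^ v) := by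
    refine le_trans ?_ h2
    have : (((T.card : ℕ∞)) : ℝ≥0∞) ≤ (coverNum Q r C : ℝ≥0∞) := by exact_mod_cast h1
    simpa using this
  rw [show A / (ε / 2) = 2 * A / ε by field_simp] at h3
  have h4 := ENNReal.toReal_mono ENNReal.ofReal_ne_top h3
  rwa [ENNReal.toReal_natCast, ENNReal.toReal_ofReal (by positivity)] at h4

/-- The uniform entropy bound extends from finitely discrete measures to all finite measures, with
nets inside the given class. -/
theorem exists_net [Fintype ι] [Nonempty ι] (hent : UniformEntropyBound C F A v)
    (hF : Measurable F) (hFM : ∀ x, |F x| ≤ M) (hf : ∀ i, Measurable (f i)) (hfC : ∀ i, f i ∈ C)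
    (hfF : ∀ i x, |f i x| ≤ F x) (hA : 1 ≤ A) (hv : 0 ≤ v) (Q : Measure α) [IsFiniteMeasure Q]
    {ε : ℝ} (hε : 0 < ε) (hε1 : ε ≤ 1) :
    ∃ N : Finset ι, (N.card : ℝ) ≤ (2 * A / ε) ^ v ∧
      ∀ i, ∃ j ∈ N, ∫ x, (f i x - f j x) ^ 2 ∂Q ≤ ε ^ 2 * ∫ x, F x ^ 2 ∂Q := by
  classical
  by_cases hQ0 : Q = 0
  · refine ⟨{Classical.arbitrary ι}, ?_, fun i => ⟨_, Finset.mem_singleton_self _, by simp [hQ0]⟩⟩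
    simp only [Finset.card_singleton, Nat.cast_one]
    refine Real.one_le_rpow ?_ hv
    rw [one_le_div hε]; linarith
  have hfM : ∀ i x, |f i x| ≤ M := fun i x => (hfF i x).trans ((le_abs_self _).trans (hFM x))
  let sep : Finset ι → Prop := fun T => ∀ i ∈ T, ∀ j ∈ T, i ≠ j →
    ε ^ 2 * ∫ x, F x ^ 2 ∂Q < ∫ x, (f i x - f j x) ^ 2 ∂Q
  obtain ⟨T, hT, hmax⟩ := Finset.exists_max_image ((Finset.univ : Finset (Finset ι)).filter sep)
    Finset.card ⟨∅, by simp [sep]⟩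
  replace hT : sep T := (Finset.mem_filter.1 hT).2
  refine ⟨T, ?_, fun i => ?_⟩
  · have : NeZero Q := ⟨hQ0⟩
    let Q₁ : Measure α := (Q Set.univ)⁻¹ • Q
    have hc : 0 < ((Q Set.univ)⁻¹).toReal :=
      ENNReal.toReal_pos (ENNReal.inv_ne_zero.2 (measure_ne_top _ _))
        (ENNReal.inv_ne_top.2 (NeZero.ne _))
    let φ : Option (ι × ι) → α → ℝ := fun k => k.elim (fun x => F x ^ 2)
      (fun p x => (f p.1 x - f p.2 x) ^ 2)
    let U : Set (Option (ι × ι) → ℝ) := {m | ∀ p : ι × ι, (p.1 ∈ T ∧ p.2 ∈ T ∧ p.1 ≠ p.2) →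
      ε ^ 2 * m none < m (some p)}
    have hU : IsOpen U := by
      have : U = ⋂ p : ι × ι, {m | (p.1 ∈ T ∧ p.2 ∈ T ∧ p.1 ≠ p.2) →
        ε ^ 2 * m none < m (some p)} := by ext m; simp [U]
      rw [this]
      refine isOpen_iInter_of_finite fun p => ?_
      by_cases hp : p.1 ∈ T ∧ p.2 ∈ T ∧ p.1 ≠ p.2
      · simp only [hp, ne_eq, not_false_eq_true, and_self, forall_const]
        exact isOpen_lt (by fun_prop) (by fun_prop)
      · simp only [hp, false_imp_iff]
        exact isOpen_univ
    have hM0 : 0 ≤ M := by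
      by_contra h
      have : IsEmpty α := ⟨fun x => h ((abs_nonneg _).trans (hFM x))⟩
      exact hQ0 (Measure.eq_zero_of_isEmpty Q)
    obtain ⟨Q', hQ', hmem⟩ := exists_isFinitelyDiscrete_integral_mem Q₁ φ
      (by
        rintro (_ | p)
        · exact hF.pow_const 2
        · exact ((hf p.1).sub (hf p.2)).pow_const 2)
      ((2 * M) ^ 2)
      (by
        rintro (_ | p) x
        · simp only [φ, Option.elim, abs_pow]
          exact pow_le_pow_left₀ (abs_nonneg _) ((hFM x).trans (by linarith)) 2
        · simp only [φ, Option.elim, abs_pow]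
          exact pow_le_pow_left₀ (abs_nonneg _) ((abs_sub _ _).trans
            (by linarith [hfM p.1 x, hfM p.2 x])) 2)
      U hU
      (by
        rintro p ⟨h1, h2, h3⟩
        simp only [φ, Option.elim, Q₁, integral_smul_measure, smul_eq_mul]
        have := mul_lt_mul_of_pos_left (hT _ h1 _ h2 h3) hc
        linarith)
    exact card_le_of_separated_discrete hent hF hFM hf hfC hfF (by linarith) hQ' hε hε1 T
      fun i hi j hj hij => hmem (i, j) ⟨hi, hj, hij⟩
  · by_cases hi : i ∈ T
    · refine ⟨i, hi, ?_⟩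
      simp only [sub_self]
      have : 0 ≤ ∫ x, F x ^ 2 ∂Q := integral_nonneg fun x => sq_nonneg _
      simp; positivity
    · by_contra! hcon
      have hs : sep (insert i T) := by
        intro a ha b hb hab
        rcases Finset.mem_insert.1 ha with rfl | ha' <;>
          rcases Finset.mem_insert.1 hb with rfl | hb'
        · exact absurd rfl hab
        · exact hcon b hb'
        · refine (hcon a ha').trans_le (le_of_eq ?_)
          congr 1; ext x; ring
        · exact hT a ha' b hb' hab
      have := hmax (insert i T) (Finset.mem_filter.2 ⟨Finset.mem_univ _, hs⟩)
      rw [Finset.card_insert_of_notMem hi] at this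
      omega

end Nets

section FiniteSuprema

variable {α : Type*} {ι : Type*}

lemma iSup_abs_nonneg (a : ι → ℝ) : 0 ≤ ⨆ i, |a i| := Real.iSup_nonneg fun _ => abs_nonneg _

lemma iSup_abs_le {a : ι → ℝ} {c : ℝ} (h : ∀ i, |a i| ≤ c) (hc : 0 ≤ c) : ⨆ i, |a i| ≤ c :=
  Real.iSup_le h hc

lemma abs_iSup_abs_le {Y : ι → α → ℝ} {c : ℝ} (hc : ∀ i x, |Y i x| ≤ c) (hc0 : 0 ≤ c) (x : α) :
    |(⨆ i, |Y i x|)| ≤ c := by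
  rw [abs_of_nonneg (iSup_abs_nonneg _)]
  exact iSup_abs_le (fun i => hc i x) hc0

variable [MeasurableSpace α] [Finite ι]

lemma le_iSup_abs (a : ι → ℝ) (i : ι) : |a i| ≤ ⨆ i, |a i| :=
  le_ciSup (f := fun i => |a i|) (Set.finite_range _).bddAbove i

lemma measurable_iSup_abs {Y : ι → α → ℝ} (hY : ∀ i, Measurable (Y i)) :
    Measurable fun x => ⨆ i, |Y i x| :=
  Measurable.iSup fun i => (hY i).abs

lemma integrable_iSup_abs {μ : Measure α} [IsFiniteMeasure μ] {Y : ι → α → ℝ}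
    (hY : ∀ i, Measurable (Y i)) {c : ℝ} (hc0 : 0 ≤ c) (hc : ∀ i x, |Y i x| ≤ c) :
    Integrable (fun x => ⨆ i, |Y i x|) μ :=
  integrable_of_measurable_of_abs_le (measurable_iSup_abs hY) (abs_iSup_abs_le hc hc0)

end FiniteSuprema

lemma measurable_avg {α Ω : Type*} [MeasurableSpace α] [Fintype Ω] {φ : Ω → α → ℝ}
    (h : ∀ ω, Measurable (φ ω)) : Measurable fun x => avg (fun ω => φ ω x) := by
  unfold avg
  exact (Finset.measurable_sum _ fun ω _ => h ω).div_const _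

lemma integral_avg {α Ω : Type*} [MeasurableSpace α] [Fintype Ω] {μ : Measure α} {φ : Ω → α → ℝ}
    (h : ∀ ω, Integrable (φ ω) μ) :
    Integrable (fun x => avg (fun ω => φ ω x)) μ ∧
      ∫ x, avg (fun ω => φ ω x) ∂μ = avg (fun ω => ∫ x, φ ω x ∂μ) := by
  unfold avg
  exact ⟨(integrable_finsetSum _ fun ω _ => h ω).div_const _, by
    rw [integral_div, integral_finsetSum _ fun ω _ => h ω]⟩

lemma integral_comp_of_measurePreserving {α β : Type*} [MeasurableSpace α] [MeasurableSpace β]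
    {μ : Measure α} {ν : Measure β} {T : α → β} (hT : MeasurePreserving T μ ν) {g : β → ℝ}
    (hg : Measurable g) : ∫ x, g (T x) ∂μ = ∫ y, g y ∂ν := by
  rw [← hT.map_eq, integral_map hT.measurable.aemeasurable hg.aestronglyMeasurable]

section Samples

variable {S : Type*} {n : ℕ}

/-- The sample which follows `x` where `ε = 1` and `x'` elsewhere. -/
def mix (ε : Fin n → ℤˣ) (x x' : Fin n → S) : Fin n → S := fun i => if ε i = 1 then x i else x' i

/-- The second difference of a kernel at the pairs `(x i, x' i)` and `(x j, x' j)`. -/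
def diff2 (k : S × S → ℝ) (x x' : Fin n → S) (i j : Fin n) : ℝ :=
  k (x i, x j) - k (x' i, x j) - k (x i, x' j) + k (x' i, x' j)

/-- The sum of a kernel over all pairs of distinct indices. -/
def pairSum (k : S × S → ℝ) (x : Fin n → S) : ℝ :=
  ∑ i, ∑ j ∈ Finset.univ.filter (fun j => i ≠ j), k (x i, x j)

lemma diff2_mix (k : S × S → ℝ) (ε : Fin n → ℤˣ) (x x' : Fin n → S) (i j : Fin n) :
    diff2 k (mix ε x x') (mix ε x' x) i j = diff2 k x x' i j * (sgn (ε i) * sgn (ε j)) := by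
  have h : ¬ (-1 : ℤˣ) = 1 := by decide
  rcases Int.units_eq_one_or (ε i) with hi | hi <;>
    rcases Int.units_eq_one_or (ε j) with hj | hj <;>
    simp [diff2, mix, hi, hj, h] <;> ring

lemma sum_card_offDiag (n : ℕ) (c : ℝ) :
    ∑ i : Fin n, ∑ _j ∈ Finset.univ.filter (fun j => i ≠ j), c = n * (n - 1) * c := by
  have : ∀ i : Fin n, ((Finset.univ.filter (fun j => i ≠ j)).card : ℝ) = n - 1 := by
    intro i
    rw [Finset.filter_ne, Finset.card_erase_of_mem (Finset.mem_univ i), Finset.card_univ,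
      Fintype.card_fin, Nat.cast_sub (Nat.one_le_iff_ne_zero.2 (by rintro rfl; exact i.elim0))]
    simp
  simp only [Finset.sum_const, nsmul_eq_mul, this, Finset.card_univ, Fintype.card_fin]
  ring

lemma abs_pairSum_le {k : S × S → ℝ} {c : ℝ} (hc : ∀ z, |k z| ≤ c) (x : Fin n → S) :
    |pairSum k x| ≤ n * (n - 1) * c := by
  rw [← sum_card_offDiag]
  exact (Finset.abs_sum_le_sum_abs _ _).trans (Finset.sum_le_sum fun i _ =>
    (Finset.abs_sum_le_sum_abs _ _).trans (Finset.sum_le_sum fun j _ => hc _))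

lemma mul_pred_nonneg (n : ℕ) : 0 ≤ (n : ℝ) * (n - 1) := by
  rcases n with _ | n
  · simp
  · push_cast; simp; positivity

variable [MeasurableSpace S]

lemma measurable_pair {k : S × S → ℝ} (hk : Measurable k) (i j : Fin n) :
    Measurable fun x : Fin n → S => k (x i, x j) := by fun_prop

lemma measurable_pairSum {k : S × S → ℝ} (hk : Measurable k) :
    Measurable (pairSum k : (Fin n → S) → ℝ) := by
  unfold pairSum
  exact Finset.measurable_sum _ fun i _ => Finset.measurable_sum _ fun j _ => measurable_pair hk i j

variable (P : Measure S) [IsProbabilityMeasure P]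

/-- The law of an i.i.d. sample. -/
abbrev sampleLaw (n : ℕ) : Measure (Fin n → S) := Measure.pi fun _ : Fin n => P

lemma measurePreserving_mix (ε : Fin n → ℤˣ) :
    MeasurePreserving
      (fun p : (Fin n → S) × (Fin n → S) => (mix ε p.1 p.2, mix ε p.2 p.1))
      ((sampleLaw P n).prod (sampleLaw P n)) ((sampleLaw P n).prod (sampleLaw P n)) := by
  have he := measurePreserving_arrowProdEquivProdArrow S S (Fin n) (fun _ => P) (fun _ => P)
  have hs : MeasurePreserving (fun (a : Fin n → S × S) i =>
      (if ε i = 1 then id else Prod.swap : S × S → S × S) (a i))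
      (Measure.pi fun _ => P.prod P) (Measure.pi fun _ => P.prod P) := by
    refine measurePreserving_pi _ _ fun i => ?_
    split_ifs
    · exact MeasurePreserving.id _
    · exact Measure.measurePreserving_swap
  have h := he.comp (hs.comp (he.symm _))
  convert h using 1
  ext p i <;>
  · simp only [mix, Function.comp, MeasurableEquiv.arrowProdEquivProdArrow]
    by_cases hi : ε i = 1 <;>
      simp [hi, Equiv.arrowProdEquivProdArrow, MeasurableEquiv.symm]

lemma measurePreserving_mix_fst (ε : Fin n → ℤˣ) :
    MeasurePreserving (fun p : (Fin n → S) × (Fin n → S) => mix ε p.1 p.2)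
      ((sampleLaw P n).prod (sampleLaw P n)) (sampleLaw P n) :=
  measurePreserving_fst.comp (measurePreserving_mix P ε)

lemma integral_sample_eval {g : S → ℝ} (hg : Measurable g) (i : Fin n) :
    ∫ x, g (x i) ∂(sampleLaw P n) = ∫ y, g y ∂P :=
  integral_comp_of_measurePreserving (measurePreserving_eval (fun _ : Fin n => P) i) hg

lemma integral_sample_pair {k : S × S → ℝ} (hk : Measurable k) {i j : Fin n} (hij : i ≠ j) :
    ∫ x, k (x i, x j) ∂(sampleLaw P n) = ∫ z, k z ∂(P.prod P) := by
  have hind := (iIndepFun_pi (μ := fun _ : Fin n => P) (X := fun _ => (id : S → S))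
    fun i => aemeasurable_id).indepFun hij
  have hm := (indepFun_iff_map_prod_eq_prod_map_map
    (measurable_id.comp (measurable_pi_apply _)).aemeasurable
    (measurable_id.comp (measurable_pi_apply _)).aemeasurable).1 hind
  have he : ∀ i : Fin n, Measure.map (id ∘ fun x : Fin n → S => x i) (Measure.pi fun _ => P) = P :=
    fun i => (measurePreserving_eval (fun _ : Fin n => P) i).map_eq
  rw [he, he] at hm
  exact integral_comp_of_measurePreserving (T := fun x : Fin n → S => (x i, x j))
    ⟨by fun_prop, hm⟩ hk

lemma integral_pairSum {k : S × S → ℝ} (hk : Measurable k) {c : ℝ} (hc : ∀ z, |k z| ≤ c) :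
    ∫ x, pairSum k x ∂(sampleLaw P n) = n * (n - 1) * ∫ z, k z ∂(P.prod P) := by
  have hi : ∀ i j : Fin n, Integrable (fun x : Fin n → S => k (x i, x j)) (sampleLaw P n) :=
    fun i j => integrable_of_measurable_of_abs_le (measurable_pair hk i j) fun x => hc _
  rw [← sum_card_offDiag]
  unfold pairSum
  rw [integral_finsetSum _ fun i _ => integrable_finsetSum _ fun j _ => hi i j]
  refine Finset.sum_congr rfl fun i _ => ?_
  rw [integral_finsetSum _ fun j _ => hi i j]
  refine Finset.sum_congr rfl fun j hj => ?_
  exact integral_sample_pair P hk (Finset.mem_filter.1 hj).2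

variable {ι : Type*} [Finite ι]

/-- Symmetrisation: a class of statistics which are conditional means of statistics `G` of the
sample and of an independent copy. -/
lemma integral_iSup_abs_le_avg_mix (g : ι → (Fin n → S) → ℝ)
    (G : ι → (Fin n → S) × (Fin n → S) → ℝ) (hG : ∀ f, Measurable (G f)) {c : ℝ} (hc0 : 0 ≤ c)
    (hc : ∀ f p, |G f p| ≤ c) (hg : ∀ f, Measurable (g f))
    (hgG : ∀ f x, g f x = ∫ x', G f (x, x') ∂(sampleLaw P n)) :
    ∫ x, ⨆ f, |g f x| ∂(sampleLaw P n) ≤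
      ∫ p, avg (fun ε : Fin n → ℤˣ => ⨆ f, |G f (mix ε p.1 p.2, mix ε p.2 p.1)|)
        ∂((sampleLaw P n).prod (sampleLaw P n)) := by
  have hm : Measurable fun p => ⨆ f, |G f p| := measurable_iSup_abs hG
  have hi : Integrable (fun p => ⨆ f, |G f p|) ((sampleLaw P n).prod (sampleLaw P n)) :=
    integrable_iSup_abs hG hc0 hc
  have h1 : ∫ x, ⨆ f, |g f x| ∂(sampleLaw P n) ≤
      ∫ p, ⨆ f, |G f p| ∂((sampleLaw P n).prod (sampleLaw P n)) := by
    rw [integral_prod _ hi]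
    have hgc : ∀ f x, |g f x| ≤ c := fun f x => by
      rw [hgG]
      refine (norm_integral_le_of_norm_le_const (f := fun x' => G f (x, x')) (C := c)
        (ae_of_all _ fun x' => hc f (x, x'))).trans ?_
      simp
    refine integral_mono (integrable_iSup_abs hg hc0 hgc) hi.integral_prod_left fun x => ?_
    have hix : Integrable (fun x' => ⨆ f, |G f (x, x')|) (sampleLaw P n) :=
      integrable_iSup_abs (Y := fun f x' => G f (x, x'))
        (fun f => (hG f).comp measurable_prodMk_left) hc0 fun f x' => hc f _
    refine iSup_abs_le (fun f => ?_) (integral_nonneg fun x' => iSup_abs_nonneg _)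
    rw [hgG]
    refine (abs_integral_le_integral_abs).trans (integral_mono ?_ hix fun x' => ?_)
    · exact (integrable_of_measurable_of_abs_le ((hG f).comp measurable_prodMk_left)
        fun x' => hc f (x, x')).abs
    · exact le_iSup_abs (fun f => G f (x, x')) f
  refine h1.trans (le_of_eq ?_)
  rw [(integral_avg fun ε => integrable_iSup_abs
    (Y := fun f (p : (Fin n → S) × (Fin n → S)) => G f (mix ε p.1 p.2, mix ε p.2 p.1))
    (fun f => (hG f).comp (measurePreserving_mix P ε).measurable) hc0 fun f p => hc f _).2]
  have : ∀ ε : Fin n → ℤˣ, ∫ p : (Fin n → S) × (Fin n → S),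
      ⨆ f, |G f (mix ε p.1 p.2, mix ε p.2 p.1)| ∂((sampleLaw P n).prod (sampleLaw P n)) =
      ∫ p, ⨆ f, |G f p| ∂((sampleLaw P n).prod (sampleLaw P n)) := fun ε =>
    integral_comp_of_measurePreserving (measurePreserving_mix P ε) hm
  simp only [this, avg_const]

/-- Randomisation of degenerate U-statistics by Rademacher chaoses. -/
theorem integral_iSup_pairSum_le_chaos (k : ι → S × S → ℝ) (hk : ∀ f, Measurable (k f)) {c : ℝ}
    (hc0 : 0 ≤ c) (hc : ∀ f z, |k f z| ≤ c) (hd : ∀ f x, ∫ y, k f (x, y) ∂P = 0)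
    (hd' : ∀ f y, ∫ x, k f (x, y) ∂P = 0) :
    ∫ x, ⨆ f, |pairSum (k f) x| ∂(sampleLaw P n) ≤
      ∫ p, avg (fun ε : Fin n → ℤˣ => ⨆ f, |chaos (diff2 (k f) p.1 p.2) ε|)
        ∂((sampleLaw P n).prod (sampleLaw P n)) := by
  let G : ι → (Fin n → S) × (Fin n → S) → ℝ := fun f p =>
    ∑ i, ∑ j ∈ Finset.univ.filter (fun j => i ≠ j), diff2 (k f) p.1 p.2 i j
  have hdm : ∀ f i j, Measurable fun p : (Fin n → S) × (Fin n → S) => diff2 (k f) p.1 p.2 i j := by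
    intro f i j
    have := hk f
    unfold diff2; fun_prop
  have hdc : ∀ f (x x' : Fin n → S) i j, |diff2 (k f) x x' i j| ≤ 4 * c := by
    intro f x x' i j
    unfold diff2
    have h1 := abs_le.1 (hc f (x i, x j))
    have h2 := abs_le.1 (hc f (x' i, x j))
    have h3 := abs_le.1 (hc f (x i, x' j))
    have h4 := abs_le.1 (hc f (x' i, x' j))
    rw [abs_le]; constructor <;> linarith
  have hx : ∀ f (x : Fin n → S) i j, i ≠ j →
      Integrable (fun x' => diff2 (k f) x x' i j) (sampleLaw P n) ∧
      ∫ x', diff2 (k f) x x' i j ∂(sampleLaw P n) = k f (x i, x j) := by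
    intro f x i j hij
    have hkf := hk f
    have i1 : Integrable (fun x' : Fin n → S => k f (x' i, x j)) (sampleLaw P n) :=
      integrable_of_measurable_of_abs_le (by fun_prop) fun x' => hc f _
    have i2 : Integrable (fun x' : Fin n → S => k f (x i, x' j)) (sampleLaw P n) :=
      integrable_of_measurable_of_abs_le (by fun_prop) fun x' => hc f _
    have i3 : Integrable (fun x' : Fin n → S => k f (x' i, x' j)) (sampleLaw P n) :=
      integrable_of_measurable_of_abs_le (by fun_prop) fun x' => hc f _
    have i0 : Integrable (fun _ : Fin n → S => k f (x i, x j)) (sampleLaw P n) :=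
      integrable_const _
    have i01 : Integrable (fun x' : Fin n → S => k f (x i, x j) - k f (x' i, x j))
      (sampleLaw P n) := i0.sub i1
    have i012 : Integrable (fun x' : Fin n → S => k f (x i, x j) - k f (x' i, x j) -
      k f (x i, x' j)) (sampleLaw P n) := i01.sub i2
    refine ⟨i012.add i3, ?_⟩
    unfold diff2
    rw [integral_add i012 i3, integral_sub i01 i2, integral_sub i0 i1,
      integral_sample_pair P (hk f) hij,
      integral_sample_eval P (g := fun y => k f (y, x j)) (by fun_prop),
      integral_sample_eval P (g := fun y => k f (x i, y)) (by fun_prop), hd, hd',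
      integral_prod _ (integrable_of_measurable_of_abs_le (hk f) (hc f))]
    simp [hd]
  have main := integral_iSup_abs_le_avg_mix P (fun f => pairSum (k f)) G
    (fun f => Finset.measurable_sum _ fun i _ => Finset.measurable_sum _ fun j _ => hdm f i j)
    (c := n * (n - 1) * (4 * c)) (mul_nonneg (mul_pred_nonneg n) (by linarith))
    (fun f p => by
      rw [← sum_card_offDiag]
      exact (Finset.abs_sum_le_sum_abs _ _).trans (Finset.sum_le_sum fun i _ =>
        (Finset.abs_sum_le_sum_abs _ _).trans (Finset.sum_le_sum fun j _ => hdc f _ _ i j)))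
    (fun f => measurable_pairSum (hk f))
    (fun f x => by
      have hij : ∀ i : Fin n, ∀ j ∈ Finset.univ.filter (fun j => i ≠ j), i ≠ j := fun i j hj =>
        (Finset.mem_filter.1 hj).2
      simp only [G]
      rw [integral_finsetSum _ fun i _ => integrable_finsetSum _ fun j hj =>
        (hx f x i j (hij i j hj)).1]
      refine Finset.sum_congr rfl fun i _ => ?_
      rw [integral_finsetSum _ fun j hj => (hx f x i j (hij i j hj)).1]
      exact Finset.sum_congr rfl fun j hj => (hx f x i j (hij i j hj)).2.symm)
  simp only [G, diff2_mix] at main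
  exact main

/-- Symmetrisation of empirical processes by Rademacher sums. -/
theorem integral_iSup_sum_le_rademacher (g : ι → S → ℝ) (hg : ∀ f, Measurable (g f)) {c : ℝ}
    (hc0 : 0 ≤ c) (hc : ∀ f x, |g f x| ≤ c) :
    ∫ x, ⨆ f, |∑ i, (g f (x i) - ∫ y, g f y ∂P)| ∂(sampleLaw P n) ≤
      2 * ∫ x, avg (fun ε : Fin n → ℤˣ => ⨆ f, |∑ i, g f (x i) * sgn (ε i)|)
        ∂(sampleLaw P n) := by
  let G : ι → (Fin n → S) × (Fin n → S) → ℝ := fun f p => ∑ i, (g f (p.1 i) - g f (p.2 i))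
  have hgi : ∀ f i, Integrable (fun x : Fin n → S => g f (x i)) (sampleLaw P n) := fun f i => by
    have := hg f
    exact integrable_of_measurable_of_abs_le (by fun_prop) fun x => hc f _
  have hsum : ∀ (a : Fin n → ℝ) (b : ℝ), (∀ i, |a i| ≤ b) → |∑ i, a i| ≤ n * b := fun a b h => by
    refine (Finset.abs_sum_le_sum_abs _ _).trans ((Finset.sum_le_sum fun i _ => h i).trans ?_)
    simp
  have main := integral_iSup_abs_le_avg_mix P
    (fun f (x : Fin n → S) => ∑ i, (g f (x i) - ∫ y, g f y ∂P)) G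
    (fun f => Finset.measurable_sum _ fun i _ => by have := hg f; fun_prop)
    (c := n * (2 * c)) (by positivity)
    (fun f p => hsum _ _ fun i => (abs_sub _ _).trans (by linarith [hc f (p.1 i), hc f (p.2 i)]))
    (fun f => Finset.measurable_sum _ fun i _ => by have := hg f; fun_prop)
    (fun f x => by
      simp only [G]
      have hi : ∀ i, Integrable (fun x' : Fin n → S => g f (x i) - g f (x' i)) (sampleLaw P n) :=
        fun i => (integrable_const _).sub (hgi f i)
      rw [integral_finsetSum _ fun i _ => hi i]
      refine Finset.sum_congr rfl fun i _ => ?_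
      rw [integral_sub (integrable_const _) (hgi f i), integral_sample_eval P (hg f)]
      simp)
  refine main.trans ?_
  have hGm : ∀ f ε (p : (Fin n → S) × (Fin n → S)), G f (mix ε p.1 p.2, mix ε p.2 p.1) =
      ∑ i, g f (p.1 i) * sgn (ε i) - ∑ i, g f (p.2 i) * sgn (ε i) := by
    intro f ε p
    simp only [G]
    rw [← Finset.sum_sub_distrib]
    refine Finset.sum_congr rfl fun i _ => ?_
    have h : ¬ (-1 : ℤˣ) = 1 := by decide
    rcases Int.units_eq_one_or (ε i) with hi | hi <;> simp [mix, hi, h]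
    ring
  let Ψ : (Fin n → S) → ℝ := fun x => avg (fun ε : Fin n → ℤˣ => ⨆ f, |∑ i, g f (x i) * sgn (ε i)|)
  have hYm : ∀ (ε : Fin n → ℤˣ) f, Measurable fun x : Fin n → S => ∑ i, g f (x i) * sgn (ε i) :=
    fun ε f => Finset.measurable_sum _ fun i _ => by have := hg f; fun_prop
  have hYc : ∀ (ε : Fin n → ℤˣ) f (x : Fin n → S), |∑ i, g f (x i) * sgn (ε i)| ≤ n * c := by
    intro ε f x
    refine hsum _ _ fun i => ?_
    rcases Int.units_eq_one_or (ε i) with hi | hi <;> simpa [hi] using hc f (x i)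
  have hΨm : Measurable Ψ := measurable_avg fun ε => measurable_iSup_abs (hYm ε)
  have hΨi : Integrable Ψ (sampleLaw P n) :=
    (integral_avg fun ε => integrable_iSup_abs (hYm ε) (by positivity) (hYc ε)).1
  have hfst := measurePreserving_fst (μ := sampleLaw P n) (ν := sampleLaw P n)
  have hsnd := measurePreserving_snd (μ := sampleLaw P n) (ν := sampleLaw P n)
  have i1 : Integrable (fun p : (Fin n → S) × (Fin n → S) => Ψ p.1)
    ((sampleLaw P n).prod (sampleLaw P n)) := hfst.integrable_comp_of_integrable hΨi
  have i2 : Integrable (fun p : (Fin n → S) × (Fin n → S) => Ψ p.2)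
    ((sampleLaw P n).prod (sampleLaw P n)) := hsnd.integrable_comp_of_integrable hΨi
  calc _ ≤ ∫ p, (Ψ p.1 + Ψ p.2) ∂((sampleLaw P n).prod (sampleLaw P n)) := by
        refine integral_mono (integral_avg fun ε => ?_).1 (i1.add i2) fun p => ?_
        · simp only [hGm]
          refine integrable_iSup_abs (c := n * c + n * c) (fun f => ?_) (by positivity)
            fun f p => (abs_sub _ _).trans (add_le_add (hYc ε f _) (hYc ε f _))
          exact ((hYm ε f).comp measurable_fst).sub ((hYm ε f).comp measurable_snd)
        · simp only [hGm, Ψ]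
          rw [← avg_add]
          refine avg_mono fun ε => iSup_abs_le (fun f => (abs_sub _ _).trans ?_)
            (add_nonneg (iSup_abs_nonneg _) (iSup_abs_nonneg _))
          exact add_le_add (le_iSup_abs (fun f => ∑ i, g f (p.1 i) * sgn (ε i)) f)
            (le_iSup_abs (fun f => ∑ i, g f (p.2 i) * sgn (ε i)) f)
    _ = 2 * ∫ x, Ψ x ∂(sampleLaw P n) := by
        rw [integral_add i1 i2, integral_comp_of_measurePreserving hfst hΨm,
          integral_comp_of_measurePreserving hsnd hΨm]
        ring

end Samples

/-- The chaining bound, linear in the squares of the random radius and envelope norm. -/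
theorem chaining_linearised {ι Ω E : Type*} [Fintype ι] [Nonempty ι] [Fintype Ω] [Nonempty Ω]
    [NormedAddCommGroup E] [DecidableEq E] (Y : E → Ω → ℝ)
    (hY : ∀ a b ω, Y (a - b) ω = Y a ω - Y b ω)
    {θ : ℝ → ℝ} (hθ : IsGauge θ) {c : ℝ} (hc : 0 ≤ c)
    (hmax : ∀ (K : Finset E) (hK : K.Nonempty) (D : ℝ), 0 < D → (∀ a ∈ K, ‖a‖ ≤ D) →
      avg (fun ω => K.sup' hK (fun a => |Y a ω|)) ≤ c * D * θ (Real.log (4 * K.card)))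
    (a : ι → E) {Z W A v κ σ τ b : ℝ} (hZ : 0 ≤ Z) (hZW : Z ≤ W) (hA : Real.exp 1 ≤ A)
    (hv : 0 ≤ v) (hκ : 0 < κ) (hσ : 0 < σ) (hστ : σ ≤ τ) (hb : 0 < b)
    (ha : ∀ f, ‖a f‖ ≤ κ * Z)
    (hnet : ∀ ε : ℝ, 0 < ε → ε ≤ 1 → ∃ N : Finset ι, (N.card : ℝ) ≤ (4 * A / ε) ^ v ∧
      ∀ f, ∃ g ∈ N, ‖a f - a g‖ ≤ κ * (ε * W)) :
    avg (fun ω => ⨆ f, |Y (a f) ω|) ≤ c * (26 * κ) *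
      (θ (1 + 3 * v * Real.log (A * τ / σ)) * ((Z ^ 2 / b + b) / 2) +
        θ v * ((Z ^ 2 / b + b) + (Z ^ 2 / b + b * (W ^ 2 / τ ^ 2)) / 2 + σ)) := by
  have hA0 : 0 < A := (Real.exp_pos 1).trans_le hA
  have hA1 : 1 ≤ A := (Real.one_le_exp (by norm_num)).trans hA
  have hτ := hσ.trans_le hστ
  rcases hZ.eq_or_lt with h0 | h0
  · have hz : ∀ f, a f = 0 := fun f => by
      have := ha f
      rw [← h0, mul_zero] at this
      exact norm_le_zero_iff.1 this
    have hY0 : ∀ ω, Y 0 ω = 0 := fun ω => by simpa using hY 0 0 ω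
    simp only [hz, hY0, abs_zero, ciSup_const, avg_const]
    have hl : 0 ≤ Real.log (A * τ / σ) := Real.log_nonneg (by
      rw [one_le_div hσ]; nlinarith)
    have := hθ.nonneg (1 + 3 * v * Real.log (A * τ / σ)) (by positivity)
    have := hθ.nonneg v hv
    positivity
  · have h1 := chaining Y hY hθ hc hmax a h0 hZW (B := 4 * A) (by linarith) hv hκ ha hnet
    refine h1.trans ?_
    rw [show c * (26 * (κ * Z)) * θ (1 + v * Real.log (4 * A * W / Z)) =
      c * (26 * κ) * (Z * θ (1 + v * Real.log (4 * A * W / Z))) by ring]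
    exact mul_le_mul_of_nonneg_left (chaining_radius_le hθ h0 hZW hA hσ hστ hb hv) (by positivity)

/-- Integration of the bound of `chaining_linearised`. -/
lemma integral_le_of_linearised {α : Type*} [MeasurableSpace α] {ν : Measure α}
    [IsProbabilityMeasure ν] {L Z2 W2 : α → ℝ} (hL : ∀ p, 0 ≤ L p) (hZi : Integrable Z2 ν)
    (hWi : Integrable W2 ν) {K θ₁ θ₂ σ τ b : ℝ} (hK : 0 ≤ K) (hθ₁ : 0 ≤ θ₁) (hθ₂ : 0 ≤ θ₂)
    (hb : 0 < b) (hτ : 0 < τ)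
    (hpt : ∀ p, L p ≤ K * (θ₁ * ((Z2 p / b + b) / 2) +
        θ₂ * ((Z2 p / b + b) + (Z2 p / b + b * (W2 p / τ ^ 2)) / 2 + σ)))
    (hZ : ∫ p, Z2 p ∂ν ≤ b ^ 2) (hW : ∫ p, W2 p ∂ν ≤ τ ^ 2) :
    ∫ p, L p ∂ν ≤ K * (θ₁ * b + θ₂ * (3 * b + σ)) := by
  have i1 : Integrable (fun p => (K * (θ₁ / 2 + 3 * θ₂ / 2) / b) * Z2 p) ν := hZi.const_mul _
  have i2 : Integrable (fun p => (K * (θ₂ * b / 2) / τ ^ 2) * W2 p) ν := hWi.const_mul _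
  have i12 : Integrable (fun p => (K * (θ₁ / 2 + 3 * θ₂ / 2) / b) * Z2 p +
    (K * (θ₂ * b / 2) / τ ^ 2) * W2 p) ν := i1.add i2
  have hpt' : ∀ p, L p ≤ (K * (θ₁ / 2 + 3 * θ₂ / 2) / b) * Z2 p +
      (K * (θ₂ * b / 2) / τ ^ 2) * W2 p + K * (θ₁ * b / 2 + θ₂ * (b + σ)) := fun p =>
    (hpt p).trans (le_of_eq (by ring))
  refine (integral_mono_of_nonneg (ae_of_all _ hL) (i12.add (integrable_const _))
    (ae_of_all _ hpt')).trans ?_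
  rw [integral_add' i12 (integrable_const _), integral_add i1 i2, integral_const_mul,
    integral_const_mul, integral_const]
  have e1 : (K * (θ₁ / 2 + 3 * θ₂ / 2) / b) * ∫ p, Z2 p ∂ν ≤
      (K * (θ₁ / 2 + 3 * θ₂ / 2) / b) * b ^ 2 := by gcongr
  have e2 : (K * (θ₂ * b / 2) / τ ^ 2) * ∫ p, W2 p ∂ν ≤
      (K * (θ₂ * b / 2) / τ ^ 2) * τ ^ 2 := by gcongr
  refine (add_le_add (add_le_add e1 e2) le_rfl).trans (le_of_eq ?_)
  simp only [probReal_univ, one_smul]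
  field_simp
  ring

section Pairs

variable {S : Type*} {n : ℕ}

/-- The sum of a kernel over the four pairs built from `(x i, x' i)` and `(x j, x' j)`, and over
all pairs of distinct indices. -/
def pairSum4 (g : S × S → ℝ) (x x' : Fin n → S) : ℝ :=
  ∑ i, ∑ j ∈ Finset.univ.filter (fun j => i ≠ j),
    (g (x i, x j) + g (x' i, x j) + g (x i, x' j) + g (x' i, x' j))

lemma avg_mix_pair (g : S × S → ℝ) (x x' : Fin n → S) {i j : Fin n} (hij : i ≠ j) :
    4 * avg (fun ε : Fin n → ℤˣ => g (mix ε x x' i, mix ε x x' j)) =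
      g (x i, x j) + g (x' i, x j) + g (x i, x' j) + g (x' i, x' j) := by
  let φ : (Fin n → ℤˣ) → ℝ := fun ε => g (mix ε x x' i, mix ε x x' j)
  let u : Fin n → ℤˣ := Function.update 1 i (-1)
  let w : Fin n → ℤˣ := Function.update 1 j (-1)
  have h1 : avg (fun ε => φ (u * ε)) = avg φ := avg_equiv (Equiv.mulLeft u) φ
  have h2 : avg (fun ε => φ (w * ε)) = avg φ := avg_equiv (Equiv.mulLeft w) φ
  have h3 : avg (fun ε => φ (w * (u * ε))) = avg φ := by
    rw [← h2]; exact avg_equiv (Equiv.mulLeft u) (fun ε => φ (w * ε))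
  have h4 : avg (fun ε => (φ ε + φ (u * ε)) + (φ (w * ε) + φ (w * (u * ε)))) = 4 * avg φ := by
    rw [avg_add, avg_add, avg_add, h1, h2, h3]; ring
  rw [← h4]
  rw [← avg_const (Ω := Fin n → ℤˣ)
    (g (x i, x j) + g (x' i, x j) + g (x i, x' j) + g (x' i, x' j))]
  congr 1
  ext ε
  have h : ¬ (-1 : ℤˣ) = 1 := by decide
  have hji := hij.symm
  rcases Int.units_eq_one_or (ε i) with hi | hi <;>
    rcases Int.units_eq_one_or (ε j) with hj | hj <;>
    simp [φ, u, w, mix, hi, hj, h, hij, hji] <;> ring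

lemma pairSum4_eq (g : S × S → ℝ) (x x' : Fin n → S) :
    pairSum4 g x x' = 4 * avg (fun ε : Fin n → ℤˣ => pairSum g (mix ε x x')) := by
  unfold pairSum4 pairSum
  rw [avg_sum, Finset.mul_sum]
  refine Finset.sum_congr rfl fun i _ => ?_
  rw [avg_sum, Finset.mul_sum]
  exact Finset.sum_congr rfl fun j hj => (avg_mix_pair g x x' (Finset.mem_filter.1 hj).2).symm

lemma pairSum4_nonneg {g : S × S → ℝ} (hg : ∀ z, 0 ≤ g z) (x x' : Fin n → S) :
    0 ≤ pairSum4 g x x' :=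
  Finset.sum_nonneg fun i _ => Finset.sum_nonneg fun j _ => by
    have := hg (x i, x j)
    have := hg (x' i, x j)
    have := hg (x i, x' j)
    have := hg (x' i, x' j)
    positivity

lemma pairSum4_mono {g h : S × S → ℝ} (hgh : ∀ z, g z ≤ h z) (x x' : Fin n → S) :
    pairSum4 g x x' ≤ pairSum4 h x x' :=
  Finset.sum_le_sum fun _ _ => Finset.sum_le_sum fun _ _ =>
    add_le_add (add_le_add (add_le_add (hgh _) (hgh _)) (hgh _)) (hgh _)

lemma pairSum_nonneg {g : S × S → ℝ} (hg : ∀ z, 0 ≤ g z) (x : Fin n → S) : 0 ≤ pairSum g x :=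
  Finset.sum_nonneg fun _ _ => Finset.sum_nonneg fun _ _ => hg _

/-- The coefficients of the chaos of a kernel. -/
def chaosCoeff (k : S × S → ℝ) (x x' : Fin n → S) : EuclideanSpace ℝ (Fin n × Fin n) :=
  WithLp.toLp 2 fun q => if q.1 ≠ q.2 then diff2 k x x' q.1 q.2 else 0

lemma rademacherChaos_chaosCoeff (k : S × S → ℝ) (x x' : Fin n → S) (ε : Fin n → ℤˣ) :
    rademacherChaos (chaosCoeff k x x') ε = chaos (diff2 k x x') ε := by
  unfold rademacherChaos chaos chaosCoeff
  refine Finset.sum_congr rfl fun i _ => Finset.sum_congr rfl fun j hj => ?_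
  simp [(Finset.mem_filter.1 hj).2]

lemma norm_sq_chaosCoeff_le {k : S × S → ℝ} {g : S × S → ℝ} {κ : ℝ}
    (h : ∀ z, k z ^ 2 ≤ κ ^ 2 * g z ^ 2) (x x' : Fin n → S) :
    ‖chaosCoeff k x x'‖ ^ 2 ≤ (2 * κ) ^ 2 * pairSum4 (fun z => g z ^ 2) x x' := by
  rw [EuclideanSpace.norm_sq_eq, Fintype.sum_prod_type, pairSum4, Finset.mul_sum]
  refine Finset.sum_le_sum fun i _ => ?_
  rw [Finset.mul_sum, Finset.sum_filter]
  refine Finset.sum_le_sum fun j _ => ?_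
  by_cases hij : i = j
  · simp [chaosCoeff, hij]
  · simp only [chaosCoeff, hij, ne_eq, not_false_eq_true, if_true, Real.norm_eq_abs, sq_abs, diff2]
    have h1 := h (x i, x j)
    have h2 := h (x' i, x j)
    have h3 := h (x i, x' j)
    have h4 := h (x' i, x' j)
    have : ∀ p q r s : ℝ, (p - q - r + s) ^ 2 ≤ 4 * (p ^ 2 + q ^ 2 + r ^ 2 + s ^ 2) := by
      intro p q r s
      nlinarith [sq_nonneg (p + q), sq_nonneg (p + r), sq_nonneg (p - s), sq_nonneg (q - r),
        sq_nonneg (q + s), sq_nonneg (r + s)]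
    refine (this _ _ _ _).trans ?_
    nlinarith

lemma chaosCoeff_sub (k l : S × S → ℝ) (x x' : Fin n → S) :
    chaosCoeff k x x' - chaosCoeff l x x' = chaosCoeff (fun z => k z - l z) x x' := by
  ext q
  simp only [chaosCoeff, diff2, PiLp.sub_apply]
  split_ifs <;> ring

variable [MeasurableSpace S]

/-- The unnormalised empirical measure with integrals `pairSum4`. -/
def pairMeasure (x x' : Fin n → S) : Measure (S × S) :=
  ∑ i, ∑ j ∈ Finset.univ.filter (fun j => i ≠ j),
    (Measure.dirac (x i, x j) + Measure.dirac (x' i, x j) + Measure.dirac (x i, x' j) +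
      Measure.dirac (x' i, x' j))

instance (x x' : Fin n → S) : IsFiniteMeasure (pairMeasure x x') := by
  unfold pairMeasure; infer_instance

lemma integral_pairMeasure (x x' : Fin n → S) {g : S × S → ℝ} (hg : Measurable g) :
    ∫ z, g z ∂(pairMeasure x x') = pairSum4 g x x' := by
  have hd : ∀ z : S × S, Integrable g (Measure.dirac z) := fun _ =>
    integrable_dirac' hg.stronglyMeasurable (by simp)
  have h3 : ∀ i j : Fin n, Integrable g (Measure.dirac (x i, x j) + Measure.dirac (x' i, x j) +
      Measure.dirac (x i, x' j) + Measure.dirac (x' i, x' j)) := fun _ _ =>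
    (((hd _).add_measure (hd _)).add_measure (hd _)).add_measure (hd _)
  unfold pairMeasure pairSum4
  rw [integral_finsetSum_measure fun i _ => integrable_finsetSum_measure.2 fun j _ => h3 i j]
  refine Finset.sum_congr rfl fun i _ => ?_
  rw [integral_finsetSum_measure fun j _ => h3 i j]
  refine Finset.sum_congr rfl fun j _ => ?_
  rw [integral_add_measure (((hd _).add_measure (hd _)).add_measure (hd _)) (hd _),
    integral_add_measure ((hd _).add_measure (hd _)) (hd _), integral_add_measure (hd _) (hd _)]
  simp only [integral_dirac' _ _ hg.stronglyMeasurable]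

lemma measurable_pairSum4 {g : S × S → ℝ} (hg : Measurable g) :
    Measurable fun p : (Fin n → S) × (Fin n → S) => pairSum4 g p.1 p.2 := by
  unfold pairSum4
  exact Finset.measurable_sum _ fun i _ => Finset.measurable_sum _ fun j _ => by fun_prop

variable (P : Measure S) [IsProbabilityMeasure P]

lemma integral_iSup_pairSum4_le {ι : Type*} [Finite ι] (k : ι → S × S → ℝ)
    (hk : ∀ f, Measurable (k f)) {c : ℝ} (hc0 : 0 ≤ c) (hc : ∀ f z, |k f z| ≤ c) :
    Integrable (fun p : (Fin n → S) × (Fin n → S) => ⨆ f, |pairSum4 (k f) p.1 p.2|)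
      ((sampleLaw P n).prod (sampleLaw P n)) ∧
    ∫ p, ⨆ f, |pairSum4 (k f) p.1 p.2| ∂((sampleLaw P n).prod (sampleLaw P n)) ≤
      4 * ∫ x, ⨆ f, |pairSum (k f) x| ∂(sampleLaw P n) := by
  have hm : Measurable fun x : Fin n → S => ⨆ f, |pairSum (k f) x| :=
    measurable_iSup_abs fun f => measurable_pairSum (hk f)
  have hi : Integrable (fun x : Fin n → S => ⨆ f, |pairSum (k f) x|) (sampleLaw P n) :=
    integrable_iSup_abs (fun f => measurable_pairSum (hk f))
      (mul_nonneg (mul_pred_nonneg n) hc0) fun f => abs_pairSum_le (hc f)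
  have hia := integral_avg (μ := (sampleLaw P n).prod (sampleLaw P n))
    (φ := fun (ε : Fin n → ℤˣ) p => ⨆ f, |pairSum (k f) (mix ε p.1 p.2)|)
    fun ε => (measurePreserving_mix_fst P ε).integrable_comp_of_integrable hi
  have hle : ∀ p : (Fin n → S) × (Fin n → S), ⨆ f, |pairSum4 (k f) p.1 p.2| ≤
      4 * avg (fun ε : Fin n → ℤˣ => ⨆ f, |pairSum (k f) (mix ε p.1 p.2)|) := by
    intro p
    refine iSup_abs_le (fun f => ?_) (mul_nonneg (by norm_num)
      (avg_nonneg fun ε => iSup_abs_nonneg _))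
    rw [pairSum4_eq, abs_mul, abs_of_nonneg (by norm_num : (0 : ℝ) ≤ 4)]
    gcongr
    rw [abs_le]
    constructor
    · rw [neg_le, ← neg_one_mul, ← avg_mul_left]
      refine avg_mono fun ε => le_trans ?_ (le_iSup_abs (fun f => pairSum (k f) (mix ε p.1 p.2)) f)
      rw [neg_one_mul]; exact neg_le_abs _
    · exact avg_mono fun ε => (le_abs_self _).trans
        (le_iSup_abs (fun f => pairSum (k f) (mix ε p.1 p.2)) f)
  have hI : Integrable (fun p : (Fin n → S) × (Fin n → S) => ⨆ f, |pairSum4 (k f) p.1 p.2|)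
      ((sampleLaw P n).prod (sampleLaw P n)) := by
    refine (hia.1.const_mul 4).mono'
      (measurable_iSup_abs fun f => measurable_pairSum4 (hk f)).aestronglyMeasurable
      (ae_of_all _ fun p => ?_)
    rw [Real.norm_eq_abs, abs_of_nonneg (iSup_abs_nonneg _)]
    exact hle p
  refine ⟨hI, (integral_mono hI (hia.1.const_mul 4) hle).trans (le_of_eq ?_)⟩
  rw [integral_const_mul, hia.2]
  have : ∀ ε : Fin n → ℤˣ, ∫ p : (Fin n → S) × (Fin n → S),
      ⨆ f, |pairSum (k f) (mix ε p.1 p.2)| ∂((sampleLaw P n).prod (sampleLaw P n)) =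
      ∫ x, ⨆ f, |pairSum (k f) x| ∂(sampleLaw P n) := fun ε =>
    integral_comp_of_measurePreserving (measurePreserving_mix_fst P ε) hm
  simp only [this, avg_const]

/-- The expected supremum of the randomised chaos of `φ ∘ f`, for a Lipschitz function `φ`. -/
theorem integral_chaos_le {ι : Type*} [Fintype ι] [Nonempty ι] {C : Set (S × S → ℝ)}
    {F : S × S → ℝ} {A v M : ℝ} {f : ι → S × S → ℝ} (hent : UniformEntropyBound C F A v)
    (hF : Measurable F) (hFM : ∀ z, |F z| ≤ M) (hf : ∀ i, Measurable (f i)) (hfC : ∀ i, f i ∈ C)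
    (hfF : ∀ i z, |f i z| ≤ F z) (hA : Real.exp 1 ≤ A) (hv : 0 ≤ v)
    {φ : ℝ → ℝ} (hφ0 : φ 0 = 0) {κ : ℝ} (hκ : 0 < κ)
    (hφκ : ∀ s t, |s| ≤ M → |t| ≤ M → |φ s - φ t| ≤ κ * |s - t|)
    {σ τ b : ℝ} (hσ : 0 < σ) (hστ : σ ≤ τ) (hb : 0 < b)
    (hτ : ∫ z, F z ^ 2 ∂(P.prod P) = τ ^ 2) (hn : 2 ≤ n)
    (hV : ∫ x, ⨆ i, |pairSum (fun z => f i z ^ 2) x| ∂(sampleLaw P n) ≤ n * (n - 1) * b ^ 2) :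
    ∫ p, avg (fun ε : Fin n → ℤˣ => ⨆ i, |chaos (diff2 (fun z => φ (f i z)) p.1 p.2) ε|)
        ∂((sampleLaw P n).prod (sampleLaw P n)) ≤
      520 * κ * √(n * (n - 1)) *
        ((1 + 3 * v * Real.log (A * τ / σ)) * b + v * (3 * b + σ)) := by
  classical
  have hM : ∀ i z, |f i z| ≤ M := fun i z => (hfF i z).trans ((le_abs_self _).trans (hFM z))
  have hτ0 : 0 < τ := hσ.trans_le hστ
  have hA1 : 1 ≤ A := (Real.one_le_exp (by norm_num)).trans hA
  have hM0 : 0 ≤ M := by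
    by_contra h
    have : IsEmpty (S × S) := ⟨fun z => h ((abs_nonneg _).trans (hFM z))⟩
    rw [Measure.eq_zero_of_isEmpty (P.prod P)] at hτ
    simp only [integral_zero_measure] at hτ
    nlinarith
  have hm : 0 < (n : ℝ) * (n - 1) := by
    have : (2 : ℝ) ≤ n := by exact_mod_cast hn
    nlinarith
  set s := √((n : ℝ) * (n - 1)) with hs
  have hs0 : 0 < s := Real.sqrt_pos.2 hm
  have hs2 : s ^ 2 = n * (n - 1) := Real.sq_sqrt hm.le
  let Z2 : (Fin n → S) × (Fin n → S) → ℝ := fun p => ⨆ i, |pairSum4 (fun z => f i z ^ 2) p.1 p.2|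
  let W2 : (Fin n → S) × (Fin n → S) → ℝ := fun p => pairSum4 (fun z => F z ^ 2) p.1 p.2
  set ν := (sampleLaw P n).prod (sampleLaw P n) with hν
  have hf2 : ∀ i, Measurable fun z => f i z ^ 2 := fun i => (hf i).pow_const 2
  have hF2 : Measurable fun z => F z ^ 2 := hF.pow_const 2
  have hsqM : ∀ t : ℝ, |t| ≤ M → |t ^ 2| ≤ M ^ 2 := fun t ht => by
    rw [abs_pow]; exact pow_le_pow_left₀ (abs_nonneg _) ht 2
  obtain ⟨hZi, hZle⟩ := integral_iSup_pairSum4_le (n := n) P (fun i z => f i z ^ 2) hf2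
    (sq_nonneg M) fun i z => hsqM _ (hM i z)
  obtain ⟨hWi, hWle⟩ := integral_iSup_pairSum4_le (n := n) (ι := Unit) P (fun _ z => F z ^ 2)
    (fun _ => hF2) (sq_nonneg M) fun _ z => hsqM _ (hFM z)
  have hFnn : ∀ z, 0 ≤ F z ^ 2 := fun z => sq_nonneg _
  simp only [ciSup_const, abs_of_nonneg (pairSum4_nonneg hFnn _ _),
    abs_of_nonneg (pairSum_nonneg hFnn _)] at hWi hWle
  rw [integral_pairSum P hF2 fun z => hsqM _ (hFM z), hτ, ← hs2] at hWle
  replace hZle : ∫ p, Z2 p ∂ν ≤ (2 * s * b) ^ 2 := by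
    refine hZle.trans ?_
    rw [← hs2] at hV
    nlinarith
  replace hWle : ∫ p, W2 p ∂ν ≤ (2 * s * τ) ^ 2 := by
    refine hWle.trans (le_of_eq ?_); ring
  set θ₁ := 1 + 3 * v * Real.log (A * τ / σ) with hθ₁
  have hl : 0 ≤ Real.log (A * τ / σ) := Real.log_nonneg (by
      rw [one_le_div hσ]; nlinarith)
  have hθ0 : 0 ≤ θ₁ := by positivity
  have hpt : ∀ p : (Fin n → S) × (Fin n → S),
      avg (fun ε : Fin n → ℤˣ => ⨆ i, |chaos (diff2 (fun z => φ (f i z)) p.1 p.2) ε|) ≤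
      5 * (26 * (2 * κ)) * (θ₁ * ((Z2 p / (2 * s * b) + 2 * s * b) / 2) +
        v * ((Z2 p / (2 * s * b) + 2 * s * b) +
        (Z2 p / (2 * s * b) + 2 * s * b * (W2 p / (2 * s * τ) ^ 2)) / 2 + 2 * s * σ)) := by
    intro p
    have hZ0 : 0 ≤ Z2 p := iSup_abs_nonneg _
    have hW0 : 0 ≤ W2 p := pairSum4_nonneg hFnn _ _
    have hZW : Z2 p ≤ W2 p := iSup_abs_le (fun i => by
      rw [abs_of_nonneg (pairSum4_nonneg (fun z => sq_nonneg _) _ _)]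
      exact pairSum4_mono (fun z => sq_le_sq' (by linarith [(abs_le.1 (hfF i z)).1])
        (abs_le.1 (hfF i z)).2) _ _) hW0
    have hsq : ∀ u q : ℝ, 0 ≤ u → 0 ≤ q → ∀ t : ℝ, u ^ 2 ≤ (2 * κ) ^ 2 * (t ^ 2 * q) → 0 ≤ t →
        u ≤ 2 * κ * (t * √q) := by
      intro u q hu hq t h ht
      refine le_of_sq_le_sq (h.trans (le_of_eq ?_)) (by positivity)
      rw [mul_pow (2 * κ), mul_pow t, Real.sq_sqrt hq]
    have hφ2 : ∀ s t, |s| ≤ M → |t| ≤ M → (φ s - φ t) ^ 2 ≤ κ ^ 2 * (s - t) ^ 2 := by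
      intro s t h1 h2
      rw [← sq_abs (φ s - φ t), ← sq_abs (s - t), ← mul_pow]
      exact pow_le_pow_left₀ (abs_nonneg _) (hφκ s t h1 h2) 2
    have key := chaining_linearised (Ω := Fin n → ℤˣ)
      (rademacherChaos : EuclideanSpace ℝ (Fin n × Fin n) → (Fin n → ℤˣ) → ℝ)
      rademacherChaos_sub isGauge_id (c := 5) (by norm_num) avg_sup'_rademacherChaos_le
      (fun i => chaosCoeff (fun z => φ (f i z)) p.1 p.2)
      (Z := √(Z2 p)) (W := √(W2 p)) (A := A) (v := v) (κ := 2 * κ) (σ := 2 * s * σ)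
      (τ := 2 * s * τ) (b := 2 * s * b) (Real.sqrt_nonneg _) (Real.sqrt_le_sqrt hZW) hA hv
      (by positivity) (by positivity) (by gcongr) (by positivity)
      (fun i => by
        have h1 := norm_sq_chaosCoeff_le (k := fun z => φ (f i z)) (g := f i) (κ := κ)
          (fun z => by simpa [hφ0] using hφ2 (f i z) 0 (hM i z) (by simpa using hM0)) p.1 p.2
        have h2 : pairSum4 (fun z => f i z ^ 2) p.1 p.2 ≤ Z2 p :=
          (le_abs_self _).trans (le_iSup_abs (fun i => pairSum4 (fun z => f i z ^ 2) p.1 p.2) i)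
        have := hsq _ (Z2 p) (norm_nonneg _) hZ0 1 (h1.trans (by rw [one_pow, one_mul]; gcongr))
          zero_le_one
        simpa using this)
      (fun ε hε hε1 => by
        obtain ⟨N, hN, hnet⟩ := exists_net hent hF hFM hf hfC hfF hA1 hv
          (pairMeasure p.1 p.2) hε hε1
        refine ⟨N, hN.trans ?_, fun i => ?_⟩
        · gcongr ?_ ^ v
          gcongr
          norm_num
        · obtain ⟨j, hj, hij⟩ := hnet i
          refine ⟨j, hj, ?_⟩
          rw [integral_pairMeasure _ _ (g := fun z => (f i z - f j z) ^ 2)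
            (((hf i).sub (hf j)).pow_const 2),
            integral_pairMeasure _ _ hF2] at hij
          simp only [chaosCoeff_sub]
          refine hsq _ (W2 p) (norm_nonneg _) hW0 ε ?_ hε.le
          refine (norm_sq_chaosCoeff_le (g := fun z => f i z - f j z) (κ := κ)
            (fun z => hφ2 _ _ (hM i z) (hM j z)) p.1 p.2).trans ?_
          gcongr)
    simp only [rademacherChaos_chaosCoeff, Real.sq_sqrt hZ0, Real.sq_sqrt hW0, id] at key
    rw [show A * (2 * s * τ) / (2 * s * σ) = A * τ / σ by field_simp] at key
    exact key
  refine (integral_le_of_linearised (fun p => avg_nonneg fun ε => iSup_abs_nonneg _) hZi hWi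
    (by positivity) hθ0 hv (by positivity) (by positivity) hpt hZle hWle).trans (le_of_eq ?_)
  ring

end Pairs

lemma sq_integral_mul_le {α : Type*} [MeasurableSpace α] {μ : Measure α} [IsFiniteMeasure μ]
    {u w : α → ℝ} (hu : Measurable u) (hw : Measurable w) {c : ℝ} (huc : ∀ x, |u x| ≤ c)
    (hwc : ∀ x, |w x| ≤ c) :
    (∫ x, u x * w x ∂μ) ^ 2 ≤ (∫ x, u x ^ 2 ∂μ) * ∫ x, w x ^ 2 ∂μ := by
  have hb : ∀ s t : ℝ, |s| ≤ c → |t| ≤ c → |s * t| ≤ c * c := fun s t hs ht => by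
    rw [abs_mul]; exact mul_le_mul hs ht (abs_nonneg _) ((abs_nonneg _).trans hs)
  have i1 : Integrable (fun x => u x ^ 2) μ := by
    simp only [sq]
    exact integrable_of_measurable_of_abs_le (hu.mul hu) fun x => hb _ _ (huc x) (huc x)
  have i2 : Integrable (fun x => u x * w x) μ :=
    integrable_of_measurable_of_abs_le (hu.mul hw) fun x => hb _ _ (huc x) (hwc x)
  have i3 : Integrable (fun x => w x ^ 2) μ := by
    simp only [sq]
    exact integrable_of_measurable_of_abs_le (hw.mul hw) fun x => hb _ _ (hwc x) (hwc x)
  have h := discrim_le_zero (a := ∫ x, w x ^ 2 ∂μ) (b := -2 * ∫ x, u x * w x ∂μ)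
    (c := ∫ x, u x ^ 2 ∂μ) fun t => by
      have e : ∫ x, (u x - t * w x) ^ 2 ∂μ =
          ∫ x, u x ^ 2 ∂μ + (-2 * t) * ∫ x, u x * w x ∂μ + t ^ 2 * ∫ x, w x ^ 2 ∂μ := by
        have i2' := i2.const_mul (-2 * t)
        have i3' := i3.const_mul (t ^ 2)
        have i12 : Integrable (fun x => u x ^ 2 + -2 * t * (u x * w x)) μ := i1.add i2'
        rw [← integral_const_mul, ← integral_const_mul, ← integral_add i1 i2',
          ← integral_add i12 i3']
        congr 1; ext x; ring
      have h0 : 0 ≤ ∫ x, (u x - t * w x) ^ 2 ∂μ := integral_nonneg fun x => sq_nonneg _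
      rw [e] at h0
      linarith
  unfold discrim at h
  nlinarith

section SecondMoment

variable {S : Type*} [MeasurableSpace S] (P : Measure S)

lemma secondMoment_nonneg (f : S × S → ℝ) (x : S) : 0 ≤ secondMoment P f x :=
  integral_nonneg fun _ => sq_nonneg _

variable [IsProbabilityMeasure P]

lemma measurable_secondMoment {f : S × S → ℝ} (hf : Measurable f) :
    Measurable (secondMoment P f) := by
  unfold secondMoment
  exact ((hf.pow_const 2).stronglyMeasurable.integral_prod_right').measurable

variable {P} {f g F : S × S → ℝ} {M : ℝ}

lemma sq_le_sq_of_abs_le {s t : ℝ} (h : |s| ≤ t) : s ^ 2 ≤ t ^ 2 :=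
  sq_le_sq' (by linarith [(abs_le.1 h).1]) (abs_le.1 h).2

lemma integrable_sq_section (hf : Measurable f) (hM : ∀ z, |f z| ≤ M) (x : S) :
    Integrable (fun y => f (x, y) ^ 2) P :=
  integrable_of_measurable_of_abs_le (by fun_prop) (c := M ^ 2) fun y => by
    rw [abs_pow]; exact pow_le_pow_left₀ (abs_nonneg _) (hM _) 2

lemma secondMoment_mono (hf : Measurable f) (hF : Measurable F) (hFM : ∀ z, |F z| ≤ M)
    (hfF : ∀ z, |f z| ≤ F z) (x : S) : secondMoment P f x ≤ secondMoment P F x :=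
  integral_mono (integrable_sq_section (M := M) hf (fun z =>
    (hfF z).trans ((le_abs_self _).trans (hFM z))) x) (integrable_sq_section hF hFM x)
    fun y => sq_le_sq_of_abs_le (hfF (x, y))

lemma secondMoment_le (hF : Measurable F) (hFM : ∀ z, |F z| ≤ M) (x : S) :
    secondMoment P F x ≤ M ^ 2 := by
  have := integral_mono (μ := P) (integrable_sq_section hF hFM x) (integrable_const (M ^ 2))
    fun y => sq_le_sq_of_abs_le (hFM (x, y))
  simpa [secondMoment] using this

lemma sq_secondMoment_sub_le (hf : Measurable f) (hg : Measurable g) (hF : Measurable F)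
    (hFM : ∀ z, |F z| ≤ M) (hfF : ∀ z, |f z| ≤ F z) (hgF : ∀ z, |g z| ≤ F z) (x : S) :
    (secondMoment P f x - secondMoment P g x) ^ 2 ≤
      4 * (secondMoment P F x * ∫ y, (f (x, y) - g (x, y)) ^ 2 ∂P) := by
  have hfM : ∀ z, |f z| ≤ M := fun z => (hfF z).trans ((le_abs_self _).trans (hFM z))
  have hgM : ∀ z, |g z| ≤ M := fun z => (hgF z).trans ((le_abs_self _).trans (hFM z))
  have e : secondMoment P f x - secondMoment P g x =
      ∫ y, (f (x, y) - g (x, y)) * (f (x, y) + g (x, y)) ∂P := by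
    unfold secondMoment
    rw [← integral_sub (integrable_sq_section hf hfM x) (integrable_sq_section hg hgM x)]
    congr 1; ext y; ring
  have h1 := sq_integral_mul_le (μ := P) (u := fun y => f (x, y) - g (x, y))
    (w := fun y => f (x, y) + g (x, y)) (by fun_prop) (by fun_prop) (c := M + M)
    (fun y => (abs_sub _ _).trans (add_le_add (hfM _) (hgM _)))
    (fun y => (abs_add_le _ _).trans (add_le_add (hfM _) (hgM _)))
  have h2 : ∫ y, (f (x, y) + g (x, y)) ^ 2 ∂P ≤ 4 * secondMoment P F x := by
    unfold secondMoment
    rw [← integral_const_mul]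
    refine integral_mono (integrable_sq_section (f := fun z => f z + g z) (M := M + M)
      (hf.add hg) (fun z => (abs_add_le _ _).trans (add_le_add (hfM _) (hgM _))) x)
      ((integrable_sq_section hF hFM x).const_mul 4) fun y => ?_
    have := sq_le_sq_of_abs_le ((abs_add_le _ _).trans (add_le_add (hfF (x, y)) (hgF (x, y))))
    simp only
    linarith
  have h3 : 0 ≤ ∫ y, (f (x, y) - g (x, y)) ^ 2 ∂P := integral_nonneg fun y => sq_nonneg _
  rw [e]
  refine h1.trans ((mul_le_mul_of_nonneg_left h2 h3).trans (le_of_eq (by ring)))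

end SecondMoment

section Linear

variable {S : Type*} [MeasurableSpace S] (P : Measure S) [IsProbabilityMeasure P] {n : ℕ}

/-- The mixed measure `∑ i, L (x i) • (δ_{x i} × P)`, where `L` is the second moment of `F`. -/
def tiltedMeasure (F : S × S → ℝ) (x : Fin n → S) : Measure (S × S) :=
  ∑ i, (secondMoment P F (x i)).toNNReal • P.map (Prod.mk (x i))

instance (F : S × S → ℝ) (x : Fin n → S) : IsFiniteMeasure (tiltedMeasure P F x) := by
  unfold tiltedMeasure; infer_instance

lemma integral_tiltedMeasure (F : S × S → ℝ) (x : Fin n → S) {g : S × S → ℝ} (hg : Measurable g)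
    {c : ℝ} (hc : ∀ z, |g z| ≤ c) :
    ∫ z, g z ∂(tiltedMeasure P F x) = ∑ i, secondMoment P F (x i) * ∫ y, g (x i, y) ∂P := by
  unfold tiltedMeasure
  rw [integral_finsetSum_measure fun i _ => integrable_of_measurable_of_abs_le hg hc]
  refine Finset.sum_congr rfl fun i _ => ?_
  rw [integral_smul_nnreal_measure, integral_map measurable_prodMk_left.aemeasurable
    hg.aestronglyMeasurable, NNReal.smul_def, smul_eq_mul,
    Real.coe_toNNReal _ (secondMoment_nonneg P F _)]

/-- The expected supremum of the randomised empirical process of `φ ∘ l_f`, for a Lipschitz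
function `φ`. -/
theorem integral_rademacher_le {ι : Type*} [Fintype ι] [Nonempty ι] {C : Set (S × S → ℝ)}
    {F : S × S → ℝ} {A v M m : ℝ} {f : ι → S × S → ℝ} (hent : UniformEntropyBound C F A v)
    (hF : Measurable F) (hFM : ∀ z, |F z| ≤ M) (hf : ∀ i, Measurable (f i)) (hfC : ∀ i, f i ∈ C)
    (hfF : ∀ i z, |f i z| ≤ F z) (hA : Real.exp 1 ≤ A) (hv : 0 ≤ v)
    (hm : ∀ x, secondMoment P F x ≤ m)
    {φ : ℝ → ℝ} (hφ0 : φ 0 = 0) {κ : ℝ} (hκ : 0 < κ)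
    (hφκ : ∀ s t, |s| ≤ m → |t| ≤ m → |φ s - φ t| ≤ κ * |s - t|)
    {σ τ b : ℝ} (hσ : 0 < σ) (hστ : σ ≤ τ) (hb : 0 < b)
    (hτ : ∫ x, secondMoment P F x ^ 2 ∂P = τ ^ 2) (hn : 1 ≤ n)
    (hV : ∫ x : Fin n → S, ⨆ i, |∑ j, secondMoment P (f i) (x j) ^ 2| ∂(sampleLaw P n) ≤
      n * b ^ 2) :
    ∫ x, avg (fun ε : Fin n → ℤˣ => ⨆ i, |∑ j, φ (secondMoment P (f i) (x j)) * sgn (ε j)|)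
        ∂(sampleLaw P n) ≤
      52 * κ * √n * (√(1 + 3 * v * Real.log (A * τ / σ)) * b + √v * (3 * b + σ)) := by
  classical
  have hτ0 : 0 < τ := hσ.trans_le hστ
  have hA1 : 1 ≤ A := (Real.one_le_exp (by norm_num)).trans hA
  have hn0 : 0 < (n : ℝ) := by exact_mod_cast hn
  set s := √(n : ℝ) with hs
  have hs0 : 0 < s := Real.sqrt_pos.2 hn0
  have hs2 : s ^ 2 = n := Real.sq_sqrt hn0.le
  have hL0 := fun g x => secondMoment_nonneg P g x
  have hLm := fun i => measurable_secondMoment P (hf i)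
  have hLF : ∀ i x, secondMoment P (f i) x ≤ secondMoment P F x := fun i x =>
    secondMoment_mono (hf i) hF hFM (hfF i) x
  have hLb : ∀ i x, |secondMoment P (f i) x| ≤ m := fun i x => by
    rw [abs_of_nonneg (hL0 _ _)]; exact (hLF i x).trans (hm x)
  have hFb : ∀ x, |secondMoment P F x| ≤ m := fun x => by
    rw [abs_of_nonneg (hL0 _ _)]; exact hm x
  have hfM : ∀ i z, |f i z| ≤ M := fun i z => (hfF i z).trans ((le_abs_self _).trans (hFM z))
  have hsum : ∀ (a : Fin n → ℝ), (∀ j, |a j| ≤ m) → |∑ j, a j ^ 2| ≤ n * m ^ 2 := fun a h => by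
    refine (Finset.abs_sum_le_sum_abs _ _).trans ((Finset.sum_le_sum fun j _ => ?_).trans
      (le_of_eq (by simp) : ∑ _j : Fin n, m ^ 2 ≤ _))
    rw [abs_pow]; exact pow_le_pow_left₀ (abs_nonneg _) (h j) 2
  let Z2 : (Fin n → S) → ℝ := fun x => ⨆ i, |∑ j, secondMoment P (f i) (x j) ^ 2|
  let W2 : (Fin n → S) → ℝ := fun x => ∑ j, secondMoment P F (x j) ^ 2
  have hZi : Integrable Z2 (sampleLaw P n) :=
    integrable_iSup_abs (fun i => Finset.measurable_sum _ fun j _ => by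
      have := hLm i; fun_prop) (by positivity) fun i x => hsum _ fun j => hLb i (x j)
  have hFm := measurable_secondMoment P hF
  have hF2i : ∀ j : Fin n, Integrable (fun x : Fin n → S => secondMoment P F (x j) ^ 2)
      (sampleLaw P n) := fun j => integrable_of_measurable_of_abs_le (c := m ^ 2) (by fun_prop)
    fun x => by rw [abs_pow]; exact pow_le_pow_left₀ (abs_nonneg _) (hFb _) 2
  have hWi : Integrable W2 (sampleLaw P n) := integrable_finsetSum _ fun j _ => hF2i j
  have hZle : ∫ x, Z2 x ∂(sampleLaw P n) ≤ (s * b) ^ 2 := by rw [mul_pow, hs2]; exact hV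
  have hWle : ∫ x, W2 x ∂(sampleLaw P n) ≤ (s * τ) ^ 2 := by
    refine le_of_eq ?_
    rw [integral_finsetSum _ fun j _ => hF2i j]
    have : ∀ j : Fin n, ∫ x, secondMoment P F (x j) ^ 2 ∂(sampleLaw P n) = τ ^ 2 := fun j => by
      rw [← hτ]; exact integral_sample_eval P (hFm.pow_const 2) j
    simp only [this, Finset.sum_const, Finset.card_univ, Fintype.card_fin, nsmul_eq_mul, mul_pow,
      hs2]
  have hsq : ∀ u q : ℝ, 0 ≤ u → 0 ≤ q → ∀ t : ℝ, u ^ 2 ≤ κ ^ 2 * (t ^ 2 * q) → 0 ≤ t →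
      u ≤ κ * (t * √q) := by
    intro u q hu hq t h ht
    refine le_of_sq_le_sq (h.trans (le_of_eq ?_)) (by positivity)
    rw [mul_pow κ, mul_pow t, Real.sq_sqrt hq]
  have hφ2 : ∀ s t, |s| ≤ m → |t| ≤ m → (φ s - φ t) ^ 2 ≤ κ ^ 2 * (s - t) ^ 2 := by
    intro s t h1 h2
    rw [← sq_abs (φ s - φ t), ← sq_abs (s - t), ← mul_pow]
    exact pow_le_pow_left₀ (abs_nonneg _) (hφκ s t h1 h2) 2
  let a : (Fin n → S) → ι → EuclideanSpace ℝ (Fin n) := fun x i =>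
    WithLp.toLp 2 fun j => φ (secondMoment P (f i) (x j))
  have hpt : ∀ x : Fin n → S,
      avg (fun ε : Fin n → ℤˣ => ⨆ i, |∑ j, φ (secondMoment P (f i) (x j)) * sgn (ε j)|) ≤
      2 * (26 * κ) * (√(1 + 3 * v * Real.log (A * τ / σ)) * ((Z2 x / (s * b) + s * b) / 2) +
        √v * ((Z2 x / (s * b) + s * b) +
        (Z2 x / (s * b) + s * b * (W2 x / (s * τ) ^ 2)) / 2 + s * σ)) := by
    intro x
    have hZ0 : 0 ≤ Z2 x := iSup_abs_nonneg _
    have hW0 : 0 ≤ W2 x := Finset.sum_nonneg fun j _ => sq_nonneg _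
    have hZW : Z2 x ≤ W2 x := iSup_abs_le (fun i => by
      rw [abs_of_nonneg (Finset.sum_nonneg fun j _ => sq_nonneg _)]
      exact Finset.sum_le_sum fun j _ => pow_le_pow_left₀ (hL0 _ _) (hLF i (x j)) 2) hW0
    have hm0 : 0 ≤ m := (hL0 F (x ⟨0, hn⟩)).trans (hm _)
    have key := chaining_linearised (Ω := Fin n → ℤˣ)
      (rademacher : EuclideanSpace ℝ (Fin n) → (Fin n → ℤˣ) → ℝ)
      rademacher_sub isGauge_sqrt (c := 2) (by norm_num) avg_sup'_rademacher_le (a x)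
      (Z := √(Z2 x)) (W := √(W2 x)) (A := A) (v := v) (κ := κ) (σ := s * σ)
      (τ := s * τ) (b := s * b) (Real.sqrt_nonneg _) (Real.sqrt_le_sqrt hZW) hA hv
      hκ (by positivity) (by gcongr) (by positivity)
      (fun i => by
        have h1 : ‖a x i‖ ^ 2 ≤ κ ^ 2 * Z2 x := by
          rw [EuclideanSpace.norm_sq_eq]
          calc _ ≤ ∑ j, κ ^ 2 * secondMoment P (f i) (x j) ^ 2 := by
                refine Finset.sum_le_sum fun j _ => ?_
                simp only [a, Real.norm_eq_abs, sq_abs]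
                simpa [hφ0] using hφ2 _ 0 (hLb i (x j)) (by simpa using hm0)
            _ ≤ _ := by
                rw [← Finset.mul_sum]
                gcongr
                exact (le_abs_self _).trans
                  (le_iSup_abs (fun i => ∑ j, secondMoment P (f i) (x j) ^ 2) i)
        simpa using hsq _ (Z2 x) (norm_nonneg _) hZ0 1 (by simpa using h1) zero_le_one)
      (fun ε hε hε1 => by
        obtain ⟨N, hN, hnet⟩ := exists_net hent hF hFM hf hfC hfF hA1 hv
          (tiltedMeasure P F x) (half_pos hε) (by linarith)
        refine ⟨N, hN.trans (le_of_eq ?_), fun i => ?_⟩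
        · congr 1; field_simp; norm_num
        · obtain ⟨j, hj, hij⟩ := hnet i
          refine ⟨j, hj, ?_⟩
          rw [integral_tiltedMeasure P F x (g := fun z => (f i z - f j z) ^ 2) (c := (M + M) ^ 2)
              (((hf i).sub (hf j)).pow_const 2) (fun z => by
                rw [abs_pow]
                exact pow_le_pow_left₀ (abs_nonneg _)
                  ((abs_sub _ _).trans (add_le_add (hfM i z) (hfM j z))) 2),
            integral_tiltedMeasure P F x (g := fun z => F z ^ 2) (c := M ^ 2)
              (hF.pow_const 2) (fun z => by
                rw [abs_pow]; exact pow_le_pow_left₀ (abs_nonneg _) (hFM z) 2)] at hij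
          refine hsq _ (W2 x) (norm_nonneg _) hW0 ε ?_ hε.le
          rw [EuclideanSpace.norm_sq_eq]
          calc _ ≤ ∑ k, κ ^ 2 * (4 * (secondMoment P F (x k) *
                ∫ y, (f i (x k, y) - f j (x k, y)) ^ 2 ∂P)) := by
                refine Finset.sum_le_sum fun k _ => ?_
                simp only [a, PiLp.sub_apply, Real.norm_eq_abs, sq_abs]
                refine (hφ2 _ _ (hLb i (x k)) (hLb j (x k))).trans ?_
                gcongr
                exact sq_secondMoment_sub_le (hf i) (hf j) hF hFM (hfF i) (hfF j) (x k)
            _ = κ ^ 2 * (4 * ∑ k, secondMoment P F (x k) *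
                ∫ y, (f i (x k, y) - f j (x k, y)) ^ 2 ∂P) := by simp only [← Finset.mul_sum]
            _ ≤ κ ^ 2 * (4 * ((ε / 2) ^ 2 * W2 x)) := by
                gcongr
                refine hij.trans (le_of_eq ?_)
                simp only [W2, sq (secondMoment P F _)]
                rfl
            _ = _ := by ring)
    simp only [Real.sq_sqrt hZ0, Real.sq_sqrt hW0] at key
    rw [show A * (s * τ) / (s * σ) = A * τ / σ by field_simp] at key
    exact key
  refine (integral_le_of_linearised (fun p => avg_nonneg fun ε => iSup_abs_nonneg _) hZi hWi
    (by positivity) (Real.sqrt_nonneg _) (Real.sqrt_nonneg _) (by positivity) (by positivity)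
    hpt hZle hWle).trans (le_of_eq ?_)
  ring

end Linear

lemma le_of_sq_le_add_mul {t s α β : ℝ} (ht : 0 ≤ t) (hs : 0 ≤ s) (hα : 0 ≤ α) (hβ : 0 ≤ β)
    (h : t ^ 2 ≤ α + β * (t + s)) : t ≤ √α + 2 * β + s := by
  by_contra! hlt
  have h0 := Real.sqrt_nonneg α
  have h1 := Real.sq_sqrt hα
  have ha : α ≤ t * √α := calc
    α = √α * √α := by rw [← sq, h1]
    _ ≤ t * √α := mul_le_mul_of_nonneg_right (by linarith) h0
  have hb : β * s ≤ t * β := by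
    rw [mul_comm]; exact mul_le_mul_of_nonneg_right (by linarith) hβ
  rcases ht.eq_or_lt with rfl | ht
  · linarith
  · nlinarith [mul_lt_mul_of_pos_left hlt ht, mul_nonneg ht.le hs]

section Hoeffding

variable {S : Type*} {n : ℕ}

lemma pairSum_fst (g : S → ℝ) (x : Fin n → S) :
    pairSum (fun z => g z.1) x = (n - 1) * ∑ i, g (x i) := by
  rcases n with _ | n
  · simp [pairSum]
  · unfold pairSum
    rw [Finset.mul_sum]
    refine Finset.sum_congr rfl fun i _ => ?_
    change ∑ _j ∈ Finset.univ.filter (fun j => i ≠ j), g (x i) = _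
    rw [Finset.sum_const, Finset.filter_ne, Finset.card_erase_of_mem (Finset.mem_univ i)]
    simp

lemma pairSum_swap (k : S × S → ℝ) (x : Fin n → S) :
    pairSum (fun z => k (z.2, z.1)) x = pairSum k x := by
  unfold pairSum
  simp only [Finset.sum_filter]
  rw [Finset.sum_comm]
  refine Finset.sum_congr rfl fun i _ => Finset.sum_congr rfl fun j _ => ?_
  simp only [ne_comm]

lemma pairSum_add (k l : S × S → ℝ) (x : Fin n → S) :
    pairSum (fun z => k z + l z) x = pairSum k x + pairSum l x := by
  simp only [pairSum, Finset.sum_add_distrib]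

lemma pairSum_const (c : ℝ) (x : Fin n → S) :
    pairSum (fun _ => c) x = n * (n - 1) * c := sum_card_offDiag n c

lemma hoeffding_decomposition (k : S × S → ℝ) (l : S → ℝ) (c : ℝ) (x : Fin n → S) :
    pairSum k x = n * (n - 1) * c + 2 * (n - 1) * ∑ i, (l (x i) - c) +
      pairSum (fun z => k z - l z.1 - l z.2 + c) x := by
  have e : k = fun z => ((((k z - l z.1 - l z.2 + c) + l z.1) + l z.2) + -c) := by
    ext z; ring
  have h1 : pairSum (fun z : S × S => l z.2) x = (n - 1) * ∑ i, l (x i) := by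
    rw [← pairSum_fst]; exact pairSum_swap (fun z => l z.1) x
  conv_lhs => rw [e]
  rw [pairSum_add, pairSum_add, pairSum_add, h1, pairSum_fst, pairSum_const,
    Finset.sum_sub_distrib]
  simp
  ring

variable [MeasurableSpace S] (P : Measure S) [IsProbabilityMeasure P]

lemma integral_iSup_sum_le_add {ι : Type*} [Finite ι] (g : ι → S → ℝ) (hg : ∀ i, Measurable (g i))
    {c : ℝ} (hc0 : 0 ≤ c) (hc : ∀ i x, |g i x| ≤ c) {s : ℝ} (hs0 : 0 ≤ s) (hs : ∀ i, |∫ y, g i y ∂P| ≤ s) :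
    ∫ x : Fin n → S, ⨆ i, |∑ j, g i (x j)| ∂(sampleLaw P n) ≤ n * s +
      ∫ x : Fin n → S, ⨆ i, |∑ j, (g i (x j) - ∫ y, g i y ∂P)| ∂(sampleLaw P n) := by
  have i1 : Integrable (fun x : Fin n → S => ⨆ i, |∑ j, (g i (x j) - ∫ y, g i y ∂P)|)
      (sampleLaw P n) := by
    refine integrable_iSup_abs (c := n * (c + s)) (fun i => Finset.measurable_sum _
      fun j _ => by have := hg i; fun_prop) (by positivity) fun i x => ?_
    exact (Finset.abs_sum_le_sum_abs _ _).trans ((Finset.sum_le_sum fun j _ =>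
      (abs_sub _ _).trans (add_le_add (hc i (x j)) (hs i))).trans
        (le_of_eq (by simp [mul_add])))
  have i0 : Integrable (fun x : Fin n → S => ⨆ i, |∑ j, g i (x j)|) (sampleLaw P n) := by
    refine integrable_iSup_abs (c := n * c) (fun i => Finset.measurable_sum _
      fun j _ => by have := hg i; fun_prop) (by positivity) fun i x => ?_
    exact (Finset.abs_sum_le_sum_abs _ _).trans ((Finset.sum_le_sum fun j _ =>
      hc i (x j)).trans (le_of_eq (by simp)))
  have h := integral_mono i0 ((integrable_const (n * s)).add i1) fun x => by
    simp only [Pi.add_apply]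
    refine iSup_abs_le (fun i => ?_) (add_nonneg (by positivity) (iSup_abs_nonneg _))
    have e : ∑ j, g i (x j) = n * ∫ y, g i y ∂P + ∑ j, (g i (x j) - ∫ y, g i y ∂P) := by
      rw [Finset.sum_sub_distrib]; simp
    rw [e]
    refine (abs_add_le _ _).trans (add_le_add ?_ (le_iSup_abs (fun i => ∑ j,
      (g i (x j) - ∫ y, g i y ∂P)) i))
    rw [abs_mul, abs_of_nonneg (Nat.cast_nonneg n)]
    gcongr
    exact hs i
  rw [integral_add' (integrable_const _) i1, integral_const] at h
  simp only [probReal_univ, one_smul] at h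
  exact h

/-- The expected supremum of the U-statistics of the squares, by the Hoeffding decomposition. -/
lemma integral_iSup_pairSum_sq_le {ι : Type*} [Finite ι] {f : ι → S × S → ℝ} {M : ℝ}
    (hf : ∀ i, Measurable (f i)) (hfM : ∀ i z, |f i z| ≤ M)
    (hsymm : ∀ i x y, f i (x, y) = f i (y, x)) {σ : ℝ} (hn : 1 ≤ n)
    (hσ : ∀ i, ∫ z, f i z ^ 2 ∂(P.prod P) ≤ σ ^ 2) :
    ∫ x, ⨆ i, |pairSum (fun z => f i z ^ 2) x| ∂(sampleLaw P n) ≤ n * (n - 1) * σ ^ 2 +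
      2 * (n - 1) * ∫ x : Fin n → S, ⨆ i, |∑ j, (secondMoment P (f i) (x j) -
        ∫ y, secondMoment P (f i) y ∂P)| ∂(sampleLaw P n) +
      ∫ p, avg (fun ε : Fin n → ℤˣ => ⨆ i, |chaos (diff2 (fun z => f i z ^ 2) p.1 p.2) ε|)
        ∂((sampleLaw P n).prod (sampleLaw P n)) := by
  have hn' : (0 : ℝ) ≤ n - 1 := by
    have : (1 : ℝ) ≤ n := by exact_mod_cast hn
    linarith
  have hlm := fun i => measurable_secondMoment P (hf i)
  have hlb : ∀ i x, |secondMoment P (f i) x| ≤ M ^ 2 := fun i x => by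
    rw [abs_of_nonneg (secondMoment_nonneg P _ _)]; exact secondMoment_le (hf i) (hfM i) x
  have hfb : ∀ i z, |f i z ^ 2| ≤ M ^ 2 := fun i z => by
    rw [abs_pow]; exact pow_le_pow_left₀ (abs_nonneg _) (hfM i z) 2
  have hf2i : ∀ i, Integrable (fun z => f i z ^ 2) (P.prod P) := fun i =>
    integrable_of_measurable_of_abs_le ((hf i).pow_const 2) (hfb i)
  have hc : ∀ i, ∫ z, f i z ^ 2 ∂(P.prod P) = ∫ y, secondMoment P (f i) y ∂P := fun i =>
    integral_prod _ (hf2i i)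
  have hli : ∀ i, Integrable (secondMoment P (f i)) P := fun i =>
    integrable_of_measurable_of_abs_le (hlm i) (hlb i)
  have hcb : ∀ i, |∫ y, secondMoment P (f i) y ∂P| ≤ M ^ 2 := fun i => by
    refine (norm_integral_le_of_norm_le_const (f := secondMoment P (f i)) (C := M ^ 2)
      (ae_of_all _ (hlb i))).trans ?_
    simp
  let k : ι → S × S → ℝ := fun i z => f i z ^ 2 - secondMoment P (f i) z.1 -
    secondMoment P (f i) z.2 + ∫ y, secondMoment P (f i) y ∂P
  have hk : ∀ i, Measurable (k i) := fun i => by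
    have := hlm i
    have := hf i
    fun_prop
  have hkb : ∀ i z, |k i z| ≤ 4 * M ^ 2 := fun i z => by
    have h1 := abs_le.1 (hfb i z)
    have h2 := abs_le.1 (hlb i z.1)
    have h3 := abs_le.1 (hlb i z.2)
    have h4 := abs_le.1 (hcb i)
    simp only [k]
    rw [abs_le]; constructor <;> linarith
  have hd : ∀ i x, ∫ y, k i (x, y) ∂P = 0 := by
    intro i x
    have i0 := integrable_sq_section (P := P) (hf i) (hfM i) x
    have i1 : Integrable (fun y => f i (x, y) ^ 2 - secondMoment P (f i) x) P :=
      i0.sub (integrable_const _)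
    have i2 : Integrable (fun y => f i (x, y) ^ 2 - secondMoment P (f i) x -
      secondMoment P (f i) y) P := i1.sub (hli i)
    simp only [k]
    rw [integral_add i2 (integrable_const _), integral_sub i1 (hli i),
      integral_sub i0 (integrable_const _)]
    simp [secondMoment]
  have hd' : ∀ i y, ∫ x, k i (x, y) ∂P = 0 := by
    intro i y
    rw [← hd i y]
    congr 1; ext x
    simp only [k, hsymm i x y]
    ring
  have h1 := integral_iSup_pairSum_le_chaos (n := n) P k hk (by positivity) hkb hd hd'
  have e : ∀ i (x x' : Fin n → S), diff2 (k i) x x' = diff2 (fun z => f i z ^ 2) x x' := by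
    intro i x x'
    ext a b
    simp only [diff2, k]; ring
  simp only [e] at h1
  have i1 : Integrable (fun x : Fin n → S => ⨆ i, |∑ j, (secondMoment P (f i) (x j) -
        ∫ y, secondMoment P (f i) y ∂P)|) (sampleLaw P n) := by
    refine integrable_iSup_abs (c := n * (M ^ 2 + M ^ 2)) (fun i => Finset.measurable_sum _
      fun j _ => by have := hlm i; fun_prop) (by positivity) fun i x => ?_
    refine (Finset.abs_sum_le_sum_abs _ _).trans ((Finset.sum_le_sum fun j _ =>
      (abs_sub _ _).trans (add_le_add (hlb i (x j)) (hcb i))).trans (le_of_eq (by simp [mul_add])))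
  have i2 : Integrable (fun x : Fin n → S => ⨆ i, |pairSum (k i) x|) (sampleLaw P n) :=
    integrable_iSup_abs (fun i => measurable_pairSum (hk i))
      (mul_nonneg (mul_pred_nonneg n) (by positivity)) fun i => abs_pairSum_le (hkb i)
  have i0 : Integrable (fun x : Fin n → S => ⨆ i, |pairSum (fun z => f i z ^ 2) x|)
      (sampleLaw P n) :=
    integrable_iSup_abs (fun i => measurable_pairSum ((hf i).pow_const 2))
      (mul_nonneg (mul_pred_nonneg n) (by positivity)) fun i => abs_pairSum_le (hfb i)
  have i1' := i1.const_mul (2 * ((n : ℝ) - 1))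
  have i01 : Integrable (fun x : Fin n → S => n * (n - 1) * σ ^ 2 + 2 * ((n : ℝ) - 1) *
      ⨆ i, |∑ j, (secondMoment P (f i) (x j) - ∫ y, secondMoment P (f i) y ∂P)|)
      (sampleLaw P n) := (integrable_const _).add i1'
  have h2 := integral_mono i0 (i01.add i2) fun x => by
    simp only [Pi.add_apply]
    have hm := mul_pred_nonneg n
    refine iSup_abs_le (fun i => ?_) (add_nonneg (add_nonneg (by positivity)
      (mul_nonneg (by positivity) (iSup_abs_nonneg _))) (iSup_abs_nonneg _))
    rw [hoeffding_decomposition (fun z => f i z ^ 2) (secondMoment P (f i))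
      (∫ y, secondMoment P (f i) y ∂P) x]
    refine (abs_add_le _ _).trans (add_le_add ((abs_add_le _ _).trans (add_le_add ?_ ?_))
      (le_iSup_abs (fun i => pairSum (k i) x) i))
    · rw [abs_mul, abs_of_nonneg hm, ← hc, abs_of_nonneg (integral_nonneg fun z => sq_nonneg _)]
      gcongr
      exact hσ i
    · rw [abs_mul, abs_of_nonneg (by positivity : (0 : ℝ) ≤ 2 * (n - 1))]
      gcongr
      exact le_iSup_abs (fun i => ∑ j, (secondMoment P (f i) (x j) -
        ∫ y, secondMoment P (f i) y ∂P)) i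
  rw [integral_add' i01 i2, integral_add (integrable_const _) i1', integral_const,
    integral_const_mul] at h2
  simp only [probReal_univ, one_smul] at h2
  linarith

end Hoeffding

section Bound

variable {S : Type*} [MeasurableSpace S] (P : Measure S) [IsProbabilityMeasure P] {n : ℕ}
  {ι : Type*} [Fintype ι] [Nonempty ι] {C : Set (S × S → ℝ)} {F : S × S → ℝ} {A v M m : ℝ}
  {f : ι → S × S → ℝ}

/-- `integral_rademacher_le` with the chaining entropy factor absorbed in `√(v ℓ / n)`. -/
lemma integral_rademacher_le_sqrt (hent : UniformEntropyBound C F A v)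
    (hF : Measurable F) (hFM : ∀ z, |F z| ≤ M) (hf : ∀ i, Measurable (f i)) (hfC : ∀ i, f i ∈ C)
    (hfF : ∀ i z, |f i z| ≤ F z) (hA : Real.exp 1 ≤ A) {v₀ : ℝ} (hv₀ : 0 < v₀) (hv : v₀ ≤ v)
    (hm : ∀ x, secondMoment P F x ≤ m)
    {φ : ℝ → ℝ} (hφ0 : φ 0 = 0) {κ : ℝ} (hκ : 0 < κ)
    (hφκ : ∀ s t, |s| ≤ m → |t| ≤ m → |φ s - φ t| ≤ κ * |s - t|)
    {σ τ ℓ b : ℝ} (hσ : 0 < σ) (hστ : σ ≤ τ) (hσb : σ ≤ b)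
    (hτ : ∫ x, secondMoment P F x ^ 2 ∂P = τ ^ 2)
    (hℓ : Real.log (A * τ / σ) ≤ ℓ) (hℓ1 : 1 ≤ ℓ) (hn : 1 ≤ n)
    (hV : ∫ x : Fin n → S, ⨆ i, |∑ j, secondMoment P (f i) (x j) ^ 2| ∂(sampleLaw P n) ≤
      n * b ^ 2) :
    ∫ x, avg (fun ε : Fin n → ℤˣ => ⨆ i, |∑ j, φ (secondMoment P (f i) (x j)) * sgn (ε j)|)
        ∂(sampleLaw P n) ≤ 104 * (1 / v₀ + 7) * κ * (n * √(v * ℓ / n) * b) := by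
  set c := 1 / v₀ + 7 with hc
  have hc7 : 7 ≤ c := by
    have : 0 < 1 / v₀ := by positivity
    linarith
  have hv' : 0 < v := hv₀.trans_le hv
  have hn0 : 0 < (n : ℝ) := by exact_mod_cast hn
  set h := v * ℓ with hh
  have hvh : v ≤ h := le_mul_of_one_le_right hv'.le hℓ1
  have hh0 : 0 < h := hv'.trans_le hvh
  have h1h : 1 ≤ 1 / v₀ * h := by
    rw [one_div_mul_eq_div, one_le_div hv₀]; linarith
  have hnq : √n * √h = n * √(h / n) := by
    rw [← Real.sqrt_mul hn0.le]
    have : (n : ℝ) * h = n ^ 2 * (h / n) := by field_simp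
    rw [this, Real.sqrt_mul (by positivity), Real.sqrt_sq hn0.le]
  refine (integral_rademacher_le (n := n) P hent hF hFM hf hfC hfF hA hv'.le hm hφ0 hκ hφκ hσ
    hστ (hσ.trans_le hσb) hτ hn hV).trans ?_
  have hs1 : √(1 + 3 * v * Real.log (A * τ / σ)) ≤ c * √h := by
    refine Real.sqrt_le_iff.2 ⟨by positivity, ?_⟩
    rw [mul_pow, Real.sq_sqrt hh0.le]
    have e1 : 3 * v * Real.log (A * τ / σ) ≤ 3 * h := by
      rw [mul_assoc, hh]; gcongr
    have e2 : 1 + 3 * h ≤ c * h := by rw [hc]; nlinarith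
    have e3 : c * h ≤ c ^ 2 * h := by
      gcongr
      nlinarith
    linarith
  have hs2 : √v ≤ √h := Real.sqrt_le_sqrt hvh
  have hb : 0 < b := hσ.trans_le hσb
  calc _ ≤ 52 * κ * √n * (c * √h * b + √h * (c * b)) := by
        gcongr
        nlinarith
    _ = 104 * c * κ * ((√n * √h) * b) := by ring
    _ = _ := by rw [hnq]

/-- The empirical process indexed by the second moments `l_f`. -/
theorem integral_iSup_secondMoment_le (hent : UniformEntropyBound C F A v)
    (hF : Measurable F) (hFM : ∀ z, |F z| ≤ M) (hf : ∀ i, Measurable (f i)) (hfC : ∀ i, f i ∈ C)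
    (hfF : ∀ i z, |f i z| ≤ F z) (hA : Real.exp 1 ≤ A) {v₀ : ℝ} (hv₀ : 0 < v₀) (hv : v₀ ≤ v)
    (hm : ∀ x, secondMoment P F x ≤ m) (hm0 : 0 < m)
    {σ τ ℓ : ℝ} (hσ : 0 < σ) (hστ : σ ≤ τ) (hτ : ∫ x, secondMoment P F x ^ 2 ∂P = τ ^ 2)
    (hfσ : ∀ i, ∫ x, secondMoment P (f i) x ^ 2 ∂P ≤ σ ^ 2)
    (hℓ : Real.log (A * τ / σ) ≤ ℓ) (hℓ1 : 1 ≤ ℓ) (hn : 1 ≤ n) :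
    ∫ x : Fin n → S, ⨆ i, |∑ j, (secondMoment P (f i) (x j) -
        ∫ y, secondMoment P (f i) y ∂P)| ∂(sampleLaw P n) ≤
      208 * 832 * (1 / v₀ + 7) ^ 2 * (n * (σ * √(v * ℓ / n) + m * (v * ℓ / n))) := by
  set c := 1 / v₀ + 7 with hc
  have hc7 : 7 ≤ c := by have : 0 < 1 / v₀ := by positivity
                         linarith
  have hv' : 0 < v := hv₀.trans_le hv
  have hn0 : 0 < (n : ℝ) := by exact_mod_cast hn
  set h := v * ℓ with hh
  have hvh : v ≤ h := le_mul_of_one_le_right hv'.le hℓ1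
  have hh0 : 0 < h := hv'.trans_le hvh
  have hlm := fun i => measurable_secondMoment P (hf i)
  have hlb : ∀ i x, |secondMoment P (f i) x| ≤ m := fun i x => by
    rw [abs_of_nonneg (secondMoment_nonneg P _ _)]
    exact (secondMoment_mono (hf i) hF hFM (hfF i) x).trans (hm x)
  have hlb2 : ∀ i x, |secondMoment P (f i) x ^ 2| ≤ m ^ 2 := fun i x => by
    rw [abs_pow]; exact pow_le_pow_left₀ (abs_nonneg _) (hlb i x) 2
  set V : ℝ := ∫ x : Fin n → S, ⨆ i, |∑ j, secondMoment P (f i) (x j) ^ 2| ∂(sampleLaw P n) with hV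
  have hV0 : 0 ≤ V := integral_nonneg fun x => iSup_abs_nonneg _
  set t := √(V / n) with ht
  have ht0 : 0 ≤ t := Real.sqrt_nonneg _
  have ht2 : t ^ 2 = V / n := Real.sq_sqrt (by positivity)
  have hVb : V ≤ n * (t + σ) ^ 2 := by
    have : V = n * t ^ 2 := by rw [ht2]; field_simp
    rw [this]
    gcongr
    linarith
  set q := √(h / n) with hq
  have hq0 : 0 ≤ q := Real.sqrt_nonneg _
  have hq2 : q ^ 2 = h / n := Real.sq_sqrt (by positivity)
  have hlin := integral_iSup_sum_le_rademacher (n := n) P (fun i => secondMoment P (f i)) hlm hm0.le hlb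
  have hsqr := integral_iSup_sum_le_rademacher (n := n) P (fun i x => secondMoment P (f i) x ^ 2)
    (fun i => (hlm i).pow_const 2) (sq_nonneg m) hlb2
  have r1 := integral_rademacher_le_sqrt P hent hF hFM hf hfC hfF hA hv₀ hv hm (φ := id) rfl
    (κ := 1) one_pos (fun s t _ _ => (one_mul _).ge) hσ hστ
    (le_add_of_nonneg_left ht0) hτ hℓ hℓ1 hn hVb
  have r2 := integral_rademacher_le_sqrt P hent hF hFM hf hfC hfF hA hv₀ hv hm
    (φ := fun s => s ^ 2) (by norm_num) (κ := 2 * m) (by positivity) (fun s t hs ht => by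
      rw [sq_sub_sq, abs_mul]
      exact mul_le_mul_of_nonneg_right ((abs_add_le _ _).trans (by linarith)) (abs_nonneg _))
    hσ hστ (le_add_of_nonneg_left ht0) hτ hℓ hℓ1 hn hVb
  simp only [id] at r1
  rw [← hc, ← hh, ← hq] at r1 r2
  have hVle : V ≤ n * σ ^ 2 + 2 * (104 * c * (2 * m) * (n * q * (t + σ))) := by
    have := integral_iSup_sum_le_add (n := n) P (fun i x => secondMoment P (f i) x ^ 2)
      (fun i => (hlm i).pow_const 2) (sq_nonneg m) hlb2 (sq_nonneg σ) fun i => by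
        rw [abs_of_nonneg (integral_nonneg fun y => sq_nonneg _)]
        exact hfσ i
    linarith
  have hquad : t ^ 2 ≤ σ ^ 2 + (416 * c * m * q) * (t + σ) := by
    rw [ht2, div_le_iff₀ hn0]
    linarith
  have ht3 := le_of_sq_le_add_mul ht0 hσ.le (sq_nonneg σ) (by positivity) hquad
  rw [Real.sqrt_sq hσ.le] at ht3
  calc _ ≤ 2 * (104 * c * 1 * (n * q * (t + σ))) := by linarith
    _ ≤ 2 * (104 * c * 1 * (n * q * (3 * σ + 832 * c * m * q))) := by
        gcongr 2 * (104 * c * 1 * (n * q * ?_))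
        linarith
    _ = 208 * 3 * c * (n * (σ * q)) + 208 * 832 * c ^ 2 * (n * (m * q ^ 2)) := by ring
    _ ≤ 208 * 832 * c ^ 2 * (n * (σ * q)) + 208 * 832 * c ^ 2 * (n * (m * q ^ 2)) := by
        gcongr ?_ * _ + _
        nlinarith
    _ = _ := by rw [hq2]; ring

end Bound

section Bound

variable {S : Type*} [MeasurableSpace S] (P : Measure S) [IsProbabilityMeasure P] {n : ℕ}
  {C : Set (S × S → ℝ)} {F : S × S → ℝ} {A v M m : ℝ}

/-- `integral_chaos_le` with the chaining entropy factor absorbed in `v ℓ`. -/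
lemma integral_chaos_le_mul {ι : Type*} [Fintype ι] [Nonempty ι] {f : ι → S × S → ℝ}
    (hent : UniformEntropyBound C F A v)
    (hF : Measurable F) (hFM : ∀ z, |F z| ≤ M) (hf : ∀ i, Measurable (f i)) (hfC : ∀ i, f i ∈ C)
    (hfF : ∀ i z, |f i z| ≤ F z) (hA : Real.exp 1 ≤ A) {v₀ : ℝ} (hv₀ : 0 < v₀) (hv : v₀ ≤ v)
    {φ : ℝ → ℝ} (hφ0 : φ 0 = 0) {κ : ℝ} (hκ : 0 < κ)
    (hφκ : ∀ s t, |s| ≤ M → |t| ≤ M → |φ s - φ t| ≤ κ * |s - t|)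
    {σ τ b : ℝ} (hσ : 0 < σ) (hστ : σ ≤ τ) (hσb : σ ≤ b)
    (hτ : ∫ z, F z ^ 2 ∂(P.prod P) = τ ^ 2) (hℓ1 : 1 ≤ Real.log (A * τ / σ)) (hn : 2 ≤ n)
    (hV : ∫ x, ⨆ i, |pairSum (fun z => f i z ^ 2) x| ∂(sampleLaw P n) ≤ n * (n - 1) * b ^ 2) :
    ∫ p, avg (fun ε : Fin n → ℤˣ => ⨆ i, |chaos (diff2 (fun z => φ (f i z)) p.1 p.2) ε|)
        ∂((sampleLaw P n).prod (sampleLaw P n)) ≤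
      n * (n - 1) * (1040 * (1 / v₀ + 7) * κ * (v * Real.log (A * τ / σ) / n * b)) := by
  set c := 1 / v₀ + 7 with hc
  set h := v * Real.log (A * τ / σ) with hh
  have hv' : 0 < v := hv₀.trans_le hv
  have hb : 0 < b := hσ.trans_le hσb
  have hvh : v ≤ h := le_mul_of_one_le_right hv'.le hℓ1
  have hh0 : 0 < h := hv'.trans_le hvh
  have h1h : 1 ≤ 1 / v₀ * h := by
    rw [one_div_mul_eq_div, one_le_div hv₀]; linarith
  have hc0 : 0 < c := by positivity
  have hn2 : (2 : ℝ) ≤ n := by exact_mod_cast hn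
  have hm : 0 ≤ (n : ℝ) * (n - 1) := mul_pred_nonneg n
  refine (integral_chaos_le (n := n) P hent hF hFM hf hfC hfF hA hv'.le hφ0 hκ hφκ hσ hστ
    hb hτ hn hV).trans ?_
  have e1 : (1 + 3 * v * Real.log (A * τ / σ)) * b + v * (3 * b + σ) ≤ c * h * b := by
    have e2 : 1 + 3 * v * Real.log (A * τ / σ) ≤ (1 / v₀ + 3) * h := by
      rw [mul_assoc, ← hh]; linarith
    have e3 : v * (3 * b + σ) ≤ h * (4 * b) := by gcongr; linarith
    have e4 := mul_le_mul_of_nonneg_right e2 hb.le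
    rw [hc]; linarith
  have e5 : √((n : ℝ) * (n - 1)) ≤ n * (n - 1) * (2 / n) := by
    refine Real.sqrt_le_iff.2 ⟨by positivity, ?_⟩
    have : ((n : ℝ) * (n - 1) * (2 / n)) ^ 2 = 4 * (n - 1) ^ 2 := by field_simp; ring
    rw [this]; nlinarith
  calc _ ≤ 520 * κ * (n * (n - 1) * (2 / n)) * (c * h * b) := by gcongr
    _ = _ := by ring

variable {P}

lemma bddAbove_range_integral_sq (hC : ∀ f ∈ C, Measurable f)
    (hFM : ∀ z, |F z| ≤ M) (henv : ∀ f ∈ C, ∀ z, |f z| ≤ F z) :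
    BddAbove (Set.range fun f : C => ∫ z, f.1 z ^ 2 ∂(P.prod P)) := by
  refine ⟨M ^ 2, ?_⟩
  rintro _ ⟨f, rfl⟩
  have hfM : ∀ z, |f.1 z| ≤ M := fun z => (henv f f.2 z).trans ((le_abs_self _).trans (hFM z))
  have := integral_mono (μ := P.prod P) (integrable_of_measurable_of_abs_le (c := M ^ 2)
    ((hC f f.2).pow_const 2) fun z => by
      rw [abs_pow]; exact pow_le_pow_left₀ (abs_nonneg _) (hfM z) 2) (integrable_const (M ^ 2))
    fun z => sq_le_sq_of_abs_le (hfM z)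
  simpa using this

lemma integral_secondMoment_sq_le {f : S × S → ℝ} (hf : Measurable f) (hF : Measurable F)
    (hFM : ∀ z, |F z| ≤ M) (hfF : ∀ z, |f z| ≤ F z) :
    ∫ x, secondMoment P f x ^ 2 ∂P ≤ ∫ x, secondMoment P F x ^ 2 ∂P := by
  have hb : ∀ g : S × S → ℝ, Measurable g → (∀ z, |g z| ≤ M) →
      Integrable (fun x => secondMoment P g x ^ 2) P := fun g hg hgM =>
    integrable_of_measurable_of_abs_le (c := (M ^ 2) ^ 2) ((measurable_secondMoment P hg).pow_const 2)
      fun x => by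
        rw [abs_pow, abs_of_nonneg (secondMoment_nonneg P g x)]
        exact pow_le_pow_left₀ (secondMoment_nonneg P g x) (secondMoment_le hg hgM x) 2
  exact integral_mono (hb f hf fun z => (hfF z).trans ((le_abs_self _).trans (hFM z))) (hb F hF hFM)
    fun x => pow_le_pow_left₀ (secondMoment_nonneg P f x) (secondMoment_mono hf hF hFM hfF x) 2

lemma bddAbove_range_integral_secondMoment_sq (hC : ∀ f ∈ C, Measurable f) (hF : Measurable F)
    (hFM : ∀ z, |F z| ≤ M) (henv : ∀ f ∈ C, ∀ z, |f z| ≤ F z) :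
    BddAbove (Set.range fun f : C => ∫ x, secondMoment P f.1 x ^ 2 ∂P) := by
  refine ⟨∫ x, secondMoment P F x ^ 2 ∂P, ?_⟩
  rintro _ ⟨f, rfl⟩
  exact integral_secondMoment_sq_le (hC f f.2) hF hFM (henv f f.2)

omit [IsProbabilityMeasure P] in
lemma sigma2_sq (hσ : 0 < sigma2 P C) :
    sigma2 P C ^ 2 = ⨆ f : C, ∫ z, f.1 z ^ 2 ∂(P.prod P) :=
  Real.sq_sqrt (Real.sqrt_pos.1 hσ).le

lemma sigma1_pos (hC : ∀ f ∈ C, Measurable f) (hF : Measurable F)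
    (hFM : ∀ z, |F z| ≤ M) (henv : ∀ f ∈ C, ∀ z, |f z| ≤ F z) (hσ : 0 < sigma2 P C) :
    0 < sigma1 P C := by
  have h0 : ∃ f : C, 0 < ∫ z, f.1 z ^ 2 ∂(P.prod P) := by
    by_contra! h
    have : ⨆ f : C, ∫ z, f.1 z ^ 2 ∂(P.prod P) ≤ 0 := Real.iSup_le h le_rfl
    rw [sigma2, Real.sqrt_eq_zero_of_nonpos this] at hσ
    exact lt_irrefl _ hσ
  obtain ⟨f, hf⟩ := h0
  have hfm := hC f f.2
  have hfM : ∀ z, |f.1 z| ≤ M := fun z => (henv f f.2 z).trans ((le_abs_self _).trans (hFM z))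
  have e : ∫ z, f.1 z ^ 2 ∂(P.prod P) = ∫ x, secondMoment P f.1 x ∂P :=
    integral_prod _ (integrable_of_measurable_of_abs_le (c := M ^ 2) (hfm.pow_const 2) fun z => by
      rw [abs_pow]; exact pow_le_pow_left₀ (abs_nonneg _) (hfM z) 2)
  have h1 := sq_integral_mul_le (μ := P) (u := secondMoment P f.1) (w := fun _ => 1)
    (measurable_secondMoment P hfm) measurable_const (c := max (M ^ 2) 1)
    (fun x => by
      rw [abs_of_nonneg (secondMoment_nonneg P _ x)]
      exact (secondMoment_le hfm hfM x).trans (le_max_left _ _)) (fun x => by simp)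
  simp only [mul_one, one_pow, integral_const, probReal_univ, one_smul, ← e] at h1
  refine Real.sqrt_pos.2 (lt_of_lt_of_le (by positivity) (h1.trans
    (le_ciSup (bddAbove_range_integral_secondMoment_sq hC hF hFM henv) f)))

variable (P)

/-- The expected supremum over a finite subclass is at most a multiple of the rate. -/
theorem integral_iSup_uStat_le {ι : Type*} [Fintype ι] [Nonempty ι] {f : ι → S × S → ℝ}
    (hC : ∀ f ∈ C, Measurable f) (hsymm : ∀ f ∈ C, ∀ x y, f (x, y) = f (y, x))
    (hdeg : ∀ f ∈ C, Degenerate P f) (hF : Measurable F) (hFbdd : BddAbove (Set.range F))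
    (henv : ∀ f ∈ C, ∀ z, |f z| ≤ F z) (hσ : 0 < sigma2 P C) (hA : Real.exp 1 ≤ A)
    {v₀ : ℝ} (hv₀ : 0 < v₀) (hv : v₀ ≤ v) (hent : UniformEntropyBound C F A v)
    (hfC : ∀ i, f i ∈ C) (hn : 2 ≤ n) :
    0 < rate P C F A v n ∧
    ∫ x : Fin n → S, ⨆ i, |uStat x (f i)| ∂(sampleLaw P n) ≤
      1040 * (1 / v₀ + 7) * (3 + √(2 * (208 * 832 * (1 / v₀ + 7) ^ 2)) + 4160 * (1 / v₀ + 7)) *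
        rate P C F A v n := by
  have hFM : ∀ z, |F z| ≤ envSup F := fun z => by
    rw [abs_of_nonneg ((abs_nonneg _).trans (henv _ (hfC (Classical.arbitrary ι)) z))]
    exact le_ciSup hFbdd z
  set M := envSup F with hM
  have hf : ∀ i, Measurable (f i) := fun i => hC _ (hfC i)
  have hfF : ∀ i z, |f i z| ≤ F z := fun i => henv _ (hfC i)
  have hfM : ∀ i z, |f i z| ≤ M := fun i z => (hfF i z).trans ((le_abs_self _).trans (hFM z))
  have hσ1 := sigma1_pos hC hF hFM henv hσ
  set σ := sigma2 P C with hσdef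
  set σ₁ := sigma1 P C with hσ1def
  -- the norms of the envelope
  set τ : ℝ := NNReal.toReal (l2Norm (P.prod P) F) with hτdef
  have hτs : τ = √(∫ z, F z ^ 2 ∂(P.prod P)) := l2Norm_eq hF hFM
  have hτ : ∫ z, F z ^ 2 ∂(P.prod P) = τ ^ 2 := by
    rw [hτs, Real.sq_sqrt (integral_nonneg fun z => sq_nonneg _)]
  have hCne : Nonempty C := ⟨⟨_, hfC (Classical.arbitrary ι)⟩⟩
  have hστ : σ ≤ τ := by
    rw [hτs, hσdef]
    refine Real.sqrt_le_sqrt (ciSup_le fun g => ?_)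
    refine integral_mono_of_nonneg (ae_of_all _ fun z => sq_nonneg _)
      (integrable_of_measurable_of_abs_le (c := M ^ 2) (hF.pow_const 2) fun z => by
        rw [abs_pow]; exact pow_le_pow_left₀ (abs_nonneg _) (hFM z) 2)
      (ae_of_all _ fun z => sq_le_sq_of_abs_le (henv g g.2 z))
  have hfσ : ∀ i, ∫ z, f i z ^ 2 ∂(P.prod P) ≤ σ ^ 2 := fun i => by
    rw [hσdef, sigma2_sq hσ]
    exact le_ciSup (bddAbove_range_integral_sq hC hFM henv) (⟨f i, hfC i⟩ : C)
  have hM0 : 0 < M := by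
    by_contra! hle
    have hF0 : ∀ z, F z ^ 2 = 0 := fun z => by
      have : |F z| = 0 := le_antisymm ((hFM z).trans hle) (abs_nonneg _)
      rw [abs_eq_zero.1 this]; norm_num
    simp only [hF0, integral_zero] at hτ
    nlinarith [hσ.trans_le hστ]
  have hLm := measurable_secondMoment P hF
  have hLM : ∀ x, |secondMoment P F x| ≤ M ^ 2 := fun x => by
    rw [abs_of_nonneg (secondMoment_nonneg P _ x)]; exact secondMoment_le hF hFM x
  set m := envLSup P F with hm
  have hmx : ∀ x, secondMoment P F x ≤ m := fun x => by
    refine le_ciSup (f := secondMoment P F) ⟨M ^ 2, ?_⟩ x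
    rintro _ ⟨y, rfl⟩
    exact secondMoment_le hF hFM y
  set τ₁ : ℝ := NNReal.toReal (l2Norm P (secondMoment P F)) with hτ1def
  have hτ1s : τ₁ = √(∫ x, secondMoment P F x ^ 2 ∂P) := l2Norm_eq hLm hLM
  have hτ1 : ∫ x, secondMoment P F x ^ 2 ∂P = τ₁ ^ 2 := by
    rw [hτ1s, Real.sq_sqrt (integral_nonneg fun z => sq_nonneg _)]
  have hστ1 : σ₁ ≤ τ₁ := by
    rw [hτ1s, hσ1def]
    exact Real.sqrt_le_sqrt (ciSup_le fun g =>
      integral_secondMoment_sq_le (hC g g.2) hF hFM (henv g g.2))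
  have hfσ1 : ∀ i, ∫ x, secondMoment P (f i) x ^ 2 ∂P ≤ σ₁ ^ 2 := fun i => by
    have h := le_ciSup (bddAbove_range_integral_secondMoment_sq (P := P) hC hF hFM henv)
      (⟨f i, hfC i⟩ : C)
    refine h.trans (le_of_eq ?_)
    rw [hσ1def, sigma1, Real.sq_sqrt]
    exact (Real.sqrt_pos.1 hσ1).le
  have hm0 : 0 < m := by
    by_contra! hle
    have hF0 : ∀ x, secondMoment P F x ^ 2 = 0 := fun x => by
      have : secondMoment P F x = 0 := le_antisymm ((hmx x).trans hle) (secondMoment_nonneg P F x)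
      rw [this]; norm_num
    simp only [hF0, integral_zero] at hτ1
    nlinarith [hσ1.trans_le hστ1]
  have hmnorm : (l2Norm P (fun _ : S => m) : ℝ) = m := by
    rw [l2Norm_eq measurable_const (c := |m|) fun _ => le_rfl]
    simp [Real.sqrt_sq hm0.le]
  -- the logarithms
  have hA0 : 0 < A := (Real.exp_pos 1).trans_le hA
  have hτ0 : 0 < τ := hσ.trans_le hστ
  have hτ10 : 0 < τ₁ := hσ1.trans_le hστ1
  set ℓ := log2 P C F A with hℓ
  have hℓe : Real.log (A * τ / σ) = ℓ := rfl
  have hℓ1 : 1 ≤ Real.log (A * τ / σ) := by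
    rw [Real.le_log_iff_exp_le (by positivity), mul_div_assoc]
    exact hA.trans (le_mul_of_one_le_right hA0.le ((one_le_div hσ).2 hστ))
  set ℓ₁ := log1 P C F A with hℓ1def
  have hℓ1e : Real.log (2 * A * τ₁ / σ₁) = ℓ₁ := rfl
  have hℓ1le : Real.log (A * τ₁ / σ₁) ≤ ℓ₁ := by
    rw [← hℓ1e]
    refine Real.log_le_log (by positivity) ?_
    gcongr
    linarith
  have hℓ11 : 1 ≤ ℓ₁ := by
    refine le_trans ?_ hℓ1le
    rw [Real.le_log_iff_exp_le (by positivity), mul_div_assoc]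
    exact hA.trans (le_mul_of_one_le_right hA0.le ((one_le_div hσ1).2 hστ1))
  -- constants
  set c := 1 / v₀ + 7 with hc
  have hc0 : 0 < c := by positivity
  set K₂ : ℝ := 208 * 832 * c ^ 2 with hK₂
  have hK₂0 : 0 < K₂ := by positivity
  have hv' : 0 < v := hv₀.trans_le hv
  have hn2 : (2 : ℝ) ≤ n := by exact_mod_cast hn
  have hn0 : (0 : ℝ) < n := by linarith
  have hN : 0 < (n : ℝ) * (n - 1) := by nlinarith
  have hn1' : (n : ℝ) - 1 ≠ 0 := (by linarith : (0 : ℝ) < n - 1).ne'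
  set h := v * ℓ with hh
  have hℓpos : 1 ≤ ℓ := hℓ1
  have hh0 : 0 < h := by positivity
  set h₁ := v * ℓ₁ with hh₁
  have hh₁0 : 0 < h₁ := by positivity
  set p := piTerm P C F A v n with hp
  have hp2 : σ₁ * √(h₁ / n) + m * (h₁ / n) = p ^ 2 := by
    have e : √(v * σ₁ ^ 2 / n * ℓ₁) = σ₁ * √(h₁ / n) := by
      rw [show v * σ₁ ^ 2 / n * ℓ₁ = σ₁ ^ 2 * (h₁ / n) by rw [hh₁]; ring,
        Real.sqrt_mul (by positivity), Real.sqrt_sq hσ1.le]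
    rw [hp, piTerm, Real.sq_sqrt]
    · rw [← hσ1def, ← hm, hmnorm, ← hℓ1def, e, hh₁]; ring
    · rw [← hσ1def, ← hm, hmnorm, ← hℓ1def]; positivity
  have hp0 : 0 ≤ p := Real.sqrt_nonneg _
  -- the second moment of the random radius
  set V : ℝ := ∫ x : Fin n → S, ⨆ i, |pairSum (fun z => f i z ^ 2) x| ∂(sampleLaw P n) with hV
  have hV0 : 0 ≤ V := integral_nonneg fun x => iSup_abs_nonneg _
  set t := √(V / (n * (n - 1))) with ht
  have ht0 : 0 ≤ t := Real.sqrt_nonneg _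
  have ht2 : t ^ 2 = V / (n * (n - 1)) := Real.sq_sqrt (by positivity)
  have hVb : V ≤ n * (n - 1) * (t + σ) ^ 2 := by
    have : V = n * (n - 1) * t ^ 2 := by rw [ht2]; field_simp
    rw [this]
    gcongr
    linarith
  have hsq := integral_iSup_pairSum_sq_le (n := n) P hf hfM (fun i => hsymm _ (hfC i)) (by omega) hfσ
  have hlin := integral_iSup_secondMoment_le (n := n) P hent hF hFM hf hfC hfF hA hv₀ hv hmx hm0
    hσ1 hστ1 hτ1 hfσ1 hℓ1le hℓ11 (by omega)
  have hch2 := integral_chaos_le_mul (n := n) P hent hF hFM hf hfC hfF hA hv₀ hv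
    (φ := fun s => s ^ 2) (by norm_num) (κ := 2 * M) (by positivity) (fun s t hs ht => by
      rw [sq_sub_sq, abs_mul]
      exact mul_le_mul_of_nonneg_right ((abs_add_le _ _).trans (by linarith)) (abs_nonneg _))
    hσ hστ (le_add_of_nonneg_left ht0) hτ hℓ1 hn hVb
  have hch1 := integral_chaos_le_mul (n := n) P hent hF hFM hf hfC hfF hA hv₀ hv
    (φ := id) rfl (κ := 1) one_pos (fun s t _ _ => (one_mul _).ge)
    hσ hστ (le_add_of_nonneg_left ht0) hτ hℓ1 hn hVb
  have hrand := integral_iSup_pairSum_le_chaos (n := n) P f hf hM0.le hfM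
    (fun i => hdeg _ (hfC i)) (fun i y => by
      simp only [hsymm _ (hfC i) _ y]
      exact hdeg _ (hfC i) y)
  rw [hℓe, ← hh, ← hc] at hch1 hch2
  rw [← hh₁, ← hc, ← hK₂, hp2] at hlin
  simp only [id] at hch1
  have hn1 : (0 : ℝ) ≤ n - 1 := by linarith
  have hVle : V ≤ n * (n - 1) * (σ ^ 2 + 2 * K₂ * p ^ 2 +
      1040 * c * (2 * M) * (h / n * (t + σ))) := by
    have := mul_le_mul_of_nonneg_left hlin (mul_nonneg zero_le_two hn1)
    linarith
  have hquad : t ^ 2 ≤ (σ ^ 2 + 2 * K₂ * p ^ 2) + (2080 * c * (M * (h / n))) * (t + σ) := by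
    rw [ht2, div_le_iff₀ hN]
    linarith
  have ht3 := le_of_sq_le_add_mul ht0 hσ.le (by positivity) (by positivity) hquad
  have ht4 : √(σ ^ 2 + 2 * K₂ * p ^ 2) ≤ σ + √(2 * K₂) * p := by
    refine (isGauge_sqrt.add_le _ _ (by positivity) (by positivity)).trans (le_of_eq ?_)
    rw [Real.sqrt_sq hσ.le, Real.sqrt_mul (by positivity), Real.sqrt_sq hp0]
  have hb : t + σ ≤ 3 * σ + √(2 * K₂) * p + 4160 * c * (M * (h / n)) := by linarith
  have hrate : rate P C F A v n = (h / n) * (σ + p + M * (h / n)) := by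
    rw [rate, ← hσdef, ← hp, ← hM, ← hℓ, hh]
    field_simp
  refine ⟨by rw [hrate]; positivity, ?_⟩
  have hu : ∀ x : Fin n → S, ⨆ i, |uStat x (f i)| =
      1 / (n * (n - 1)) * ⨆ i, |pairSum (f i) x| := fun x => by
    rw [Real.mul_iSup_of_nonneg (by positivity)]
    congr 1; ext i
    rw [← abs_of_nonneg (by positivity : (0 : ℝ) ≤ 1 / (n * (n - 1))), ← abs_mul]
    rfl
  simp only [hu]
  rw [integral_const_mul, hrate]
  have hs0 := Real.sqrt_nonneg (2 * K₂)
  calc _ ≤ 1 / ((n : ℝ) * (n - 1)) * (n * (n - 1) * (1040 * c * 1 * (h / n * (t + σ)))) := by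
        gcongr
        exact hrand.trans hch1
    _ = 1040 * c * (h / n * (t + σ)) := by field_simp
    _ ≤ 1040 * c * (h / n * ((3 + √(2 * K₂) + 4160 * c) * (σ + p + M * (h / n)))) := by
        gcongr 1040 * c * (h / n * ?_)
        refine hb.trans ?_
        have q0 : 0 ≤ M * (h / n) := by positivity
        have e1 := mul_nonneg hs0 hσ.le
        have e2 := mul_nonneg hs0 q0
        have e3 := mul_nonneg hc0.le hσ.le
        have e4 := mul_nonneg hc0.le hp0
        linarith
    _ = _ := by ring

end Bound

/-- Tail bound for the supremum over the whole class. -/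
theorem measure_lt_iSup_uStat_le {Ω S : Type*} [MeasurableSpace Ω] [MeasurableSpace S]
    (μ : Measure Ω) [IsProbabilityMeasure μ] (P : Measure S) [IsProbabilityMeasure P] {n : ℕ}
    (X : Fin n → Ω → S) (hXmeas : ∀ i, Measurable (X i)) (hXlaw : ∀ i, μ.map (X i) = P)
    (hXindep : iIndepFun X μ) {C : Set (S × S → ℝ)} (hC : PointwiseMeasurable C)
    {r κ δ : ℝ} (hr : 0 < r) (hκ : 0 < κ) (hδ : 0 < δ) {c : ℝ} (hc : ∀ f ∈ C, ∀ z, |f z| ≤ c)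
    (hbound : ∀ (k : ℕ) (f : Fin (k + 1) → S × S → ℝ), (∀ i, f i ∈ C) →
      ∫ x : Fin n → S, ⨆ i, |uStat x (f i)| ∂(sampleLaw P n) ≤ κ * r) :
    μ {ω | κ / δ * r < |(⨆ f : C, |uStat (fun i => X i ω) f.1|)|} ≤ ENNReal.ofReal δ := by
  obtain ⟨hCm, G, hGC, hGc, hGlim⟩ := hC
  have hX : Measurable fun ω i => X i ω := measurable_pi_lambda _ hXmeas
  have hmap : μ.map (fun ω i => X i ω) = sampleLaw P n := by
    rw [(iIndepFun_iff_map_fun_eq_pi_map fun i => (hXmeas i).aemeasurable).1 hXindep]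
    simp only [hXlaw]
  have hpos : 0 < κ / δ * r := by positivity
  rcases G.eq_empty_or_nonempty with hG | hG
  · have hCe : IsEmpty C := ⟨fun f => by
      obtain ⟨g, hg, -⟩ := hGlim f f.2
      simpa [hG] using hg 0⟩
    simp only [Real.iSup_of_isEmpty, abs_zero, not_lt.2 hpos.le]
    exact (measure_empty (μ := μ)).trans_le zero_le
  obtain ⟨g, rfl⟩ := hGc.exists_eq_range hG
  have hgC : ∀ i, g i ∈ C := fun i => hGC ⟨i, rfl⟩
  have huc : ∀ f : S × S → ℝ, Measurable f → Measurable fun x : Fin n → S => uStat x f :=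
    fun f hf => (measurable_pairSum hf).const_mul _
  let E : ℕ → Set Ω := fun k =>
    {ω | κ / δ * r < ⨆ i : Fin (k + 1), |uStat (fun j => X j ω) (g i)|}
  have hsub : {ω | κ / δ * r < |(⨆ f : C, |uStat (fun i => X i ω) f.1|)|} ⊆ ⋃ k, E k := by
    intro ω hω
    replace hω : κ / δ * r < |(⨆ f : C, |uStat (fun i => X i ω) f.1|)| := hω
    rw [abs_of_nonneg (Real.iSup_nonneg fun f => abs_nonneg _)] at hω
    have hCne : Nonempty C := ⟨⟨_, hgC 0⟩⟩
    obtain ⟨f, hf⟩ := exists_lt_of_lt_ciSup hω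
    obtain ⟨w, hw, hlim⟩ := hGlim f.1 f.2
    have hl : Tendsto (fun q => |uStat (fun i => X i ω) (w q)|) atTop
        (𝓝 |uStat (fun i => X i ω) f.1|) :=
      ((tendsto_finsetSum _ fun i _ => tendsto_finsetSum _ fun j _ => hlim _).const_mul _).abs
    obtain ⟨q, hq⟩ := (hl.eventually (lt_mem_nhds hf)).exists
    obtain ⟨k, hk⟩ := hw q
    refine Set.mem_iUnion.2 ⟨k, lt_of_lt_of_le hq ?_⟩
    rw [← hk]
    exact le_iSup_abs (fun i : Fin (k + 1) => uStat (fun j => X j ω) (g i)) (Fin.last k)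
  have hmono : Monotone E := by
    intro k l hkl ω hω
    refine lt_of_lt_of_le hω (iSup_abs_le (fun i => ?_) (iSup_abs_nonneg _))
    exact le_iSup_abs (fun i : Fin (l + 1) => uStat (fun j => X j ω) (g i))
      (Fin.castLE (by omega) i)
  refine (measure_mono hsub).trans ?_
  rw [hmono.measure_iUnion]
  refine iSup_le fun k => ?_
  have hYm : Measurable fun x : Fin n → S => ⨆ i : Fin (k + 1), |uStat x (g i)| :=
    measurable_iSup_abs fun i => huc _ (hCm _ (hgC i))
  have hYi : Integrable (fun x : Fin n → S => ⨆ i : Fin (k + 1), |uStat x (g i)|)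
      (sampleLaw P n) := by
    have hc0 : 0 ≤ |1 / ((n : ℝ) * (n - 1))| * (n * (n - 1) * |c|) := by
      have := mul_pred_nonneg n
      positivity
    refine integrable_iSup_abs (fun i => huc _ (hCm _ (hgC i))) hc0 fun i x => ?_
    unfold uStat
    rw [abs_mul]
    gcongr
    exact abs_pairSum_le (fun z => (hc _ (hgC i) z).trans (le_abs_self c)) x
  have hE : μ (E k) = sampleLaw P n {x | κ / δ * r < ⨆ i : Fin (k + 1), |uStat x (g i)|} := by
    rw [← hmap, Measure.map_apply hX (measurableSet_lt measurable_const hYm)]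
    rfl
  rw [hE]
  have hmk := mul_meas_ge_le_integral_of_nonneg (μ := sampleLaw P n)
    (ae_of_all _ fun x => iSup_abs_nonneg fun i : Fin (k + 1) => uStat x (g i)) hYi (κ / δ * r)
  have hle := hmk.trans (hbound k (fun i => g i) fun i => hgC i)
  have h1 : (sampleLaw P n).real {x | κ / δ * r ≤ ⨆ i : Fin (k + 1), |uStat x (g i)|} ≤ δ := by
    have : κ / δ * r * δ = κ * r := by field_simp
    rw [← this] at hle
    exact le_of_mul_le_mul_left hle hpos
  have hsub' : {x : Fin n → S | κ / δ * r < ⨆ i : Fin (k + 1), |uStat x (g i)|} ⊆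
      {x | κ / δ * r ≤ ⨆ i : Fin (k + 1), |uStat x (g i)|} := fun x hx => by
    rw [Set.mem_ofPred_eq] at hx ⊢
    exact hx.le
  refine (measure_mono hsub').trans ?_
  rw [← ofReal_measureReal]
  exact ENNReal.ofReal_le_ofReal h1

end

end UStatistic

theorem mainTheorem9 {Ω S : ℕ → Type*}
    [∀ n, MeasurableSpace (Ω n)] [∀ n, MeasurableSpace (S n)]
    (μ : ∀ n, Measure (Ω n)) [∀ n, IsProbabilityMeasure (μ n)]
    (P : ∀ n, Measure (S n)) [∀ n, IsProbabilityMeasure (P n)]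
    -- for every `n`, an i.i.d. sample of size `n` from `P n`
    (X : ∀ n, Fin n → Ω n → S n)
    (hXmeas : ∀ n i, Measurable (X n i))
    (hXlaw : ∀ n i, (μ n).map (X n i) = P n)
    (hXindep : ∀ n, iIndepFun (X n) (μ n))
    -- the class of kernels and its bounded envelope
    (C : ∀ n, Set (S n × S n → ℝ))
    (hC : ∀ n, UStatistic.PointwiseMeasurable (C n))
    (hsymm : ∀ n, ∀ f ∈ C n, ∀ x y, f (x, y) = f (y, x))
    (hdeg : ∀ n, ∀ f ∈ C n, UStatistic.Degenerate (P n) f)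
    (F : ∀ n, S n × S n → ℝ)
    (hFmeas : ∀ n, Measurable (F n))
    (hFbdd : ∀ n, BddAbove (Set.range (F n)))
    (henv : ∀ n, ∀ f ∈ C n, ∀ z, |f z| ≤ F n z)
    (hσ : ∀ n, 0 < UStatistic.sigma2 (P n) (C n))
    -- the entropy bound
    (A v : ℕ → ℝ) (hA : ∀ n, Real.exp 1 ≤ A n)
    (v₀ : ℝ) (hv₀ : 0 < v₀) (hv : ∀ n, v₀ ≤ v n)
    (hent : ∀ n, UStatistic.UniformEntropyBound (C n) (F n) (A n) (v n)) :
    UStatistic.IsBigOp μ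
      (fun n ω => ⨆ f : C n, |UStatistic.uStat (fun i => X n i ω) f.1|)
      (fun n => UStatistic.rate (P n) (C n) (F n) (A n) (v n) n) := by
  intro δ hδ
  set κ : ℝ := 1040 * (1 / v₀ + 7) *
    (3 + √(2 * (208 * 832 * (1 / v₀ + 7) ^ 2)) + 4160 * (1 / v₀ + 7)) with hκ
  have hκ0 : 0 < κ := by positivity
  refine ⟨κ / δ, by positivity, eventually_atTop.2 ⟨2, fun n hn => ?_⟩⟩
  have hmain := fun (k : ℕ) (f : Fin (k + 1) → S n × S n → ℝ) (hf : ∀ i, f i ∈ C n) =>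
    UStatistic.integral_iSup_uStat_le (n := n) (P n) (hC n).1 (hsymm n) (hdeg n) (hFmeas n)
      (hFbdd n) (henv n) (hσ n) (hA n) hv₀ (hv n) (hent n) hf hn
  have hCne : (C n).Nonempty := by
    by_contra hne
    rw [Set.not_nonempty_iff_eq_empty] at hne
    have := hσ n
    rw [hne, UStatistic.sigma2, Real.iSup_of_isEmpty, Real.sqrt_zero] at this
    exact lt_irrefl _ this
  obtain ⟨f₀, hf₀⟩ := hCne
  exact UStatistic.measure_lt_iSup_uStat_le (μ n) (P n) (X n) (hXmeas n) (hXlaw n) (hXindep n)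
    (hC n) (hmain 0 (fun _ => f₀) fun _ => hf₀).1 hκ0 hδ
    (fun f hf z => (henv n f hf z).trans (le_ciSup (hFbdd n) z)) fun k f hf => (hmain k f hf).2
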